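/- **Setting.** Fix reals $\delta,\lambda>0$ and a vertex set $V$ of size $n$. Put $g=\lceil\log_{1+\delta}n\rceil$ and $K=4g^2$. A *level data structure* (LDS) stores a simple graph $G$ on $V$ and a level $\ell(v)\in\{0,\dots,K\}$ for each vertex; level $\ell$ lies in group $\lfloor \ell/(4g)\rfloor$. *Invariant 1* at $v$: if $\ell(v)<K$ lies in group $i$, then $v$ has at most $(2+3/\lambda)(1+\delta)^i$ neighbours on levels $\ge\ell(v)$. *Invariant 2* at $v$: if $\ell(v)>0$ and $\ell(v)-1$ lies in group $i$, then $v$ has at least $(1+\delta)^i$ neighbours on levels $\ge\ell(v)-1$. The coreness estimate of $v$ is $(1+\delta)^{\max(\lfloor(\ell(v)+1)/(4g)\rfloor-1,\,0)}$ (quotients by $0$ count as $0$). In the *sequential* LDS, an update inserts or deletes one edge and then, as long as an invariant is violated, moves a vertex that violates Invariant 1 one level up or a vertex that violates Invariant 2 one level down; a read of $v$ returns the coreness estimate of $v$. Initially $G$ is empty and all levels are $0$. **The concurrent structure.** Batches of updates run one after another, concurrently with asynchronous reads by any number of processes; the steps are atomic and interleave arbitrarily, and process failures are allowed. Besides the LDS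 there are a batch number and an array which holds, for each vertex, either UNMARKED or a descriptor: an old level and a parent, where roots have no parent. The marked vertices thereby form disjoint DAGs, each with one root. *Batches.* A batch $\mathcal B$ consists of insertions only or of deletions only; all its updates are invoked and respond with it. It increments the batch number, modifies its edges in $G$ one by one, and performs rounds $\ell=0,\dots,K-1$. In round $\ell$ of an insertion batch, every vertex on level $\ell$ violating Invariant 1 is moved to level $\ell+1$; in round $\ell$ of a deletion batch, every vertex that violates Invariant 2 and whose desire-level is $\ell$ (the closest lower level on which it would satisfy Invariant 2) is moved to level $\ell$. A vertex is marked before its first move. Marking $v$ first collects the roots of the DAGs of all marked vertices $w$ such that $vw\in\mathcal B$, or $w$ is a neighbour of $v$ and (for insertions) $\ell(w)\ge\ell(v)$. It then makes one of these roots the parent of the others, and finally stores for $v$ a descriptor with its current level and that root as its parent (if there is no such $w$, then $v$ becomes the root of a new DAG). Marking procedures exclude each other; moves and reads may interleave with them. After the last round all roots are unmarked, then all other marked vertices, and then the batch returns. *Reads.* A read of $v$ repeats the following: read the batch number ($b_1$), the live level of $v$ ($l_1$), and the descriptor of $v$; follow parents, one array entry per step, until an unmarked vertex or a marked root is found; read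 the live level of $v$ ($l_2$) and the batch number ($b_2$). If $b_1=b_2$ and a marked root was found, it returns the coreness estimate for the old level in the descriptor of $v$. If $b_1=b_2$, an unmarked vertex was found and $l_1=l_2$, it returns the estimate for $l_2$. Otherwise it retries. **Linearization points.** The steps of an execution happen at strictly increasing real times, and edges carry distinct identifiers $id(e)\in\{1,\dots,n(n-1)/2\}$. Consider batches that have reached the unmarking. An update of $e$ in such a batch $\mathcal B$ is *visible* if $\mathcal B$ changes the level of at least one endpoint of $e$, and *invisible* otherwise. - An invisible update is linearized at the step of $\mathcal B$ that modifies $e$. - A visible update is linearized at $T+(T'-T)\cdot\frac{id(e)}{n(n-1)/2+1}$, where $T$ is the time at which the root of its DAG (the DAG containing the endpoints of $e$ that change levels) is unmarked in $\mathcal B$, and $T'$ is the time of the next step in the system (if the execution ends at $T$, any later time). It has no linearization point if this root is never unmarked. - A read that has returned is linearized at its last read of the descriptor of $v$, if it returned the estimate for an old level, and at its last read of $l_2$, if it returned the estimate for the live level. Other operations have no linearization point. **Theorem.** In every finite or infinite execution the following hold. 1. If $e=uv$ is updated in a batch that reaches the unmarking, and the batch changes the levels of both $u$ and $v$, then both are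 marked when the unmarking begins, and $u$ and $v$ are in the same DAG at every moment of the batch, up to the beginning of the unmarking, when both are marked. Every visible update belongs to exactly one DAG. 2. The execution is linearizable with respect to the sequential LDS, by means of the points above. Each operation has at most one point, and every operation that has responded has one; the point falls strictly after the invocation of the operation and, if it has responded, strictly before the response; distinct operations have distinct points. For each step, the operations with points before that step, executed by the sequential LDS in the order of their points, form a legal sequential execution in which every read returns exactly the value that it returned in the concurrent execution. -/

import Mathlib

noncomputable section

namespace CPLDS

/-! ## The level data structure -/

/-- The two constants of the level data structure. -/
structure Params where
  δ : ℝ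
  lam : ℝ
  δ_pos : 0 < δ
  lam_pos : 0 < lam

/-- The number of groups of levels, `⌈log_{1+δ} n⌉`. -/
def Params.numGroups (prm : Params) (n : ℕ) : ℕ := ⌈Real.logb (1 + prm.δ) n⌉₊

/-- The number of levels in a group, `4 ⌈log_{1+δ} n⌉`. -/
def Params.groupSize (prm : Params) (n : ℕ) : ℕ := 4 * prm.numGroups n

/-- The top level `K`; the levels are `0, …, K`. -/
def Params.topLevel (prm : Params) (n : ℕ) : ℕ := prm.numGroups n * prm.groupSize n

/-- The index of the group that contains level `ℓ`. -/
def Params.group (prm : Params) (n ℓ : ℕ) : ℕ := ℓ / prm.groupSize n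

/-- The coreness estimate `(1+δ)^{max(⌊(ℓ+1)/(4⌈log_{1+δ} n⌉)⌋ - 1, 0)}` of a vertex on level `ℓ`
(the truncated subtraction is the maximum with `0`). -/
def Params.estimate (prm : Params) (n ℓ : ℕ) : ℝ :=
  (1 + prm.δ) ^ ((ℓ + 1) / prm.groupSize n - 1)

/-- The number of neighbours of `v` on level `ℓ` or higher. -/
def degAbove {n : ℕ} (G : SimpleGraph (Fin n)) (L : Fin n → ℕ) (v : Fin n) (ℓ : ℕ) : ℕ :=
  {w | G.Adj v w ∧ ℓ ≤ L w}.ncard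

/-- Invariant 1 (degree upper bound) at `v`: below the top level, a vertex on level `ℓ` of group `i`
has at most `(2 + 3/λ)(1+δ)^i` neighbours on levels `≥ ℓ`. -/
def UpperInv {n : ℕ} (prm : Params) (G : SimpleGraph (Fin n)) (L : Fin n → ℕ) (v : Fin n) : Prop :=
  L v < prm.topLevel n →
    (degAbove G L v (L v) : ℝ) ≤ (2 + 3 / prm.lam) * (1 + prm.δ) ^ prm.group n (L v)

/-- The condition of Invariant 2 for `v`, evaluated as if `v` were on level `ℓ`: either `ℓ = 0`, or
`v` has at least `(1+δ)^i` neighbours on levels `≥ ℓ - 1`, where level `ℓ - 1` is in group `i`. -/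
def LowerOK {n : ℕ} (prm : Params) (G : SimpleGraph (Fin n)) (L : Fin n → ℕ) (v : Fin n) (ℓ : ℕ) :
    Prop :=
  0 < ℓ → (1 + prm.δ) ^ prm.group n (ℓ - 1) ≤ (degAbove G L v (ℓ - 1) : ℝ)

/-- Invariant 2 (degree lower bound) at `v`. -/
def LowerInv {n : ℕ} (prm : Params) (G : SimpleGraph (Fin n)) (L : Fin n → ℕ) (v : Fin n) : Prop :=
  LowerOK prm G L v (L v)

/-- `ℓ` is the desire-level of a vertex `v` that violates Invariant 2: the closest level below the
current one on which `v` would satisfy Invariant 2. -/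
def IsDesireLevel {n : ℕ} (prm : Params) (G : SimpleGraph (Fin n)) (L : Fin n → ℕ) (v : Fin n)
    (ℓ : ℕ) : Prop :=
  ℓ < L v ∧ LowerOK prm G L v ℓ ∧ ∀ j, ℓ < j → j ≤ L v → ¬ LowerOK prm G L v j

/-- A batch consists of insertions only or of deletions only. -/
inductive Kind where
  | insertion
  | deletion

/-- Insert the edge `e` into `G`, or delete it from `G`. -/
def applyEdge {n : ℕ} (G : SimpleGraph (Fin n)) : Kind → Sym2 (Fin n) → SimpleGraph (Fin n)
  | .insertion, e => G ⊔ SimpleGraph.fromEdgeSet {e}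
  | .deletion, e => G.deleteEdges {e}

/-! ## The sequential specification

The sequential object is the sequential level data structure. An update changes one edge and then
moves vertices that violate an invariant, one level at a time, until no vertex violates one; a read
of `v` returns the coreness estimate given by the level of `v`. -/

/-- The state of the sequential object. -/
structure SeqState (n : ℕ) where
  G : SimpleGraph (Fin n)
  level : Fin n → ℕ

/-- The empty graph, with all vertices on level `0`. -/
def SeqState.init (n : ℕ) : SeqState n := ⟨⊥, fun _ => 0⟩

/-- One rebalancing move. -/
inductive MoveStep {n : ℕ} (prm : Params) (G : SimpleGraph (Fin n)) :
    (Fin n → ℕ) → (Fin n → ℕ) → Prop where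
  | up (L : Fin n → ℕ) (v : Fin n) (h : ¬ UpperInv prm G L v) :
      MoveStep prm G L (Function.update L v (L v + 1))
  | down (L : Fin n → ℕ) (v : Fin n) (h : ¬ LowerInv prm G L v) :
      MoveStep prm G L (Function.update L v (L v - 1))

/-- `L'` results from `L` by rebalancing until both invariants hold everywhere. -/
def Rebalance {n : ℕ} (prm : Params) (G : SimpleGraph (Fin n)) (L L' : Fin n → ℕ) : Prop :=
  Relation.ReflTransGen (MoveStep prm G) L L' ∧ ∀ v, UpperInv prm G L' v ∧ LowerInv prm G L' v

/-- An operation instance of a concurrent execution: an update of the edge `e`, part of the batch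
that is invoked at step `inv`, or a read of the coreness estimate of `v` by process `p`, invoked at
step `inv` and returning `val`. -/
inductive Op (n : ℕ) (P : Type*) where
  | update (inv : ℕ) (κ : Kind) (e : Sym2 (Fin n))
  | read (inv : ℕ) (p : P) (v : Fin n) (val : ℝ)

/-- The step at which an operation is invoked. -/
def Op.inv {n : ℕ} {P : Type*} : Op n P → ℕ
  | .update i _ _ => i
  | .read i _ _ _ => i

/-- The effect of an operation on the sequential object; for a read, the returned value must be the
one the sequential object returns. -/
inductive SeqStep {n : ℕ} {P : Type*} (prm : Params) : SeqState n → Op n P → SeqState n → Prop where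
  | update (S : SeqState n) (i : ℕ) (κ : Kind) (e : Sym2 (Fin n)) (L' : Fin n → ℕ)
      (h : Rebalance prm (applyEdge S.G κ e) S.level L') :
      SeqStep prm S (.update i κ e) ⟨applyEdge S.G κ e, L'⟩
  | read (S : SeqState n) (i : ℕ) (p : P) (v : Fin n) :
      SeqStep prm S (.read i p v (prm.estimate n (S.level v))) S

/-- Executing the operations of a list one after the other takes `S` to `S'`. -/
inductive SeqRun {n : ℕ} {P : Type*} (prm : Params) :
    SeqState n → List (Op n P) → SeqState n → Prop where
  | nil (S : SeqState n) : SeqRun prm S [] S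
  | cons (S S' S'' : SeqState n) (o : Op n P) (l : List (Op n P))
      (h : SeqStep prm S o S') (hl : SeqRun prm S' l S'') : SeqRun prm S (o :: l) S''

/-! ## Shared memory and process states -/

/-- The descriptor of a marked vertex: its level before the batch, and its parent in its DAG
(`none` for a root). -/
structure Desc (n : ℕ) where
  oldLevel : ℕ
  parent : Option (Fin n)

/-- The descriptor array; `none` means `UNMARKED`. -/
abbrev DescArray (n : ℕ) := Fin n → Option (Desc n)

/-- `b` is the parent of the marked vertex `a`. -/
def ParentOf {n : ℕ} (D : DescArray n) (a b : Fin n) : Prop :=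
  ∃ d, D a = some d ∧ d.parent = some b

/-- `r` is marked and is a root. -/
def IsRoot {n : ℕ} (D : DescArray n) (r : Fin n) : Prop :=
  ∃ d, D r = some d ∧ d.parent = none

/-- `r` is the root of the DAG that contains `v`. -/
def RootOf {n : ℕ} (D : DescArray n) (v r : Fin n) : Prop :=
  Relation.ReflTransGen (ParentOf D) v r ∧ IsRoot D r

/-- A marking procedure in progress: the vertex that is being marked, the roots that still have to
be linked, and the root of the merged DAG (`none` if no DAG is merged, so that the vertex becomes
the root of a new DAG). -/
structure MarkTask (n : ℕ) where
  vertex : Fin n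
  toLink : Finset (Fin n)
  newRoot : Option (Fin n)

/-- The program counter of the update side, with its private data. -/
inductive Phase (n : ℕ) where
  | quiescent
  | invoked (κ : Kind) (B : Finset (Sym2 (Fin n)))
  | editing (κ : Kind) (B todo : Finset (Sym2 (Fin n)))
  | rebalancing (κ : Kind) (B : Finset (Sym2 (Fin n))) (ℓ : ℕ) (task : Option (MarkTask n))
  | unmarkingRoots
  | unmarkingRest

/-- The program counter of a reading process, with its local variables: the vertex `v`, the first
batch number `b₁`, the first live level `l₁`, the descriptor `d` of `v`, the descriptor `cur` that
`check_DAG` is looking at, its result, and the second live level `l₂`. -/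
inductive Reader (n : ℕ) where
  | idle
  | start (v : Fin n)
  | gotB1 (v : Fin n) (b₁ : ℕ)
  | gotL1 (v : Fin n) (b₁ l₁ : ℕ)
  | checking (v : Fin n) (b₁ l₁ : ℕ) (d cur : Option (Desc n))
  | checked (v : Fin n) (b₁ l₁ : ℕ) (d : Option (Desc n)) (marked : Bool)
  | gotL2 (v : Fin n) (b₁ l₁ : ℕ) (d : Option (Desc n)) (marked : Bool) (l₂ : ℕ)
  | returningOld (oldLevel : ℕ)
  | returningLive (liveLevel : ℕ)

/-- A configuration of the system. `P` is the set of reading processes. -/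
structure Config (n : ℕ) (P : Type*) where
  G : SimpleGraph (Fin n)
  level : Fin n → ℕ
  desc : DescArray n
  batchNum : ℕ
  phase : Phase n
  reader : P → Reader n

/-- The initial configuration: empty graph, all vertices unmarked on level `0`, nothing running. -/
def Config.init (n : ℕ) (P : Type*) : Config n P :=
  ⟨⊥, fun _ => 0, fun _ => none, 0, .quiescent, fun _ => .idle⟩

/-- In round `ℓ` of a batch, `v` has to be moved. Insertions: `v` is on level `ℓ` and violates
Invariant 1. Deletions: `v` violates Invariant 2 and its desire-level is `ℓ`. -/
def Config.NeedsMove {n : ℕ} {P : Type*} (prm : Params) (c : Config n P) (ℓ : ℕ) (v : Fin n) :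
    Kind → Prop
  | .insertion => c.level v = ℓ ∧ ¬ UpperInv prm c.G c.level v
  | .deletion => IsDesireLevel prm c.G c.level v ℓ

/-- The level to which a vertex is moved in round `ℓ`. -/
def destination (ℓ : ℕ) : Kind → ℕ
  | .insertion => ℓ + 1
  | .deletion => ℓ

/-- When `v` is marked, its DAG is merged with that of the marked vertex `w`: either `w` is a marked
batch neighbour of `v`, or it is a marked neighbour that can be causally related to the move
of `v`. For insertions these are the marked neighbours that are on the level of `v` or higher; for
deletions they are all the marked neighbours (all of them move to a level below that of `v`). -/
def Config.Related {n : ℕ} {P : Type*} (c : Config n P) (B : Finset (Sym2 (Fin n)))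
    (v w : Fin n) (κ : Kind) : Prop :=
  c.desc w ≠ none ∧
    (s(v, w) ∈ B ∨
      c.G.Adj v w ∧
        match κ with
        | .insertion => c.level v ≤ c.level w
        | .deletion => True)

/-- What happens at a step. Steps of the update side that play no role in the definition of
linearization points are `internal`. -/
inductive Event (n : ℕ) (P : Type*) where
  | batchInv (κ : Kind) (B : Finset (Sym2 (Fin n)))
  | batchResp
  | modify (e : Sym2 (Fin n))
  | beginUnmark
  | unmarkRoot (r : Fin n)
  | internal
  | readInv (p : P) (v : Fin n)
  | readB1 (p : P)
  | readL1 (p : P)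
  | readDesc (p : P)
  | checkDAG (p : P)
  | readL2 (p : P)
  | readB2 (p : P)
  | returnOld (p : P) (val : ℝ)
  | returnLive (p : P) (val : ℝ)

/-! ## The algorithm -/

/-- The atomic steps of the update side.

A batch increments the batch number, modifies its edges in `G` in any order, and runs through the
rounds `ℓ = 0, …, K - 1`. In round `ℓ` each vertex that has to be moved is first marked, if it is
not yet marked, and is later moved; marking procedures exclude each other, but moves may happen
between the steps of a marking procedure. Marking `v` collects the roots of the DAGs of all related
marked vertices (`roots_to_merge`), makes one of them the parent of the others, and then publishes
the descriptor of `v`, whose parent is that root. After the last round all the roots are unmarked,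
then all the remaining vertices, and the batch returns. -/
inductive UpdateStep {n : ℕ} {P : Type*} (prm : Params) :
    Config n P → Event n P → Config n P → Prop where
  | invoke (c : Config n P) (κ : Kind) (B : Finset (Sym2 (Fin n)))
      (hph : c.phase = .quiescent) (hB : ∀ e ∈ B, ¬ e.IsDiag) :
      UpdateStep prm c (.batchInv κ B) { c with phase := .invoked κ B }
  | tick (c : Config n P) (κ : Kind) (B : Finset (Sym2 (Fin n)))
      (hph : c.phase = .invoked κ B) :
      UpdateStep prm c .internal
        { c with batchNum := c.batchNum + 1, phase := .editing κ B B }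
  | modify (c : Config n P) (κ : Kind) (B todo : Finset (Sym2 (Fin n))) (e : Sym2 (Fin n))
      (hph : c.phase = .editing κ B todo) (he : e ∈ todo) :
      UpdateStep prm c (.modify e)
        { c with G := applyEdge c.G κ e, phase := .editing κ B (todo.erase e) }
  | editsDone (c : Config n P) (κ : Kind) (B : Finset (Sym2 (Fin n)))
      (hph : c.phase = .editing κ B ∅) :
      UpdateStep prm c .internal { c with phase := .rebalancing κ B 0 none }
  | markNewDAG (c : Config n P) (κ : Kind) (B : Finset (Sym2 (Fin n))) (ℓ : ℕ) (v : Fin n)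
      (hph : c.phase = .rebalancing κ B ℓ none)
      (hv : c.NeedsMove prm ℓ v κ) (hunm : c.desc v = none)
      (hR : ∀ w, ¬ c.Related B v w κ) :
      UpdateStep prm c .internal
        { c with phase := .rebalancing κ B ℓ (some ⟨v, ∅, none⟩) }
  | markMerge (c : Config n P) (κ : Kind) (B : Finset (Sym2 (Fin n))) (ℓ : ℕ) (v : Fin n)
      (hph : c.phase = .rebalancing κ B ℓ none)
      (hv : c.NeedsMove prm ℓ v κ) (hunm : c.desc v = none)
      (rootsToMerge : Finset (Fin n))
      (hR : ∀ r, r ∈ rootsToMerge ↔ ∃ w, c.Related B v w κ ∧ RootOf c.desc w r)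
      (newRoot : Fin n) (hr : newRoot ∈ rootsToMerge) :
      UpdateStep prm c .internal
        { c with phase :=
            .rebalancing κ B ℓ (some ⟨v, rootsToMerge.erase newRoot, some newRoot⟩) }
  | link (c : Config n P) (κ : Kind) (B : Finset (Sym2 (Fin n))) (ℓ : ℕ)
      (v newRoot x : Fin n) (todo : Finset (Fin n)) (d : Desc n)
      (hph : c.phase = .rebalancing κ B ℓ (some ⟨v, todo, some newRoot⟩))
      (hx : x ∈ todo) (hd : c.desc x = some d) :
      UpdateStep prm c .internal
        { c with
          desc := Function.update c.desc x (some ⟨d.oldLevel, some newRoot⟩)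
          phase := .rebalancing κ B ℓ (some ⟨v, todo.erase x, some newRoot⟩) }
  | publish (c : Config n P) (κ : Kind) (B : Finset (Sym2 (Fin n))) (ℓ : ℕ)
      (v : Fin n) (newRoot : Option (Fin n))
      (hph : c.phase = .rebalancing κ B ℓ (some ⟨v, ∅, newRoot⟩)) :
      UpdateStep prm c .internal
        { c with
          desc := Function.update c.desc v (some ⟨c.level v, newRoot⟩)
          phase := .rebalancing κ B ℓ none }
  | move (c : Config n P) (κ : Kind) (B : Finset (Sym2 (Fin n))) (ℓ : ℕ)
      (task : Option (MarkTask n)) (v : Fin n)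
      (hph : c.phase = .rebalancing κ B ℓ task)
      (hv : c.NeedsMove prm ℓ v κ) (hmarked : c.desc v ≠ none) :
      UpdateStep prm c .internal
        { c with level := Function.update c.level v (destination ℓ κ) }
  | nextRound (c : Config n P) (κ : Kind) (B : Finset (Sym2 (Fin n))) (ℓ : ℕ)
      (hph : c.phase = .rebalancing κ B ℓ none) (hℓ : ℓ < prm.topLevel n)
      (hdone : ∀ v, ¬ c.NeedsMove prm ℓ v κ) :
      UpdateStep prm c .internal { c with phase := .rebalancing κ B (ℓ + 1) none }
  | beginUnmark (c : Config n P) (κ : Kind) (B : Finset (Sym2 (Fin n)))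
      (hph : c.phase = .rebalancing κ B (prm.topLevel n) none) :
      UpdateStep prm c .beginUnmark { c with phase := .unmarkingRoots }
  | unmarkRoot (c : Config n P) (r : Fin n)
      (hph : c.phase = .unmarkingRoots) (hr : IsRoot c.desc r) :
      UpdateStep prm c (.unmarkRoot r) { c with desc := Function.update c.desc r none }
  | rootsDone (c : Config n P)
      (hph : c.phase = .unmarkingRoots) (hr : ∀ r, ¬ IsRoot c.desc r) :
      UpdateStep prm c .internal { c with phase := .unmarkingRest }
  | unmarkOther (c : Config n P) (v : Fin n)
      (hph : c.phase = .unmarkingRest) (hv : c.desc v ≠ none) :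
      UpdateStep prm c .internal { c with desc := Function.update c.desc v none }
  | respond (c : Config n P)
      (hph : c.phase = .unmarkingRest) (hv : ∀ v, c.desc v = none) :
      UpdateStep prm c .batchResp { c with phase := .quiescent }

/-- The atomic steps of process `p` executing a read of the coreness estimate of `v`:
```
repeat
  b₁ := batch_number
  l₁ := LDS.get_level(v)
  d  := desc_array[v]
  status := check_DAG(d)
  l₂ := LDS.get_level(v)
  b₂ := batch_number
  if b₁ = b₂ then
    if status = MARKED then return estimate(d.old_level)
    else if l₁ = l₂ then return estimate(l₂)
```
where `check_DAG` follows the parents, reading one entry of the descriptor array per step, until it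
meets an unmarked vertex (result `UNMARKED`) or a marked root (result `MARKED`).
`ReadStep prm p c s a s'` says that in configuration `c` the process can go from local state `s`
to `s'`, with event `a`; such a step does not change the shared memory. -/
inductive ReadStep {n : ℕ} {P : Type*} (prm : Params) (p : P) (c : Config n P) :
    Reader n → Event n P → Reader n → Prop where
  | invoke (v : Fin n) : ReadStep prm p c .idle (.readInv p v) (.start v)
  | readB1 (v : Fin n) : ReadStep prm p c (.start v) (.readB1 p) (.gotB1 v c.batchNum)
  | readL1 (v : Fin n) (b₁ : ℕ) :
      ReadStep prm p c (.gotB1 v b₁) (.readL1 p) (.gotL1 v b₁ (c.level v))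
  | readDesc (v : Fin n) (b₁ l₁ : ℕ) :
      ReadStep prm p c (.gotL1 v b₁ l₁) (.readDesc p) (.checking v b₁ l₁ (c.desc v) (c.desc v))
  | checkUnmarked (v : Fin n) (b₁ l₁ : ℕ) (d : Option (Desc n)) :
      ReadStep prm p c (.checking v b₁ l₁ d none) (.checkDAG p) (.checked v b₁ l₁ d false)
  | checkMarked (v : Fin n) (b₁ l₁ : ℕ) (d : Option (Desc n)) (old : ℕ) :
      ReadStep prm p c (.checking v b₁ l₁ d (some ⟨old, none⟩)) (.checkDAG p)
        (.checked v b₁ l₁ d true)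
  | checkParent (v : Fin n) (b₁ l₁ : ℕ) (d : Option (Desc n)) (old : ℕ) (q : Fin n) :
      ReadStep prm p c (.checking v b₁ l₁ d (some ⟨old, some q⟩)) (.checkDAG p)
        (.checking v b₁ l₁ d (c.desc q))
  | readL2 (v : Fin n) (b₁ l₁ : ℕ) (d : Option (Desc n)) (m : Bool) :
      ReadStep prm p c (.checked v b₁ l₁ d m) (.readL2 p) (.gotL2 v b₁ l₁ d m (c.level v))
  | retryBatch (v : Fin n) (b₁ l₁ : ℕ) (d : Option (Desc n)) (m : Bool) (l₂ : ℕ)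
      (h : b₁ ≠ c.batchNum) :
      ReadStep prm p c (.gotL2 v b₁ l₁ d m l₂) (.readB2 p) (.start v)
  | acceptOld (v : Fin n) (b₁ l₁ : ℕ) (d : Desc n) (l₂ : ℕ) (h : b₁ = c.batchNum) :
      ReadStep prm p c (.gotL2 v b₁ l₁ (some d) true l₂) (.readB2 p) (.returningOld d.oldLevel)
  | acceptLive (v : Fin n) (b₁ l₁ : ℕ) (d : Option (Desc n)) (l₂ : ℕ) (h : b₁ = c.batchNum)
      (hl : l₁ = l₂) :
      ReadStep prm p c (.gotL2 v b₁ l₁ d false l₂) (.readB2 p) (.returningLive l₂)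
  | retryLevel (v : Fin n) (b₁ l₁ : ℕ) (d : Option (Desc n)) (l₂ : ℕ) (h : b₁ = c.batchNum)
      (hl : l₁ ≠ l₂) :
      ReadStep prm p c (.gotL2 v b₁ l₁ d false l₂) (.readB2 p) (.start v)
  | returnOld (l : ℕ) :
      ReadStep prm p c (.returningOld l) (.returnOld p (prm.estimate n l)) .idle
  | returnLive (l : ℕ) :
      ReadStep prm p c (.returningLive l) (.returnLive p (prm.estimate n l)) .idle

/-- One atomic step of the system, by the update side or by a reading process. -/
inductive Step {n : ℕ} {P : Type*} [DecidableEq P] (prm : Params) :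
    Config n P → Event n P → Config n P → Prop where
  | update (c c' : Config n P) (a : Event n P) (h : UpdateStep prm c a c') : Step prm c a c'
  | read (c : Config n P) (p : P) (a : Event n P) (s' : Reader n)
      (h : ReadStep prm p c (c.reader p) a s') :
      Step prm c a { c with reader := Function.update c.reader p s' }

/-! ## Executions and linearizability -/

/-- A finite or infinite execution, under an arbitrary interleaving of the processes. Step `i`
leads from `cfg i` to `cfg (i+1)` and happens at time `time i`; `ev i = none` means that the
execution has ended before step `i` (and `cfg (i+1)` is then meaningless). -/
structure Execution (n : ℕ) (P : Type*) [DecidableEq P] (prm : Params) where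
  cfg : ℕ → Config n P
  ev : ℕ → Option (Event n P)
  time : ℕ → ℝ
  init : cfg 0 = Config.init n P
  step : ∀ i a, ev i = some a → Step prm (cfg i) a (cfg (i + 1))
  ended : ∀ i, ev i = none → ev (i + 1) = none
  time_mono : StrictMono time

section Exec

variable {n : ℕ} {P : Type*} [DecidableEq P] {prm : Params}

/-- `j` is the first step after `i` whose event satisfies `Q`. -/
def Execution.FirstAfter (x : Execution n P prm) (Q : Event n P → Prop) (i j : ℕ) : Prop :=
  i < j ∧ (∃ a, x.ev j = some a ∧ Q a) ∧
    ∀ k, i < k → k < j → ∀ a, x.ev k = some a → ¬ Q a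

/-- `m` is the last step strictly between `i` and `j` whose event is `a`. -/
def Execution.LastBetween (x : Execution n P prm) (a : Event n P) (i j m : ℕ) : Prop :=
  i < m ∧ m < j ∧ x.ev m = some a ∧ ∀ k, m < k → k < j → x.ev k ≠ some a

/-- The event is the return of a read by process `p`. -/
def Event.IsReturnOf (p : P) (a : Event n P) : Prop :=
  ∃ val, a = .returnOld p val ∨ a = .returnLive p val

/-- The operation `o` of the execution is invoked at step `o.inv` and responds at step `j`. All
updates of a batch are invoked and respond with the batch. -/
def Execution.RespondsAt (x : Execution n P prm) : Op n P → ℕ → Prop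
  | .update i κ e, j =>
      (∃ B, x.ev i = some (.batchInv κ B) ∧ e ∈ B) ∧ x.FirstAfter (fun a => a = .batchResp) i j
  | .read i p v val, j =>
      x.ev i = some (.readInv p v) ∧ x.FirstAfter (Event.IsReturnOf p) i j ∧
        (x.ev j = some (.returnOld p val) ∨ x.ev j = some (.returnLive p val))

/-- `o` is an operation of the execution: an update that has been invoked, or a read that has been
invoked and has returned. -/
def Execution.HasOp (x : Execution n P prm) : Op n P → Prop
  | .update i κ e => ∃ B, x.ev i = some (.batchInv κ B) ∧ e ∈ B
  | .read i p v val => ∃ j, x.RespondsAt (.read i p v val) j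

/-- The execution is linearizable, with linearization points given by `LP` (where `LP o τ` means
that the linearization point of `o` is at time `τ`): linearization points are unique and belong to
operations of the execution; every operation that has responded has one; it falls between invocation
and response; distinct operations have distinct points; and the operations whose points precede any
given step, executed sequentially in the order of their points, return the same values. Operations
that have not responded may or may not have a linearization point. -/
structure Execution.LinearizedBy (x : Execution n P prm) (LP : Op n P → ℝ → Prop) : Prop where
  unique : ∀ o τ τ', LP o τ → LP o τ' → τ = τ'
  hasOp : ∀ o τ, LP o τ → x.HasOp o
  total : ∀ o j, x.RespondsAt o j → ∃ τ, LP o τ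
  after_inv : ∀ o τ, LP o τ → x.time o.inv < τ
  before_resp : ∀ o τ j, LP o τ → x.RespondsAt o j → τ < x.time j
  distinct : ∀ o o' τ, LP o τ → LP o' τ → o = o'
  legal : ∀ N : ℕ, ∃ l : List (Op n P),
    (∀ o, o ∈ l ↔ ∃ τ, LP o τ ∧ τ < x.time N) ∧
    l.Pairwise (fun o o' => ∀ τ τ', LP o τ → LP o' τ' → τ < τ') ∧
    ∃ S, SeqRun prm (SeqState.init n) l S

/-! ## The linearization points -/

/-- In the batch invoked at step `i`, unmarking begins at step `s`. The marking and the level changes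
of the batch are then complete. -/
def Execution.SettlesAt (x : Execution n P prm) (i s : ℕ) : Prop :=
  x.FirstAfter (fun a => a = .beginUnmark) i s

/-- The level of `v` is changed by the batch that is invoked at step `i` and settles at step `s`. -/
def Execution.Changes (x : Execution n P prm) (i s : ℕ) (v : Fin n) : Prop :=
  (x.cfg i).level v ≠ (x.cfg s).level v

/-- The update of `e` in the batch is visible: the batch changes the level of an endpoint of `e`.
Otherwise the update is invisible. -/
def Execution.Visible (x : Execution n P prm) (i s : ℕ) (e : Sym2 (Fin n)) : Prop :=
  ∃ v ∈ e, x.Changes i s v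

/-- `r` is the root of the DAG of a visible update of `e`, i.e. the DAG that contains the endpoints
of `e` that change levels. -/
def Execution.IsRootOfDAG (x : Execution n P prm) (i s : ℕ) (e : Sym2 (Fin n)) (r : Fin n) : Prop :=
  ∃ v ∈ e, x.Changes i s v ∧ RootOf (x.cfg s).desc v r

/-- The linearization points, for edge identifiers `eid`. An update in a batch that never reaches
the unmarking has none, and neither has a visible update whose root is never unmarked, nor a read
that never returns. -/
inductive Execution.LinPoint (x : Execution n P prm) (eid : Sym2 (Fin n) → ℕ) :
    Op n P → ℝ → Prop where
  | invisible (i s m : ℕ) (κ : Kind) (e : Sym2 (Fin n))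
      (hop : x.HasOp (.update i κ e)) (hs : x.SettlesAt i s) (hvis : ¬ x.Visible i s e)
      (him : i < m) (hms : m < s) (hm : x.ev m = some (.modify e)) :
      x.LinPoint eid (.update i κ e) (x.time m)
  | visible (i s t : ℕ) (κ : Kind) (e : Sym2 (Fin n)) (r : Fin n)
      (hop : x.HasOp (.update i κ e)) (hs : x.SettlesAt i s) (hvis : x.Visible i s e)
      (hr : x.IsRootOfDAG i s e r) (ht : x.FirstAfter (fun a => a = .unmarkRoot r) s t) :
      x.LinPoint eid (.update i κ e)
        (x.time t + (x.time (t + 1) - x.time t) * (eid e / ((n : ℝ) * (n - 1) / 2 + 1)))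
  | readOld (i j m : ℕ) (p : P) (v : Fin n) (val : ℝ)
      (hop : x.RespondsAt (.read i p v val) j) (hj : x.ev j = some (.returnOld p val))
      (hm : x.LastBetween (.readDesc p) i j m) :
      x.LinPoint eid (.read i p v val) (x.time m)
  | readLive (i j m : ℕ) (p : P) (v : Fin n) (val : ℝ)
      (hop : x.RespondsAt (.read i p v val) j) (hj : x.ev j = some (.returnLive p val))
      (hm : x.LastBetween (.readL2 p) i j m) :
      x.LinPoint eid (.read i p v val) (x.time m)

/-- For every update of an edge whose two endpoints change levels in the batch, both endpoints are
marked when unmarking begins, and, from the first moment of the batch when both are marked until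
unmarking begins, they are in the same DAG. -/
def Execution.SameDAG (x : Execution n P prm) : Prop :=
  ∀ (i s : ℕ) (κ : Kind) (u v : Fin n), x.HasOp (.update i κ s(u, v)) → x.SettlesAt i s →
    x.Changes i s u → x.Changes i s v →
    ((x.cfg s).desc u ≠ none ∧ (x.cfg s).desc v ≠ none) ∧
    ∀ t, i < t → t ≤ s → (x.cfg t).desc u ≠ none → (x.cfg t).desc v ≠ none →
      ∃ r, RootOf (x.cfg t).desc u r ∧ RootOf (x.cfg t).desc v r

/-- Every visible update belongs to exactly one DAG. -/
def Execution.UniqueDAG (x : Execution n P prm) : Prop :=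
  ∀ (i s : ℕ) (κ : Kind) (e : Sym2 (Fin n)), x.HasOp (.update i κ e) → x.SettlesAt i s →
    x.Visible i s e → ∃! r, x.IsRootOfDAG i s e r

end Exec

end CPLDS

end

/-! All updates of a batch push in one direction: insertions can only break Invariant 1, which is
repaired by moving up, deletions only Invariant 2, which is repaired by moving down. For a vertex
that keeps its level, such moves of the others change its counts monotonically. So a vertex that has
to move in some state still has to move in every later state in which it is on the same level. Hence
rebalancing in one direction is confluent (`below_of_kInv`, `Settle.unique`): it ends at the nearest
level assignment that satisfies the endangered invariant, whatever the order of the moves and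
(`Settle.trans`) of the updates. The other invariant is never lost (`KStep.oInv`). A sequential run
over a set `F` of batch edges can therefore be made to end on levels that depend only on `F`.

The core is the independence of the DAGs, `RebInv.settle_mix`. Let `X` be a union of DAGs, and let
`F` contain exactly those batch edges with a moved endpoint whose moved endpoints lie in `X`, plus
any batch edges without moved endpoints. Then `F` leads to the new levels on `X` and the old levels
elsewhere. To see this, the concurrent moves of the vertices of `X` are replayed alone (field `path`
of `RebInv`). Marked neighbours in another DAG do not interfere. For deletions there are none in the
final graph. For insertions, one of the two has come to rest strictly below the old level of the
other (`Apart`): the upper one never counts the lower one, and the lower one always counts the upper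
one, whichever of the old and new levels are used.

Consequently the sequential state behind a configuration has the new levels on the DAGs whose roots
are unmarked and the old levels elsewhere (`absLevel`). Unmarking a root linearizes the visible
updates of its DAG at once; invisible updates fit in anywhere. `settle_done` makes this precise at
each moment of a running batch, with hindsight: visibility and the DAGs are taken from the moment
when the unmarking begins.

For reads, equal batch numbers confine the relevant steps to one batch. Following parents stays in
the component of the vertex, and after the root of a component is unmarked no marked root can be met
in it. So a marked root shows that the DAG was still pending when the descriptor was read, and the
old level was correct. If an unmarked vertex is met, either the DAG is already applied and the live
level is correct, or the vertex was unmarked when its descriptor was read, so that the first live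
level is the old one, and agreement with the second makes that one correct too. -/

namespace CPLDS

/-! ## Rebalancing in one direction -/

section Levels

variable {n : ℕ} {prm : Params}

/-! ### Monotonicity of degrees and invariants -/

lemma degAbove_mono {G G' : SimpleGraph (Fin n)} {L L' : Fin n → ℕ} {v : Fin n} {ℓ ℓ' : ℕ}
    (h : ∀ w, G.Adj v w → ℓ ≤ L w → G'.Adj v w ∧ ℓ' ≤ L' w) :
    degAbove G L v ℓ ≤ degAbove G' L' v ℓ' :=
  Set.ncard_le_ncard (fun w hw => h w hw.1 hw.2) (Set.toFinite _)

lemma degAbove_congr {G : SimpleGraph (Fin n)} {L L' : Fin n → ℕ} {v : Fin n} {ℓ : ℕ}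
    (h : ∀ w, G.Adj v w → (ℓ ≤ L w ↔ ℓ ≤ L' w)) : degAbove G L v ℓ = degAbove G L' v ℓ :=
  le_antisymm (degAbove_mono fun w hw hl => ⟨hw, (h w hw).1 hl⟩)
    (degAbove_mono fun w hw hl => ⟨hw, (h w hw).2 hl⟩)

lemma degAbove_update_self {G : SimpleGraph (Fin n)} {L : Fin n → ℕ} {v : Fin n} {ℓ k : ℕ} :
    degAbove G (Function.update L v k) v ℓ = degAbove G L v ℓ :=
  degAbove_congr fun w hw => by rw [Function.update_of_ne hw.ne']

lemma Params.one_le (prm : Params) : 1 ≤ 1 + prm.δ := by linarith [prm.δ_pos]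

lemma Params.pow_group_mono (prm : Params) {a b : ℕ} (h : a ≤ b) :
    (1 + prm.δ) ^ prm.group n a ≤ (1 + prm.δ) ^ prm.group n b :=
  pow_le_pow_right₀ prm.one_le (Nat.div_le_div_right h)

lemma Params.pow_le_bound (prm : Params) (i : ℕ) :
    (1 + prm.δ) ^ i ≤ (2 + 3 / prm.lam) * (1 + prm.δ) ^ i := by
  have h1 : 0 < 3 / prm.lam := div_pos (by norm_num) prm.lam_pos
  have h2 : 0 < (1 + prm.δ) ^ i := pow_pos (by linarith [prm.δ_pos]) i
  nlinarith

lemma LowerOK.mono {G G' : SimpleGraph (Fin n)} {L L' : Fin n → ℕ} {v : Fin n} {ℓ : ℕ}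
    (h : ∀ w, G.Adj v w → ℓ - 1 ≤ L w → G'.Adj v w ∧ ℓ - 1 ≤ L' w) (hl : LowerOK prm G L v ℓ) :
    LowerOK prm G' L' v ℓ := fun h0 =>
  (hl h0).trans (by exact_mod_cast degAbove_mono h)

/-- Going down weakens the threshold and enlarges the set of counted neighbours, so the levels
acceptable for Invariant 2 form an initial segment. This is why one level decides whether a
desire-level has been passed. -/
lemma LowerOK.of_le {G : SimpleGraph (Fin n)} {L : Fin n → ℕ} {v : Fin n} {ℓ j : ℕ}
    (hj : j ≤ ℓ) (hl : LowerOK prm G L v ℓ) : LowerOK prm G L v j := fun h0 =>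
  (prm.pow_group_mono (by omega)).trans ((hl (by omega)).trans
    (by exact_mod_cast degAbove_mono fun w hw h => ⟨hw, by omega⟩))

lemma UpperInv.mono {G G' : SimpleGraph (Fin n)} {L L' : Fin n → ℕ} {v : Fin n} (hv : L v = L' v)
    (h : ∀ w, G.Adj v w → L v ≤ L w → G'.Adj v w ∧ L v ≤ L' w) (hu : UpperInv prm G' L' v) :
    UpperInv prm G L v := fun h0 => by
  have h1 := hu (hv ▸ h0)
  rw [← hv] at h1
  exact le_trans (by exact_mod_cast degAbove_mono h) h1

/-- The graph obtained from `G` by the updates of all edges of `F`. -/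
def applySet (G : SimpleGraph (Fin n)) (κ : Kind) (F : Set (Sym2 (Fin n))) : SimpleGraph (Fin n) :=
  match κ with
  | .insertion => G ⊔ SimpleGraph.fromEdgeSet F
  | .deletion => G.deleteEdges F

lemma applySet_insertion_adj {G : SimpleGraph (Fin n)} {F : Set (Sym2 (Fin n))} {a b : Fin n} :
    (applySet G .insertion F).Adj a b ↔ G.Adj a b ∨ (s(a, b) ∈ F ∧ a ≠ b) := by
  simp [applySet]

lemma applySet_deletion_adj {G : SimpleGraph (Fin n)} {F : Set (Sym2 (Fin n))} {a b : Fin n} :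
    (applySet G .deletion F).Adj a b ↔ G.Adj a b ∧ s(a, b) ∉ F := by
  simp [applySet]

lemma applySet_empty (G : SimpleGraph (Fin n)) (κ : Kind) : applySet G κ ∅ = G := by
  cases κ <;> simp [applySet]

lemma applyEdge_applySet (G : SimpleGraph (Fin n)) (κ : Kind) (F : Set (Sym2 (Fin n)))
    (e : Sym2 (Fin n)) : applyEdge (applySet G κ F) κ e = applySet G κ (insert e F) := by
  cases κ
  · ext a b
    simp only [applyEdge, SimpleGraph.sup_adj, SimpleGraph.fromEdgeSet_adj, applySet_insertion_adj,
      Set.mem_insert_iff, Set.mem_singleton_iff]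
    tauto
  · ext a b
    simp only [applyEdge, SimpleGraph.deleteEdges_adj, applySet_deletion_adj,
      Set.mem_insert_iff, Set.mem_singleton_iff]
    tauto

/-- The invariant at `v` that updates of the given kind can violate. -/
def KInv (prm : Params) (G : SimpleGraph (Fin n)) (L : Fin n → ℕ) (v : Fin n) : Kind → Prop
  | .insertion => UpperInv prm G L v
  | .deletion => LowerInv prm G L v

/-- The invariant at `v` that updates of the given kind cannot violate. -/
def OInv (prm : Params) (G : SimpleGraph (Fin n)) (L : Fin n → ℕ) (v : Fin n) : Kind → Prop
  | .insertion => LowerInv prm G L v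
  | .deletion => UpperInv prm G L v

/-- The level next to `ℓ` in the direction of the moves caused by updates of the given kind. -/
def shift : Kind → ℕ → ℕ
  | .insertion, ℓ => ℓ + 1
  | .deletion, ℓ => ℓ - 1

/-- The levels in `L'` are reached from those in `L` in the direction of the given kind. -/
def Below (L L' : Fin n → ℕ) : Kind → Prop
  | .insertion => ∀ v, L v ≤ L' v
  | .deletion => ∀ v, L' v ≤ L v

/-- The graph `G'` results from `G` by updates of the given kind. -/
def GBelow (G G' : SimpleGraph (Fin n)) : Kind → Prop
  | .insertion => G ≤ G'
  | .deletion => G' ≤ G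

/-- A rebalancing move of a vertex that violates the invariant that belongs to the kind `κ`. -/
def KStep (prm : Params) (κ : Kind) (G : SimpleGraph (Fin n)) (L L' : Fin n → ℕ) : Prop :=
  ∃ v, ¬ KInv prm G L v κ ∧ L' = Function.update L v (shift κ (L v))

/-- `L'` results from `L` by moves of kind `κ` and satisfies the invariant that belongs to `κ`. -/
def Settle (prm : Params) (κ : Kind) (G : SimpleGraph (Fin n)) (L L' : Fin n → ℕ) : Prop :=
  Relation.ReflTransGen (KStep prm κ G) L L' ∧ ∀ v, KInv prm G L' v κ

/-! ### Confluence of rebalancing in the direction of a batch -/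

lemma Below.refl (L : Fin n → ℕ) (κ : Kind) : Below L L κ := by
  cases κ <;> exact fun _ => le_rfl

lemma Below.trans {L L' L'' : Fin n → ℕ} {κ : Kind} (h : Below L L' κ) (h' : Below L' L'' κ) :
    Below L L'' κ := by
  cases κ
  · exact fun v => (h v).trans (h' v)
  · exact fun v => (h' v).trans (h v)

lemma Below.antisymm {L L' : Fin n → ℕ} {κ : Kind} (h : Below L L' κ) (h' : Below L' L κ) :
    L = L' := by
  cases κ
  · exact funext fun v => le_antisymm (h v) (h' v)
  · exact funext fun v => le_antisymm (h' v) (h v)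

lemma GBelow.refl (G : SimpleGraph (Fin n)) (κ : Kind) : GBelow G G κ := by
  cases κ <;> exact le_rfl

lemma GBelow_applySet (G : SimpleGraph (Fin n)) (κ : Kind) {F F' : Set (Sym2 (Fin n))}
    (h : F ⊆ F') : GBelow (applySet G κ F) (applySet G κ F') κ := by
  cases κ
  · intro a b hab
    rw [applySet_insertion_adj] at *
    exact hab.imp_right fun h' => ⟨h h'.1, h'.2⟩
  · intro a b hab
    rw [applySet_deletion_adj] at *
    exact ⟨hab.1, fun h' => hab.2 (h h')⟩

lemma GBelow_applySet_self (G : SimpleGraph (Fin n)) (κ : Kind) (F : Set (Sym2 (Fin n))) :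
    GBelow G (applySet G κ F) κ := by
  simpa only [applySet_empty] using GBelow_applySet G κ (Set.empty_subset F)

/-- More edges and higher levels (or dually fewer and lower) can only hurt the endangered invariant
at a vertex that stays put, so its validity travels backwards in time. For the opposite invariant,
`OInv.mono`, it travels forwards. -/
lemma KInv.mono {G G' : SimpleGraph (Fin n)} {L L' : Fin n → ℕ} {κ : Kind} {v : Fin n}
    (hG : GBelow G G' κ) (hL : Below L L' κ) (hv : L v = L' v) (h : KInv prm G' L' v κ) :
    KInv prm G L v κ := by
  cases κ
  · exact UpperInv.mono hv (fun w hw hl => ⟨hG hw, hl.trans (hL w)⟩) h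
  · unfold KInv LowerInv at *
    rw [hv]
    exact LowerOK.mono (fun w hw hl => ⟨hG hw, hl.trans (hL w)⟩) h

lemma OInv.mono {G G' : SimpleGraph (Fin n)} {L L' : Fin n → ℕ} {κ : Kind} {v : Fin n}
    (hG : GBelow G G' κ) (hL : Below L L' κ) (hv : L v = L' v) (h : OInv prm G L v κ) :
    OInv prm G' L' v κ := by
  cases κ
  · unfold OInv LowerInv at *
    rw [← hv]
    exact LowerOK.mono (fun w hw hl => ⟨hG hw, hl.trans (hL w)⟩) h
  · exact UpperInv.mono hv.symm (fun w hw hl => ⟨hG hw, hl.trans (hL w)⟩) h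

lemma lt_topLevel_of_not_upperInv {G : SimpleGraph (Fin n)} {L : Fin n → ℕ} {v : Fin n}
    (h : ¬ UpperInv prm G L v) : L v < prm.topLevel n := by
  by_contra hn
  exact h fun h' => absurd h' hn

lemma pos_of_not_lowerInv {G : SimpleGraph (Fin n)} {L : Fin n → ℕ} {v : Fin n}
    (h : ¬ LowerInv prm G L v) : 0 < L v := by
  by_contra hn
  exact h fun h' => absurd h' hn

lemma KStep.below {G : SimpleGraph (Fin n)} {L L' : Fin n → ℕ} {κ : Kind}
    (h : KStep prm κ G L L') : Below L L' κ := by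
  obtain ⟨v, -, rfl⟩ := h
  cases κ <;> intro w <;> by_cases hw : w = v <;>
    simp [hw, shift]

lemma KStep.moveStep {G : SimpleGraph (Fin n)} {L L' : Fin n → ℕ} {κ : Kind}
    (h : KStep prm κ G L L') : MoveStep prm G L L' := by
  obtain ⟨v, hv, rfl⟩ := h
  cases κ
  · exact MoveStep.up L v hv
  · exact MoveStep.down L v hv

lemma KStep.mono {G G' : SimpleGraph (Fin n)} {L L' : Fin n → ℕ} {κ : Kind}
    (hG : GBelow G G' κ) (h : KStep prm κ G L L') : KStep prm κ G' L L' := by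
  obtain ⟨v, hv, rfl⟩ := h
  exact ⟨v, fun h' => hv (h'.mono hG (Below.refl L κ) rfl), rfl⟩

lemma below_of_steps {G : SimpleGraph (Fin n)} {L L' : Fin n → ℕ} {κ : Kind}
    (h : Relation.ReflTransGen (KStep prm κ G) L L') : Below L L' κ := by
  induction h with
  | refl => exact Below.refl _ _
  | tail _ h ih => exact ih.trans h.below

/-- At the moved vertex both invariants compare the same count with thresholds that differ by the
factor `2 + 3/λ ≥ 1`: too many neighbours for level `ℓ` are enough for level `ℓ + 1`, and too few
for level `ℓ` are not too many for `ℓ - 1`. At the other vertices monotonicity suffices. -/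
lemma KStep.oInv {G : SimpleGraph (Fin n)} {L L' : Fin n → ℕ} {κ : Kind}
    (h : KStep prm κ G L L') (ho : ∀ v, OInv prm G L v κ) : ∀ v, OInv prm G L' v κ := by
  have hb := h.below
  obtain ⟨v, hv, rfl⟩ := h
  intro w
  by_cases hw : w = v
  · subst hw
    cases κ
    · intro _
      simp only [Function.update_self, degAbove_update_self, shift, Nat.add_sub_cancel]
      have h0 := lt_topLevel_of_not_upperInv hv
      have h1 : ¬ ((degAbove G L w (L w) : ℝ) ≤
        (2 + 3 / prm.lam) * (1 + prm.δ) ^ prm.group n (L w)) := fun h' => hv fun _ => h'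
      exact (prm.pow_le_bound _).trans (not_le.1 h1).le
    · intro _
      simp only [Function.update_self, degAbove_update_self, shift]
      have h1 : ¬ ((1 + prm.δ) ^ prm.group n (L w - 1) ≤ (degAbove G L w (L w - 1) : ℝ)) :=
        fun h' => hv fun _ => h'
      exact (not_le.1 h1).le.trans (prm.pow_le_bound _)
  · exact (ho w).mono (GBelow.refl G κ) hb (by simp [hw])

lemma oInv_of_steps {G : SimpleGraph (Fin n)} {L L' : Fin n → ℕ} {κ : Kind}
    (h : Relation.ReflTransGen (KStep prm κ G) L L') (ho : ∀ v, OInv prm G L v κ) :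
    ∀ v, OInv prm G L' v κ := by
  induction h with
  | refl => exact ho
  | tail _ h ih => exact h.oInv ih

/-- A path cannot overtake a state `M` that satisfies the endangered invariant: the first vertex to
do so would move while on its level in `M`, but there `KInv.mono` forbids the violation. -/
lemma below_of_kInv {G : SimpleGraph (Fin n)} {L L' M : Fin n → ℕ} {κ : Kind}
    (h : Relation.ReflTransGen (KStep prm κ G) L L') (hM : Below L M κ)
    (hk : ∀ v, KInv prm G M v κ) : Below L' M κ := by
  induction h with
  | refl => exact hM
  | @tail L₁ L₂ _ h ih =>
    obtain ⟨v, hv, rfl⟩ := h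
    have hne : L₁ v ≠ M v := fun he => hv ((hk v).mono (GBelow.refl G κ) ih he)
    cases κ <;> intro w <;> have hw' := ih w <;> by_cases hw : w = v
    · subst hw
      simp only [Function.update_self, shift]
      omega
    · simpa [hw] using hw'
    · subst hw
      simp only [Function.update_self, shift]
      omega
    · simpa [hw] using hw'

lemma Settle.unique {G : SimpleGraph (Fin n)} {L L₁ L₂ : Fin n → ℕ} {κ : Kind}
    (h₁ : Settle prm κ G L L₁) (h₂ : Settle prm κ G L L₂) : L₁ = L₂ :=
  (below_of_kInv h₁.1 (below_of_steps h₂.1) h₂.2).antisymm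
    (below_of_kInv h₂.1 (below_of_steps h₁.1) h₁.2)

/-- Moves that were justified before further updates of the same kind remain justified after them.
Thus rebalancing after each update gives the same result as applying all updates first and
rebalancing once. -/
lemma Settle.trans {G G' : SimpleGraph (Fin n)} {L L₁ L₂ : Fin n → ℕ} {κ : Kind}
    (hG : GBelow G G' κ) (h₁ : Settle prm κ G L L₁) (h₂ : Settle prm κ G' L₁ L₂) :
    Settle prm κ G' L L₂ :=
  ⟨(Relation.ReflTransGen.mono (fun _ _ (h : KStep prm κ G _ _) => h.mono hG) _ _ h₁.1).trans h₂.1,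
    h₂.2⟩

/-- The total distance to the top level (insertions) or the total level (deletions) decreases: a
vertex that violates Invariant 1 is below the top, and one that violates Invariant 2 is above level
`0`. -/
lemma exists_settle (κ : Kind) (G : SimpleGraph (Fin n)) (L : Fin n → ℕ) :
    ∃ L', Settle prm κ G L L' := by
  let m : (Fin n → ℕ) → ℕ := fun L => match κ with
    | .insertion => ∑ v, (prm.topLevel n - L v)
    | .deletion => ∑ v, L v
  induction hm : m L using Nat.strong_induction_on generalizing L with
  | _ k ih =>
    by_cases hk : ∀ v, KInv prm G L v κ
    · exact ⟨L, .refl, hk⟩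
    · push Not at hk
      obtain ⟨v, hv⟩ := hk
      have hlt : m (Function.update L v (shift κ (L v))) < k := by
        rw [← hm]
        cases κ
        · have := lt_topLevel_of_not_upperInv hv
          refine Finset.sum_lt_sum (fun w _ => ?_) ⟨v, Finset.mem_univ v, ?_⟩
          · by_cases hw : w = v
            · subst hw; simp only [Function.update_self, shift]; omega
            · simp [hw]
          · simp only [Function.update_self, shift]; omega
        · have := pos_of_not_lowerInv hv
          refine Finset.sum_lt_sum (fun w _ => ?_) ⟨v, Finset.mem_univ v, ?_⟩
          · by_cases hw : w = v
            · subst hw; simp only [Function.update_self, shift]; omega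
            · simp [hw]
          · simp only [Function.update_self, shift]; omega
      obtain ⟨L', h1, h2⟩ := ih _ hlt _ rfl
      exact ⟨L', .head ⟨v, hv, rfl⟩ h1, h2⟩

/-- Both invariants hold everywhere. -/
def Stable (prm : Params) (G : SimpleGraph (Fin n)) (L : Fin n → ℕ) : Prop :=
  ∀ v, UpperInv prm G L v ∧ LowerInv prm G L v

lemma stable_iff {G : SimpleGraph (Fin n)} {L : Fin n → ℕ} (κ : Kind) :
    Stable prm G L ↔ (∀ v, KInv prm G L v κ) ∧ ∀ v, OInv prm G L v κ := by
  cases κ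
  · exact forall_and
  · simp only [Stable, KInv, OInv, forall_and, and_comm]

lemma Settle.stable {G₀ : SimpleGraph (Fin n)} {L₀ L : Fin n → ℕ} {κ : Kind}
    {F : Set (Sym2 (Fin n))} (h₀ : Stable prm G₀ L₀) (h : Settle prm κ (applySet G₀ κ F) L₀ L) :
    Stable prm (applySet G₀ κ F) L :=
  (stable_iff κ).2 ⟨h.2, oInv_of_steps h.1 fun v =>
    (((stable_iff κ).1 h₀).2 v).mono (GBelow_applySet_self G₀ κ F) (Below.refl L₀ κ) rfl⟩

/-- The sequential object can process one more update of the batch. -/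
lemma Settle.exists_rebalance {G₀ : SimpleGraph (Fin n)} {L₀ L : Fin n → ℕ} {κ : Kind}
    {F : Set (Sym2 (Fin n))} (h₀ : Stable prm G₀ L₀) (h : Settle prm κ (applySet G₀ κ F) L₀ L)
    (e : Sym2 (Fin n)) :
    ∃ L', Rebalance prm (applyEdge (applySet G₀ κ F) κ e) L L' ∧
      Settle prm κ (applySet G₀ κ (insert e F)) L₀ L' := by
  obtain ⟨L', h'⟩ := exists_settle (prm := prm) κ (applySet G₀ κ (insert e F)) L
  have h2 := h.trans (GBelow_applySet G₀ κ (Set.subset_insert e F)) h'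
  refine ⟨L', ?_, h2⟩
  rw [applyEdge_applySet]
  exact ⟨Relation.ReflTransGen.mono
    (fun _ _ (h : KStep prm κ (applySet G₀ κ (insert e F)) _ _) => h.moveStep) _ _ h'.1,
    h2.stable h₀⟩

/-- A deletion batch sends a vertex to its desire-level in one move, whereas the sequential object
descends one level at a time. The intermediate steps are legal because the degree of a vertex does
not depend on its own level. -/
lemma steps_down {G : SimpleGraph (Fin n)} {L : Fin n → ℕ} {v : Fin n} {ℓ : ℕ} (hℓ : ℓ ≤ L v)
    (h : ∀ j, ℓ < j → j ≤ L v → ¬ LowerOK prm G L v j) :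
    Relation.ReflTransGen (KStep prm .deletion G) L (Function.update L v ℓ) := by
  obtain ⟨k, hk⟩ : ∃ k, L v = ℓ + k := ⟨L v - ℓ, by omega⟩
  induction k generalizing ℓ with
  | zero =>
    have : Function.update L v ℓ = L := by rw [Function.update_eq_self_iff]; omega
    rw [this]
  | succ k ih =>
    refine (ih (ℓ := ℓ + 1) (by omega) (fun j hj => h j (by omega)) (by omega)).tail ⟨v, ?_, ?_⟩
    · intro hl
      refine h (ℓ + 1) (by omega) (by omega) fun h0 => ?_
      have := hl (by simp)
      simpa [degAbove_update_self] using this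
    · simp [shift]

end Levels

/-! ## The DAGs of marked vertices -/

section DAG

variable {n : ℕ} {D D' : DescArray n} {u v w r : Fin n}

/-- `X` is a union of connected components of the parent relation. -/
def Closed (D : DescArray n) (X : Set (Fin n)) : Prop :=
  ∀ a b, ParentOf D a b → (a ∈ X ↔ b ∈ X)

/-- `u` and `v` lie in the same connected component of the parent relation. -/
def Conn (D : DescArray n) (u v : Fin n) : Prop :=
  ∀ X, Closed D X → (u ∈ X ↔ v ∈ X)

lemma Conn.refl (D : DescArray n) (u : Fin n) : Conn D u u := fun _ _ => Iff.rfl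

lemma Conn.symm (h : Conn D u v) : Conn D v u := fun X hX => (h X hX).symm

lemma Conn.trans (h : Conn D u v) (h' : Conn D v w) : Conn D u w :=
  fun X hX => (h X hX).trans (h' X hX)

lemma Conn.mono (hD : ∀ a b, ParentOf D a b → ParentOf D' a b) (h : Conn D u v) : Conn D' u v :=
  fun X hX => h X fun a b hab => hX a b (hD a b hab)

lemma ParentOf.conn (h : ParentOf D u v) : Conn D u v := fun _ hX => hX _ _ h

lemma conn_of_path (h : Relation.ReflTransGen (ParentOf D) u v) : Conn D u v := by
  induction h with
  | refl => exact Conn.refl D u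
  | tail _ h ih => exact ih.trans h.conn

lemma IsRoot.not_parentOf (h : IsRoot D u) : ¬ ParentOf D u v := by
  rintro ⟨d, hd, hp⟩
  obtain ⟨d', hd', hp'⟩ := h
  rw [hd] at hd'
  cases hd'
  simp [hp] at hp'

lemma IsRoot.rootOf (h : IsRoot D u) : RootOf D u u := ⟨.refl, h⟩

lemma IsRoot.ne_none (h : IsRoot D u) : D u ≠ none := by
  obtain ⟨d, hd, -⟩ := h
  simp [hd]

lemma ParentOf.unique (h : ParentOf D u v) (h' : ParentOf D u w) : v = w := by
  obtain ⟨d, hd, hp⟩ := h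
  obtain ⟨d', hd', hp'⟩ := h'
  rw [hd] at hd'
  cases hd'
  simpa [hp] using hp'

lemma RootOf.of_parentOf (h : ParentOf D u v) (hr : RootOf D v r) : RootOf D u r :=
  ⟨.head h hr.1, hr.2⟩

lemma RootOf.parent (h : ParentOf D u v) (hr : RootOf D u r) : RootOf D v r := by
  rcases Relation.ReflTransGen.cases_head hr.1 with rfl | ⟨c, hc, hcr⟩
  · exact (hr.2.not_parentOf h).elim
  · rw [h.unique hc]
    exact ⟨hcr, hr.2⟩

lemma RootOf.ne_none (h : RootOf D u r) : D u ≠ none := by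
  rcases Relation.ReflTransGen.cases_head h.1 with rfl | ⟨c, ⟨d, hd, -⟩, -⟩
  · exact h.2.ne_none
  · simp [hd]

/-- A vertex has at most one parent, so a vertex and its parent reach the same roots. Both the
components of the parent relation and the set of applied DAGs are of this form. -/
lemma closed_rootOf (D : DescArray n) (Q : Fin n → Prop) : Closed D {v | ∃ r, RootOf D v r ∧ Q r} :=
  fun _ _ hab => ⟨fun ⟨r, hr, hQ⟩ => ⟨r, hr.parent hab, hQ⟩,
    fun ⟨r, hr, hQ⟩ => ⟨r, hr.of_parentOf hab, hQ⟩⟩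

/-- Connectedness is tested on the closed set of all vertices with root `r`. Conversely a vertex is
connected to its root, so sharing a root and being connected agree on marked vertices that reach a
root. -/
lemma RootOf.of_conn (h : Conn D u v) (hr : RootOf D u r) : RootOf D v r := by
  obtain ⟨r', h1, rfl⟩ := (h _ (closed_rootOf D (· = r))).1 ⟨r, hr, rfl⟩
  exact h1

lemma RootOf.conn (h : RootOf D u r) : Conn D u r := conn_of_path h.1

lemma RootOf.eq_of_isRoot (h : RootOf D u r) (hu : IsRoot D u) : u = r := by
  rcases Relation.ReflTransGen.cases_head h.1 with rfl | ⟨c, hc, -⟩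
  · rfl
  · exact (hu.not_parentOf hc).elim

lemma RootOf.unique {r' : Fin n} (h : RootOf D u r) (h' : RootOf D u r') : r = r' :=
  (RootOf.of_conn h.conn h').eq_of_isRoot h.2

end DAG

/-! ## The invariant of the rounds of a batch -/

section Rounds

variable {n : ℕ} {prm : Params}

open Classical in
/-- The levels `L` on `X`, and `L₀` elsewhere. -/
noncomputable def mix (X : Set (Fin n)) (L L₀ : Fin n → ℕ) : Fin n → ℕ :=
  fun v => if v ∈ X then L v else L₀ v

lemma mix_of_mem {X : Set (Fin n)} {L L₀ : Fin n → ℕ} {v : Fin n} (h : v ∈ X) :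
    mix X L L₀ v = L v := if_pos h

lemma mix_of_notMem {X : Set (Fin n)} {L L₀ : Fin n → ℕ} {v : Fin n} (h : v ∉ X) :
    mix X L L₀ v = L₀ v := if_neg h

lemma mix_of_eq {X : Set (Fin n)} {L L₀ : Fin n → ℕ} {v : Fin n} (h : L v = L₀ v) :
    mix X L L₀ v = L v := by
  by_cases hv : v ∈ X
  · exact mix_of_mem hv
  · rw [mix_of_notMem hv, h]

lemma mix_update_of_mem {X : Set (Fin n)} {L L₀ : Fin n → ℕ} {v : Fin n} {k : ℕ} (h : v ∈ X) :
    mix X (Function.update L v k) L₀ = Function.update (mix X L L₀) v k := by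
  funext w
  by_cases hw : w = v
  · subst hw
    simp [mix_of_mem h]
  · by_cases hX : w ∈ X <;> simp [hw, mix_of_mem, mix_of_notMem, hX]

lemma mix_update_of_notMem {X : Set (Fin n)} {L L₀ : Fin n → ℕ} {v : Fin n} {k : ℕ} (h : v ∉ X) :
    mix X (Function.update L v k) L₀ = mix X L L₀ := by
  funext w
  by_cases hX : w ∈ X
  · rw [mix_of_mem hX, mix_of_mem hX, Function.update_of_ne (by rintro rfl; exact h hX)]
  · rw [mix_of_notMem hX, mix_of_notMem hX]

/-- In round `ℓ` of a batch, `v` has to be moved. -/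
def Moves (prm : Params) (G : SimpleGraph (Fin n)) (L : Fin n → ℕ) (ℓ : ℕ) (v : Fin n) :
    Kind → Prop
  | .insertion => L v = ℓ ∧ ¬ UpperInv prm G L v
  | .deletion => IsDesireLevel prm G L v ℓ

/-- When `v` is marked, its DAG has to be merged with that of `w`. -/
def Rel (B : Set (Sym2 (Fin n))) (G : SimpleGraph (Fin n)) (L : Fin n → ℕ) (D : DescArray n)
    (v w : Fin n) (κ : Kind) : Prop :=
  D w ≠ none ∧ (s(v, w) ∈ B ∨ G.Adj v w ∧ (κ = .insertion → L v ≤ L w))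

/-- The invariant of a marking procedure in round `ℓ`. -/
structure TaskInv (κ : Kind) (B : Set (Sym2 (Fin n))) (G : SimpleGraph (Fin n)) (L : Fin n → ℕ)
    (D : DescArray n) (ℓ : ℕ) (T : MarkTask n) : Prop where
  unmarked : D T.vertex = none
  level : κ = .insertion → L T.vertex = ℓ
  todo_root : ∀ x ∈ T.toLink, IsRoot D x
  newRoot_root : ∀ r, T.newRoot = some r → IsRoot D r ∧ r ∉ T.toLink
  cover : ∀ w, Rel B G L D T.vertex w κ → ∃ r, (T.newRoot = some r ∨ r ∈ T.toLink) ∧ Conn D w r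

/-- Neither `u` nor `v` caused a move of the other in the rounds before `ℓ` of an insertion
batch. -/
def Apart (L₀ L : Fin n → ℕ) (ℓ : ℕ) (u v : Fin n) : Prop :=
  (L u < ℓ ∧ L u < L₀ v) ∨ (L v < ℓ ∧ L v < L₀ u)

/-- The invariant of round `ℓ` of a batch that started with the graph `G₀` and the levels `L₀`. -/
structure RebInv (prm : Params) (κ : Kind) (B : Set (Sym2 (Fin n))) (G₀ : SimpleGraph (Fin n))
    (L₀ L : Fin n → ℕ) (D : DescArray n) (ℓ : ℕ) (task : Option (MarkTask n)) : Prop where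
  level_le : ∀ v, L v ≤ prm.topLevel n
  unmarked : ∀ v, D v = none → L v = L₀ v
  old : ∀ v d, D v = some d → d.oldLevel = L₀ v
  root : ∀ v, D v ≠ none → ∃ r, RootOf D v r
  below : Below L₀ L κ
  relB : ∀ u v, D u ≠ none → D v ≠ none → s(u, v) ∈ B → Conn D u v
  relAdj : ∀ u v, D u ≠ none → D v ≠ none → (applySet G₀ κ B).Adj u v →
    Conn D u v ∨ (κ = .insertion ∧ Apart L₀ L ℓ u v)
  upper : κ = .insertion → ∀ v, L v < ℓ → UpperInv prm (applySet G₀ κ B) L v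
  lower : κ = .deletion → ∀ v, LowerOK prm (applySet G₀ κ B) L v (min ℓ (L v))
  path : ∀ (X : Set (Fin n)) (F : Set (Sym2 (Fin n))), Closed D X → F ⊆ B →
    (∀ e ∈ B, ∀ v ∈ e, v ∈ X → L v ≠ L₀ v → e ∈ F) →
    Relation.ReflTransGen (KStep prm κ (applySet G₀ κ F)) L₀ (mix X L L₀)
  task : ∀ T, task = some T → TaskInv κ B (applySet G₀ κ B) L D ℓ T

variable {κ : Kind} {B : Set (Sym2 (Fin n))} {G₀ : SimpleGraph (Fin n)} {L₀ L : Fin n → ℕ}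
  {D : DescArray n} {ℓ : ℕ} {task : Option (MarkTask n)}

/-! ### Preservation of the invariant by the steps of a batch -/

lemma RebInv.start (hK : ∀ v, L₀ v ≤ prm.topLevel n) :
    RebInv prm κ B G₀ L₀ L₀ (fun _ => none) 0 none where
  level_le := hK
  unmarked _ _ := rfl
  old _ _ h := by simp at h
  root _ h := by simp at h
  below := Below.refl _ _
  relB _ _ h := by simp at h
  relAdj _ _ h := by simp at h
  upper _ _ h := by simp at h
  lower _ _ h := by simp at h
  path X F _ _ _ := by
    have : mix X L₀ L₀ = L₀ := funext fun v => mix_of_eq rfl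
    rw [this]
  task _ h := by simp at h

lemma RebInv.setTask (h : RebInv prm κ B G₀ L₀ L D ℓ none) {T : MarkTask n}
    (hT : TaskInv κ B (applySet G₀ κ B) L D ℓ T) : RebInv prm κ B G₀ L₀ L D ℓ (some T) :=
  { h with task := fun T' hT' => by cases hT'; exact hT }

lemma RebInv.newDAG (h : RebInv prm κ B G₀ L₀ L D ℓ none) {v : Fin n}
    (hv : Moves prm (applySet G₀ κ B) L ℓ v κ) (hD : D v = none)
    (hR : ∀ w, ¬ Rel B (applySet G₀ κ B) L D v w κ) :
    RebInv prm κ B G₀ L₀ L D ℓ (some ⟨v, ∅, none⟩) :=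
  h.setTask
    { unmarked := hD
      level := by rintro rfl; exact hv.1
      todo_root := by simp
      newRoot_root := by simp
      cover := fun w hw => (hR w hw).elim }

/-- Each related marked vertex is connected to its root, and this root is either the chosen one or
waits to be linked; this is the `cover` that lets `publish` connect the new vertex to all of them.
-/
lemma RebInv.merge (h : RebInv prm κ B G₀ L₀ L D ℓ none) {v : Fin n}
    (hv : Moves prm (applySet G₀ κ B) L ℓ v κ) (hD : D v = none) {R : Finset (Fin n)}
    (hR : ∀ r, r ∈ R ↔ ∃ w, Rel B (applySet G₀ κ B) L D v w κ ∧ RootOf D w r)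
    {r₀ : Fin n} (hr : r₀ ∈ R) :
    RebInv prm κ B G₀ L₀ L D ℓ (some ⟨v, R.erase r₀, some r₀⟩) := by
  have hroot : ∀ r ∈ R, IsRoot D r := fun r hr => by
    obtain ⟨w, -, h2⟩ := (hR r).1 hr
    exact h2.2
  refine h.setTask
    { unmarked := hD
      level := by rintro rfl; exact hv.1
      todo_root := fun x hx => hroot x (Finset.mem_of_mem_erase hx)
      newRoot_root := fun r h' => by
        cases h'
        exact ⟨hroot _ hr, Finset.notMem_erase _ _⟩
      cover := fun w hw => ?_ }
  obtain ⟨r, h'⟩ := h.root w hw.1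
  refine ⟨r, ?_, h'.conn⟩
  have hrR := (hR r).2 ⟨w, hw, h'⟩
  by_cases hrr : r = r₀
  · exact .inl (by simp [hrr])
  · exact .inr (Finset.mem_erase.2 ⟨hrr, hrR⟩)

lemma update_ne_none_iff {x v : Fin n} {d : Desc n} (hx : D x ≠ none) :
    Function.update D x (some d) v ≠ none ↔ D v ≠ none := by
  by_cases hv : v = x
  · subst hv; simp [hx]
  · simp [hv]

/-- During the rounds only entries without a parent are overwritten. So the parent relation only
grows, connections persist, and fewer sets remain closed, which makes the field `path` weaker and
hence automatic. -/
lemma IsRoot.parentOf_update {x : Fin n} (hx : D x = none ∨ IsRoot D x) (d : Option (Desc n))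
    {a b : Fin n} (h : ParentOf D a b) : ParentOf (Function.update D x d) a b := by
  have hne : a ≠ x := by
    rintro rfl
    obtain ⟨e, he, -⟩ := id h
    rcases hx with hx | hx
    · simp [hx] at he
    · exact hx.not_parentOf h
  obtain ⟨e, he, hp⟩ := h
  exact ⟨e, by simpa [hne] using he, hp⟩

lemma IsRoot.update_of_ne {x r : Fin n} {d : Option (Desc n)} (h : IsRoot D r) (hne : r ≠ x) :
    IsRoot (Function.update D x d) r := by
  obtain ⟨e, he, hp⟩ := h
  exact ⟨e, by simpa [hne] using he, hp⟩

/-- A vertex that had `x` as its root now reaches `r₀` in one more step. What `x` covered is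
henceforth covered by `r₀`, so `x` can be dropped from the list. -/
lemma RebInv.link {v r₀ x : Fin n} {todo : Finset (Fin n)} {d : Desc n}
    (h : RebInv prm κ B G₀ L₀ L D ℓ (some ⟨v, todo, some r₀⟩)) (hx : x ∈ todo)
    (hd : D x = some d) :
    RebInv prm κ B G₀ L₀ L (Function.update D x (some ⟨d.oldLevel, some r₀⟩)) ℓ
      (some ⟨v, todo.erase x, some r₀⟩) := by
  have hT := h.task _ rfl
  have hxr : IsRoot D x := hT.todo_root x hx
  have hr := hT.newRoot_root r₀ rfl
  have hne : r₀ ≠ x := fun e => hr.2 (e ▸ hx)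
  have hx0 : D x ≠ none := by simp [hd]
  set D' := Function.update D x (some ⟨d.oldLevel, some r₀⟩) with hD'
  have hpar : ∀ a b, ParentOf D a b → ParentOf D' a b :=
    fun a b hab => IsRoot.parentOf_update (.inr hxr) _ hab
  have hxp : ParentOf D' x r₀ := ⟨_, by rw [hD', Function.update_self], rfl⟩
  have hr' : IsRoot D' r₀ := hr.1.update_of_ne hne
  have hmark : ∀ w, D' w ≠ none ↔ D w ≠ none := fun w => update_ne_none_iff hx0
  have hmark' : ∀ w, D' w = none ↔ D w = none := fun w => not_iff_not.1 (hmark w)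
  exact
  { level_le := h.level_le
    unmarked := fun w hw => h.unmarked w ((hmark' w).1 hw)
    old := fun w e he => by
      by_cases hw : w = x
      · subst hw
        rw [hD', Function.update_self] at he
        cases he
        exact h.old w d hd
      · rw [hD', Function.update_of_ne hw] at he
        exact h.old w e he
    root := fun w hw => by
      obtain ⟨r, hr1, hr2⟩ := h.root w ((hmark w).1 hw)
      have hp := Relation.ReflTransGen.mono hpar _ _ hr1
      by_cases hrx : r = x
      · subst hrx
        exact ⟨r₀, hp.tail hxp, hr'⟩
      · exact ⟨r, hp, hr2.update_of_ne hrx⟩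
    below := h.below
    relB := fun u w hu hw hB => (h.relB u w ((hmark u).1 hu) ((hmark w).1 hw) hB).mono hpar
    relAdj := fun u w hu hw hA =>
      (h.relAdj u w ((hmark u).1 hu) ((hmark w).1 hw) hA).imp_left fun hc => hc.mono hpar
    upper := h.upper
    lower := h.lower
    path := fun X F hX => h.path X F fun a b hab => hX a b (hpar a b hab)
    task := fun T hT' => by
      cases hT'
      exact
      { unmarked := (hmark' v).2 hT.unmarked
        level := hT.level
        todo_root := fun y hy =>
          (hT.todo_root y (Finset.mem_of_mem_erase hy)).update_of_ne (Finset.ne_of_mem_erase hy)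
        newRoot_root := fun r hr0 => by
          cases hr0
          exact ⟨hr', fun h' => hr.2 (Finset.mem_of_mem_erase h')⟩
        cover := fun w hw => by
          obtain ⟨r, hr1, hr2⟩ := hT.cover w ⟨(hmark w).1 hw.1, hw.2⟩
          have hc := hr2.mono hpar
          rcases hr1 with hr1 | hr1
          · exact ⟨r, .inl hr1, hc⟩
          · by_cases hrx : r = x
            · subst hrx
              exact ⟨r₀, .inl rfl, hc.trans hxp.conn⟩
            · exact ⟨r, .inr (Finset.mem_erase.2 ⟨hrx, hr1⟩), hc⟩ } }

/-- All roots have been linked, so every related vertex is now connected to the parent of `v`. The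
level stored is the old one because an unmarked vertex has not moved. -/
lemma RebInv.publish {v : Fin n} {nr : Option (Fin n)}
    (h : RebInv prm κ B G₀ L₀ L D ℓ (some ⟨v, ∅, nr⟩)) :
    RebInv prm κ B G₀ L₀ L (Function.update D v (some ⟨L v, nr⟩)) ℓ none := by
  have hT := h.task _ rfl
  have hv0 : D v = none := hT.unmarked
  set D' := Function.update D v (some ⟨L v, nr⟩) with hD'
  have hpar : ∀ a b, ParentOf D a b → ParentOf D' a b :=
    fun a b hab => IsRoot.parentOf_update (.inl hv0) _ hab
  have hne : ∀ r, IsRoot D r → r ≠ v := fun r hr e => hr.ne_none (e ▸ hv0)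
  have hDv : D' v = some ⟨L v, nr⟩ := Function.update_self ..
  have hDw : ∀ w, w ≠ v → D' w = D w := fun w hw => Function.update_of_ne hw ..
  have hconn : ∀ w, Rel B (applySet G₀ κ B) L D v w κ → Conn D' w v := by
    intro w hw
    obtain ⟨r, hr1, hr2⟩ := hT.cover w hw
    have hr1 : nr = some r := by simpa using hr1
    subst hr1
    exact (hr2.mono hpar).trans (ParentOf.conn ⟨_, hDv, rfl⟩).symm
  have hadj : ∀ w, w ≠ v → D' w ≠ none → (applySet G₀ κ B).Adj v w →
      Conn D' w v ∨ (κ = .insertion ∧ (L w < ℓ ∧ L w < L₀ v)) := by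
    intro w hwv hw hA
    rw [hDw w hwv] at hw
    by_cases hc : κ = .insertion → L v ≤ L w
    · exact .inl (hconn w ⟨hw, .inr ⟨hA, hc⟩⟩)
    -- An insertion does not merge with a marked neighbour `w` strictly below `v`. As `v` is on
    -- level `ℓ` and has not moved, `w` is below both `ℓ` and the old level of `v`, which is
    -- apartness.
    · push Not at hc
      have := hT.level hc.1
      have := h.unmarked v hv0
      simp only at *
      exact .inr ⟨hc.1, by omega, by omega⟩
  exact
  { level_le := h.level_le
    unmarked := fun w hw => by
      by_cases hwv : w = v
      · subst hwv; simp [hDv] at hw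
      · exact h.unmarked w (by rwa [hDw w hwv] at hw)
    old := fun w e he => by
      by_cases hwv : w = v
      · subst hwv
        rw [hDv] at he
        cases he
        exact h.unmarked w hv0
      · exact h.old w e (by rwa [hDw w hwv] at he)
    root := fun w hw => by
      by_cases hwv : w = v
      · subst hwv
        cases nr with
        | none => exact ⟨w, .refl, _, hDv, rfl⟩
        | some r =>
          have hr := (hT.newRoot_root r rfl).1
          exact ⟨r, .single ⟨_, hDv, rfl⟩, hr.update_of_ne (hne r hr)⟩
      · rw [hDw w hwv] at hw
        obtain ⟨r, hr1, hr2⟩ := h.root w hw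
        exact ⟨r, Relation.ReflTransGen.mono hpar _ _ hr1, hr2.update_of_ne (hne r hr2)⟩
    below := h.below
    relB := fun u w hu hw hB => by
      by_cases huv : u = v
      · by_cases hwv : w = v
        · rw [huv, hwv]; exact Conn.refl _ _
        · subst huv
          rw [hDw w hwv] at hw
          exact (hconn w ⟨hw, .inl hB⟩).symm
      · rw [hDw u huv] at hu
        by_cases hwv : w = v
        · subst hwv
          exact hconn u ⟨hu, .inl (by rwa [Sym2.eq_swap])⟩
        · rw [hDw w hwv] at hw
          exact (h.relB u w hu hw hB).mono hpar
    relAdj := fun u w hu hw hA => by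
      by_cases huv : u = v
      · subst huv
        rcases hadj w hA.ne' hw hA with h1 | ⟨h1, h2⟩
        · exact .inl h1.symm
        · exact .inr ⟨h1, .inr h2⟩
      · by_cases hwv : w = v
        · subst hwv
          rcases hadj u hA.ne hu hA.symm with h1 | ⟨h1, h2⟩
          · exact .inl h1
          · exact .inr ⟨h1, .inl h2⟩
        · rw [hDw u huv] at hu
          rw [hDw w hwv] at hw
          exact (h.relAdj u w hu hw hA).imp_left fun hc => hc.mono hpar
    upper := h.upper
    lower := h.lower
    path := fun X F hX => h.path X F fun a b hab => hX a b (hpar a b hab)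
    task := fun T hT' => by simp at hT' }

/-- For deletions, a vertex above `ℓ` that is acceptable at `ℓ` but not at `ℓ + 1` is unacceptable
at all higher levels, so its desire-level would be `ℓ` and the round would not be over. -/
lemma RebInv.nextRound (h : RebInv prm κ B G₀ L₀ L D ℓ none)
    (hdone : ∀ v, ¬ Moves prm (applySet G₀ κ B) L ℓ v κ) :
    RebInv prm κ B G₀ L₀ L D (ℓ + 1) none :=
  { h with
    relAdj := fun u w hu hw hA => (h.relAdj u w hu hw hA).imp_right fun ⟨h1, h2⟩ =>
      ⟨h1, h2.imp (fun h => ⟨by omega, h.2⟩) (fun h => ⟨by omega, h.2⟩)⟩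
    upper := fun hκ v hv => by
      rcases Nat.lt_succ_iff_lt_or_eq.1 hv with hv | hv
      · exact h.upper hκ v hv
      · subst hκ
        by_contra hc
        exact hdone v ⟨hv, hc⟩
    lower := fun hκ v => by
      have h1 := h.lower hκ v
      subst hκ
      by_cases hle : L v ≤ ℓ
      · rw [min_eq_right hle] at h1
        rwa [min_eq_right (by omega)]
      · rw [min_eq_left (by omega)] at h1
        rw [min_eq_left (by omega)]
        by_contra hc
        exact hdone v ⟨by omega, h1, fun j hj _ hj' => hc (hj'.of_le hj)⟩
    task := fun T hT' => by simp at hT' }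

/-- The essential field is `path`: if the moved vertex lies in `X`, the move is also legal for the
sequential object that sees only the moves inside `X`; if not, nothing changes. The other fields
survive since an insertion round only lifts vertices from `ℓ` to `ℓ + 1`, and a deletion round drops
a vertex no lower than `ℓ`. -/
lemma RebInv.move (h : RebInv prm κ B G₀ L₀ L D ℓ task) {v : Fin n}
    (hv : Moves prm (applySet G₀ κ B) L ℓ v κ) (hD : D v ≠ none) :
    RebInv prm κ B G₀ L₀ (Function.update L v (destination ℓ κ)) D ℓ task := by
  have hℓ : κ = .insertion → L v = ℓ := by rintro rfl; exact hv.1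
  have hself : Function.update L v (destination ℓ κ) v = destination ℓ κ := Function.update_self ..
  have hother : ∀ w, w ≠ v → Function.update L v (destination ℓ κ) w = L w :=
    fun w hw => Function.update_of_ne hw ..
  -- The moved vertex is on level `ℓ` or higher both before and after. So a marking procedure in
  -- progress, whose vertex is on level `ℓ`, acquires no new related vertices.
  have hge : ∀ w, κ = .insertion → (ℓ ≤ Function.update L v (destination ℓ κ) w ↔ ℓ ≤ L w) := by
    rintro w rfl
    by_cases hw : w = v
    · subst hw
      have := hℓ rfl
      rw [hself]
      simp only [destination]
      omega
    · rw [hother w hw]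
  -- Vertices below the current round of an insertion batch are at rest; this makes apartness
  -- permanent.
  have hlt : ∀ w, κ = .insertion → L w < ℓ → Function.update L v (destination ℓ κ) w = L w := by
    rintro w rfl hw
    have := hℓ rfl
    exact hother w (by rintro rfl; omega)
  have hcases : κ = .insertion ∨ κ = .deletion := by cases κ <;> simp
  exact
  { level_le := fun w => by
      by_cases hw : w = v
      · subst hw
        rw [hself]
        cases κ
        · have := lt_topLevel_of_not_upperInv hv.2
          have := hℓ rfl
          simp only [destination]
          omega
        · exact hv.1.le.trans (h.level_le w)
      · rw [hother w hw]
        exact h.level_le w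
    unmarked := fun w hw => by
      rw [hother w (by rintro rfl; exact hD hw)]
      exact h.unmarked w hw
    old := h.old
    root := h.root
    below := by
      refine h.below.trans ?_
      cases κ <;> intro w <;> by_cases hw : w = v
      · subst hw; rw [hself, hℓ rfl]; simp [destination]
      · rw [hother w hw]
      · subst hw; rw [hself]; exact hv.1.le
      · rw [hother w hw]
    relB := h.relB
    relAdj := fun u w hu hw hA => (h.relAdj u w hu hw hA).imp_right fun ⟨h1, h2⟩ => ⟨h1, by
      rcases h2 with h2 | h2
      · left; rwa [hlt u h1 h2.1]
      · right; rwa [hlt w h1 h2.1]⟩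
    upper := fun hκ w hw => by
      have hw' : L w < ℓ := by
        by_contra hc
        exact absurd ((hge w hκ).2 (by omega)) (by omega)
      refine UpperInv.mono (hlt w hκ hw') (fun x hx hl => ⟨hx, ?_⟩) (h.upper hκ w hw')
      rw [hlt w hκ hw'] at hl ⊢
      by_cases hxv : x = v
      · subst hxv
        rw [hℓ hκ]
        omega
      · rwa [hother x hxv] at hl
    lower := by
      rintro rfl w
      -- Acceptability at `j ≤ ℓ` only counts vertices on levels `≥ j - 1`, and the moved vertex
      -- lands on `ℓ`, so it is still counted.
      have key : ∀ j, j ≤ ℓ → LowerOK prm (applySet G₀ .deletion B) L w j →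
          LowerOK prm (applySet G₀ .deletion B) (Function.update L v (destination ℓ .deletion)) w
            j := by
        intro j hj hok
        refine hok.mono fun x hx hl => ⟨hx, ?_⟩
        by_cases hxv : x = v
        · subst hxv
          rw [hself]
          simp only [destination]
          omega
        · rwa [hother x hxv]
      by_cases hw : w = v
      · subst hw
        rw [hself]
        simp only [destination, min_self]
        exact key ℓ le_rfl hv.2.1
      · rw [hother w hw]
        exact key _ (min_le_left _ _) (h.lower rfl w)
    path := fun X F hX hF hB => by
      by_cases hvX : v ∈ X
      -- After the move `v` is off its old level, so the hypothesis on `F` puts all batch edges at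
      -- `v` into `F`: around `v` the partial graph agrees with the final one.
      · have hch : Function.update L v (destination ℓ κ) v ≠ L₀ v := by
          rw [hself]
          cases κ
          · have h1 : L₀ v ≤ L v := h.below v
            have := hℓ rfl
            simp only [destination]
            omega
          · have h1 : L v ≤ L₀ v := h.below v
            have := hv.1
            simp only [destination]
            omega
        have hvB : ∀ w, s(v, w) ∈ B → s(v, w) ∈ F := fun w hw =>
          hB _ hw v (Sym2.mem_mk_left v w) hvX hch
        have hpath := h.path X F hX hF fun e he w hw hwX hne => hB e he w hw hwX fun he' => by
          by_cases hwv : w = v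
          · exact hch (hwv ▸ he')
          · exact hne (by rwa [hother w hwv] at he')
        rw [mix_update_of_mem hvX]
        have hmv : mix X L L₀ v = L v := mix_of_mem hvX
        rcases hcases with rfl | rfl
        · have hℓ := hℓ rfl
          refine hpath.tail ⟨v, ?_, by simp [shift, destination, hmv, hℓ]⟩
          intro hk
          -- Every neighbour that makes `v` violate Invariant 1 in the concurrent state is also
          -- counted in the mixed state, so the violation is present there too.
          refine hv.2 (UpperInv.mono hmv.symm (fun w hA hl => ⟨?_, ?_⟩) hk)
          · rw [applySet_insertion_adj] at hA ⊢
            exact hA.imp_right fun h' => ⟨hvB w h'.1, h'.2⟩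
          · by_cases hwX : w ∈ X
            · rwa [mix_of_mem hwX]
            · rw [mix_of_notMem hwX]
              by_cases hw : D w = none
              · rwa [← h.unmarked w hw]
              -- A marked neighbour outside `X` cannot be connected to `v`. It cannot be apart
              -- either, since neither `v`, on level `ℓ`, nor the counted `w` is below `ℓ`.
              · rcases h.relAdj v w hD hw hA with hc | ⟨-, hc | hc⟩
                · exact (hwX ((hc X hX).1 hvX)).elim
                · omega
                · omega
        · refine hpath.trans (steps_down (by rw [hmv]; exact hv.1.le) fun j hj hjv hok => ?_)
          rw [hmv] at hjv
          -- For deletions the inclusion is the reverse one: a neighbour counted in the mixed state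
          -- is counted in the concurrent state, because adjacent marked vertices of the final graph
          -- are always connected.
          refine hv.2.2 j hj hjv (hok.mono fun w hA hl => ?_)
          rw [applySet_deletion_adj] at hA
          have hA' : (applySet G₀ .deletion B).Adj v w := by
            rw [applySet_deletion_adj]
            exact ⟨hA.1, fun h' => hA.2 (hvB w h')⟩
          refine ⟨hA', ?_⟩
          by_cases hwX : w ∈ X
          · rwa [mix_of_mem hwX] at hl
          · rw [mix_of_notMem hwX] at hl
            by_cases hw : D w = none
            · rwa [h.unmarked w hw]
            · rcases h.relAdj v w hD hw hA' with hc | ⟨hc, -⟩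
              · exact (hwX ((hc X hX).1 hvX)).elim
              · cases hc
      · rw [mix_update_of_notMem hvX]
        refine h.path X F hX hF fun e he w hw hwX hne => hB e he w hw hwX ?_
        rwa [hother w (by rintro rfl; exact hvX hwX)]
    task := fun T hT' => by
      have hT := h.task T hT'
      have hTv : T.vertex ≠ v := by rintro rfl; exact hD hT.unmarked
      exact
      { unmarked := hT.unmarked
        level := fun hκ => by rw [hother _ hTv, hT.level hκ]
        todo_root := hT.todo_root
        newRoot_root := hT.newRoot_root
        cover := fun w hw => hT.cover w ⟨hw.1, hw.2.imp_right fun ⟨h1, h2⟩ => ⟨h1, fun hκ => by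
          have := h2 hκ
          rw [hother _ hTv, hT.level hκ] at this
          rw [hT.level hκ]
          exact (hge w hκ).1 this⟩⟩ } }

/-- When the rounds are over, the levels that result from the updates of any union of DAGs are the
new levels on these DAGs and the old levels elsewhere. -/
lemma RebInv.settle_mix (h : RebInv prm κ B G₀ L₀ L D (prm.topLevel n) none)
    (h₀ : Stable prm G₀ L₀) {X : Set (Fin n)} {F : Set (Sym2 (Fin n))} (hX : Closed D X)
    (hF : F ⊆ B) (hXF : ∀ e ∈ B, ∀ v ∈ e, L v ≠ L₀ v → (v ∈ X ↔ e ∈ F)) :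
    Settle prm κ (applySet G₀ κ F) L₀ (mix X L L₀) := by
  refine ⟨h.path X F hX hF fun e he v hv hvX hne => (hXF e he v hv hne).1 hvX, fun v => ?_⟩
  have hmark : ∀ w, L w ≠ L₀ w → D w ≠ none := fun w hw hn => hw (h.unmarked w hn)
  -- The mixed levels lie between the old and the new ones, so the invariant known for the final
  -- state descends to vertices that are on their final level.
  have hbelow : Below (mix X L L₀) L κ := by
    have := h.below
    cases κ <;> intro w <;> by_cases hw : w ∈ X <;> simp only [mix_of_mem, mix_of_notMem, hw,
      not_false_iff, le_refl]
    · exact this w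
    · exact this w
  by_cases hv : mix X L L₀ v = L v
  · refine KInv.mono (GBelow_applySet G₀ κ hF) hbelow hv ?_
    cases κ
    · rcases (h.level_le v).lt_or_eq with hl | hl
      · exact h.upper rfl v hl
      -- On the top level Invariant 1 demands nothing.
      · exact fun hl' => by omega
    · have := h.lower rfl v
      rwa [min_eq_right (h.level_le v)] at this
  -- Here `v` moves in the batch but its DAG is left out, so no edge of `F` meets `v` and its
  -- neighbourhood is that of `G₀`. The invariant is inherited from the start of the batch, once the
  -- moves in `X` are seen not to push its count the wrong way.
  · have hvX : v ∉ X := fun h' => hv (mix_of_mem h')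
    have hmv : mix X L L₀ v = L₀ v := mix_of_notMem hvX
    have hch : L v ≠ L₀ v := fun h' => hv (mix_of_eq h')
    have hvF : ∀ w, s(v, w) ∉ F := fun w hw =>
      hvX ((hXF _ (hF hw) v (Sym2.mem_mk_left v w) hch).2 hw)
    have hDv := hmark v hch
    have hk₀ := ((stable_iff κ).1 h₀).1 v
    cases κ
    · refine UpperInv.mono hmv (fun w hA hl => ?_) hk₀
      rw [applySet_insertion_adj] at hA
      have hA' : G₀.Adj v w := hA.resolve_right fun h' => hvF w h'.1
      refine ⟨hA', ?_⟩
      rw [hmv] at hl ⊢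
      by_cases hwX : w ∈ X
      · rw [mix_of_mem hwX] at hl
        by_cases hw : D w = none
        · rwa [← h.unmarked w hw]
        -- If `v` rests below the old level of `w`, then `w` was counted from the start. If `w`
        -- rests below the old level of `v`, it is not counted now.
        · rcases h.relAdj v w hDv hw (applySet_insertion_adj.2 (.inl hA')) with hc | ⟨-, hc | hc⟩
          · exact (hvX ((hc X hX).2 hwX)).elim
          · have : L₀ v ≤ L v := h.below v
            omega
          · omega
      · rwa [mix_of_notMem hwX] at hl
    · unfold KInv LowerInv
      rw [hmv]
      refine LowerOK.mono (fun w hA hl => ⟨?_, ?_⟩) hk₀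
      · rw [applySet_deletion_adj]
        exact ⟨hA, hvF w⟩
      · by_cases hwX : w ∈ X
        · rw [mix_of_mem hwX]
          by_cases hw : D w = none
          · rwa [h.unmarked w hw]
          · refine (hvX (((?_ : Conn D v w) X hX).2 hwX)).elim
            by_cases hB : s(v, w) ∈ B
            · exact h.relB v w hDv hw hB
            · rcases h.relAdj v w hDv hw (applySet_deletion_adj.2 ⟨hA, hB⟩) with hc | ⟨hc, -⟩
              · exact hc
              · cases hc
        · rwa [mix_of_notMem hwX]

end Rounds

/-! ## Histories of batches -/

lemma moves_of_needsMove {n : ℕ} {P : Type*} {prm : Params} {κ : Kind} {c : Config n P}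
    {ℓ : ℕ} {v : Fin n} :
    c.NeedsMove prm ℓ v κ ↔ Moves prm c.G c.level ℓ v κ := by
  cases κ <;> exact Iff.rfl

lemma rel_of_related {n : ℕ} {P : Type*} {κ : Kind} {B : Finset (Sym2 (Fin n))} {c : Config n P}
    {v w : Fin n} :
    c.Related B v w κ ↔ Rel ↑B c.G c.level c.desc v w κ := by
  cases κ <;> simp [Config.Related, Rel]

section LastBefore

open Classical in
/-- The last index before `N` at which `Q` holds (`0` if there is none). -/
noncomputable def lastBefore (Q : ℕ → Prop) : ℕ → ℕ
  | 0 => 0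
  | N + 1 => if Q N then N else lastBefore Q N

variable {Q : ℕ → Prop} {i N : ℕ}

lemma lastBefore_succ (h : Q N) : lastBefore Q (N + 1) = N := if_pos h

lemma lastBefore_succ_of_not (h : ¬ Q N) : lastBefore Q (N + 1) = lastBefore Q N := if_neg h

lemma lastBefore_eq (hi : i < N) (hQ : Q i) (h : ∀ k, i < k → k < N → ¬ Q k) :
    lastBefore Q N = i := by
  induction N with
  | zero => omega
  | succ N ih =>
    rcases Nat.lt_succ_iff_lt_or_eq.1 hi with hi' | rfl
    · rw [lastBefore_succ_of_not (h N hi' (Nat.lt_succ_self N))]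
      exact ih hi' fun k hk hk' => h k hk (by omega)
    · exact lastBefore_succ hQ

lemma lastBefore_spec (h : ∃ k < N, Q k) :
    lastBefore Q N < N ∧ Q (lastBefore Q N) ∧ ∀ k, lastBefore Q N < k → k < N → ¬ Q k := by
  induction N with
  | zero => obtain ⟨k, hk, -⟩ := h; omega
  | succ N ih =>
    by_cases hN : Q N
    · rw [lastBefore_succ hN]
      exact ⟨Nat.lt_succ_self N, hN, fun k _ _ => by omega⟩
    · rw [lastBefore_succ_of_not hN]
      obtain ⟨k, hk, hQ⟩ := h
      have hkN : k < N := lt_of_le_of_ne (by omega) (by rintro rfl; exact hN hQ)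
      obtain ⟨h1, h2, h3⟩ := ih ⟨k, hkN, hQ⟩
      refine ⟨by omega, h2, fun j hj hj' => ?_⟩
      rcases Nat.lt_succ_iff_lt_or_eq.1 hj' with hj' | rfl
      · exact h3 j hj hj'
      · exact hN

end LastBefore

variable {n : ℕ} {P : Type*} [DecidableEq P] {prm : Params}

namespace Execution

/-- The step at which the last batch before step `N` is invoked. -/
noncomputable def batch (x : Execution n P prm) (N : ℕ) : ℕ :=
  lastBefore (fun k => ∃ κ B, x.ev k = some (.batchInv κ B)) N

/-- The graph before the last batch. -/
noncomputable def startGraph (x : Execution n P prm) (N : ℕ) : SimpleGraph (Fin n) :=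
  (x.cfg (x.batch N)).G

/-- The levels before the last batch. -/
noncomputable def startLevel (x : Execution n P prm) (N : ℕ) : Fin n → ℕ :=
  (x.cfg (x.batch N)).level

/-- The descriptor array, in which the descriptors erased by the unmarking of the last batch are
retained. -/
noncomputable def full (x : Execution n P prm) : ℕ → DescArray n
  | 0 => (x.cfg 0).desc
  | N + 1 =>
    match (x.cfg (N + 1)).phase with
    | .unmarkingRoots => x.full N
    | .unmarkingRest => x.full N
    | .quiescent => x.full N
    | _ => (x.cfg (N + 1)).desc

/-- The vertices of the DAGs of the last batch whose roots have been unmarked. -/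
noncomputable def applied (x : Execution n P prm) (N : ℕ) : Set (Fin n) :=
  {v | ∃ r, RootOf (x.full N) v r ∧ (x.cfg N).desc r = none}

/-- The levels of the sequential object that corresponds to the configuration before step `N`. -/
noncomputable def absLevel (x : Execution n P prm) (N : ℕ) : Fin n → ℕ :=
  mix (x.applied N) (x.cfg N).level (x.startLevel N)

/-- The execution has not ended before step `N`. -/
def Alive (x : Execution n P prm) (N : ℕ) : Prop := ∀ k < N, x.ev k ≠ none

variable {x : Execution n P prm} {N : ℕ} {κ : Kind} {B todo : Finset (Sym2 (Fin n))}
  {a : Event n P}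

lemma Alive.mono {M : ℕ} (h : x.Alive N) (hM : M ≤ N) : x.Alive M := fun k hk => h k (by omega)

lemma alive_of_ev (h : x.ev N = some a) : x.Alive (N + 1) := by
  intro k hk hn
  have : ∀ j, x.ev (k + j) = none := fun j => by
    induction j with
    | zero => exact hn
    | succ j ih => exact x.ended _ ih
  have h' := this (N - k)
  rw [show k + (N - k) = N by omega, h] at h'
  cases h'

lemma batch_succ (ha : x.ev N = some a) (h : ∀ κ B, a ≠ .batchInv κ B) :
    x.batch (N + 1) = x.batch N :=
  lastBefore_succ_of_not (by rintro ⟨κ, B, h'⟩; rw [ha] at h'; cases h'; exact h κ B rfl)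

lemma batch_succ_inv (ha : x.ev N = some (.batchInv κ B)) : x.batch (N + 1) = N :=
  lastBefore_succ ⟨κ, B, ha⟩

lemma startLevel_of_batch {M : ℕ} (h : x.batch M = x.batch N) :
    x.startLevel M = x.startLevel N := by rw [startLevel, startLevel, h]

lemma startGraph_of_batch {M : ℕ} (h : x.batch M = x.batch N) :
    x.startGraph M = x.startGraph N := by rw [startGraph, startGraph, h]

/-- The history of the batch that is running before step `N`, in which the edges of `todo` have not
been modified yet. -/
structure BatchHist (x : Execution n P prm) (N : ℕ) (κ : Kind) (B todo : Finset (Sym2 (Fin n))) :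
    Prop where
  inv : x.ev (x.batch N) = some (.batchInv κ B)
  lt : x.batch N < N
  diag : ∀ e ∈ B, ¬ e.IsDiag
  stable : Stable prm (x.startGraph N) (x.startLevel N)
  level_le : ∀ v, x.startLevel N v ≤ prm.topLevel n
  noResp : ∀ k, x.batch N < k → k < N → x.ev k ≠ some .batchResp
  mod_mem : ∀ e m, x.batch N < m → m < N → x.ev m = some (.modify e) → e ∈ B ∧ e ∉ todo
  mod_unique : ∀ e m m', x.batch N < m → m < N → x.ev m = some (.modify e) →
    x.batch N < m' → m' < N → x.ev m' = some (.modify e) → m = m'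
  mod_exists : ∀ e ∈ B, e ∉ todo → ∃ m, x.batch N < m ∧ m < N ∧ x.ev m = some (.modify e)
  graph : (x.cfg N).G = applySet (x.startGraph N) κ (↑B \ ↑todo)

/-- The history of a batch before the unmarking. -/
structure PreHist (x : Execution n P prm) (N : ℕ) (κ : Kind) (B todo : Finset (Sym2 (Fin n))) :
    Prop extends BatchHist x N κ B todo where
  noUnmark : ∀ k, x.batch N < k → k < N → x.ev k ≠ some .beginUnmark
  full : x.full N = (x.cfg N).desc

/-- The history of a batch whose unmarking begins at step `s`. -/
structure PostHist (x : Execution n P prm) (N : ℕ) (κ : Kind) (B : Finset (Sym2 (Fin n)))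
    (s : ℕ) : Prop extends BatchHist x N κ B ∅ where
  settles : x.SettlesAt (x.batch N) s
  settles_lt : s < N
  full : x.full N = (x.cfg s).desc
  level : (x.cfg N).level = (x.cfg s).level
  reb : RebInv prm κ (↑B) (x.startGraph N) (x.startLevel N) (x.cfg N).level (x.full N)
    (prm.topLevel n) none
  desc : ∀ v, (x.cfg N).desc v = x.full N v ∨ (x.cfg N).desc v = none ∧ v ∈ x.applied N
  root_exists : ∀ r, IsRoot (x.full N) r → (x.cfg N).desc r = none →
    ∃ t, s < t ∧ t < N ∧ x.ev t = some (.unmarkRoot r)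
  root_done : ∀ r t, s < t → t < N → x.ev t = some (.unmarkRoot r) → (x.cfg N).desc r = none

/-- The state between two batches. -/
structure Calm (x : Execution n P prm) (N : ℕ) : Prop where
  desc : ∀ v, (x.cfg N).desc v = none
  stable : Stable prm (x.cfg N).G (x.cfg N).level
  level_le : ∀ v, (x.cfg N).level v ≤ prm.topLevel n
  unmarked : ∀ v, x.full N v = none → (x.cfg N).level v = x.startLevel N v
  root : ∀ v, x.full N v ≠ none → ∃ r, RootOf (x.full N) v r

/-- The invariant of the update side, for each phase. -/
def PhaseInvAt (x : Execution n P prm) (N : ℕ) : Phase n → Prop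
  | .quiescent => x.Calm N
  | .invoked κ B => x.PreHist N κ B B ∧ (x.cfg N).level = x.startLevel N ∧
      (x.cfg N).desc = fun _ => none
  | .editing κ B todo => x.PreHist N κ B todo ∧ (x.cfg N).level = x.startLevel N ∧
      ((x.cfg N).desc = fun _ => none) ∧ todo ⊆ B
  | .rebalancing κ B ℓ task => x.PreHist N κ B ∅ ∧
      RebInv prm κ (↑B) (x.startGraph N) (x.startLevel N) (x.cfg N).level (x.cfg N).desc ℓ task
  | .unmarkingRoots => ∃ κ B s, x.PostHist N κ B s
  | .unmarkingRest => ∃ κ B s, x.PostHist N κ B s ∧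
      ∀ r, IsRoot (x.full N) r → (x.cfg N).desc r = none

/-- The invariant of the update side. -/
def PhaseInv (x : Execution n P prm) (N : ℕ) : Prop := x.PhaseInvAt N (x.cfg N).phase

/-! ### Preservation of the history by single steps -/

lemma BatchHist.succ (h : x.BatchHist N κ B todo) (ha : x.ev N = some a)
    (h1 : ∀ κ B, a ≠ .batchInv κ B) (h2 : a ≠ .batchResp) (h3 : ∀ e, a ≠ .modify e)
    (hG : (x.cfg (N + 1)).G = (x.cfg N).G) : x.BatchHist (N + 1) κ B todo := by
  have hb := batch_succ ha h1
  have hk : ∀ k, k < N + 1 → k < N ∨ x.ev k = some a := fun k hk =>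
    (Nat.lt_succ_iff_lt_or_eq.1 hk).imp_right (by rintro rfl; exact ha)
  have hm : ∀ m e, m < N + 1 → x.ev m = some (.modify e) → m < N := fun m e hm he =>
    (hk m hm).resolve_right fun h' => by rw [he] at h'; cases h'; exact h3 e rfl
  exact
  { inv := hb ▸ h.inv
    lt := by have := h.lt; omega
    diag := h.diag
    stable := by rw [startGraph_of_batch hb, startLevel_of_batch hb]; exact h.stable
    level_le := by rw [startLevel_of_batch hb]; exact h.level_le
    noResp := fun k hk1 hk2 he => by
      rw [hb] at hk1
      rcases hk k hk2 with h' | h'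
      · exact h.noResp k hk1 h' he
      · rw [he] at h'; cases h'; exact h2 rfl
    mod_mem := fun e m hm1 hm2 he => h.mod_mem e m (hb ▸ hm1) (hm m e hm2 he) he
    mod_unique := fun e m m' hm1 hm2 he hm1' hm2' he' =>
      h.mod_unique e m m' (hb ▸ hm1) (hm m e hm2 he) he (hb ▸ hm1') (hm m' e hm2' he') he'
    mod_exists := fun e he he' => by
      obtain ⟨m, hm1, hm2, hm3⟩ := h.mod_exists e he he'
      exact ⟨m, hb ▸ hm1, by omega, hm3⟩
    graph := by rw [hG, startGraph_of_batch hb]; exact h.graph }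

lemma BatchHist.modify (h : x.BatchHist N κ B todo) {e : Sym2 (Fin n)}
    (ha : x.ev N = some (.modify e)) (htodo : todo ⊆ B) (he : e ∈ todo)
    (hG : (x.cfg (N + 1)).G = applyEdge (x.cfg N).G κ e) :
    x.BatchHist (N + 1) κ B (todo.erase e) := by
  have hb := batch_succ ha (by simp)
  have hk : ∀ k, k < N + 1 → k < N ∨ x.ev k = some (.modify e) := fun k hk =>
    (Nat.lt_succ_iff_lt_or_eq.1 hk).imp_right (by rintro rfl; exact ha)
  exact
  { inv := hb ▸ h.inv
    lt := by have := h.lt; omega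
    diag := h.diag
    stable := by rw [startGraph_of_batch hb, startLevel_of_batch hb]; exact h.stable
    level_le := by rw [startLevel_of_batch hb]; exact h.level_le
    noResp := fun k hk1 hk2 he => by
      rw [hb] at hk1
      rcases hk k hk2 with h' | h'
      · exact h.noResp k hk1 h' he
      · rw [he] at h'; cases h'
    mod_mem := fun e' m hm1 hm2 he' => by
      rw [hb] at hm1
      rcases hk m hm2 with h' | h'
      · have := h.mod_mem e' m hm1 h' he'
        exact ⟨this.1, fun h'' => this.2 (Finset.mem_of_mem_erase h'')⟩
      · rw [he'] at h'
        cases h'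
        exact ⟨htodo he, Finset.notMem_erase _ _⟩
    mod_unique := by
      intro e' m m' hm1 hm2 he1 hm1' hm2' he1'
      rw [hb] at hm1 hm1'
      -- An edge still to be modified has not been modified yet in this batch.
      have aux : ∀ m, x.batch N < m → m < N → x.ev m = some (.modify e') → e' = e → False := by
        rintro m h1 h2 h3 rfl
        exact (h.mod_mem _ m h1 h2 h3).2 he
      rcases Nat.lt_succ_iff_lt_or_eq.1 hm2 with h1 | rfl <;>
      rcases Nat.lt_succ_iff_lt_or_eq.1 hm2' with h2 | rfl
      · exact h.mod_unique e' m m' hm1 h1 he1 hm1' h2 he1'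
      · rw [ha] at he1'; cases he1'; exact (aux m hm1 h1 he1 rfl).elim
      · rw [ha] at he1; cases he1; exact (aux m' hm1' h2 he1' rfl).elim
      · rfl
    mod_exists := fun e' he1 he2 => by
      by_cases hee : e' = e
      · subst hee
        exact ⟨N, by have := h.lt; omega, by omega, ha⟩
      · obtain ⟨m, hm1, hm2, hm3⟩ := h.mod_exists e' he1
          fun h' => he2 (Finset.mem_erase.2 ⟨hee, h'⟩)
        exact ⟨m, hb ▸ hm1, by omega, hm3⟩
    graph := by
      rw [hG, startGraph_of_batch hb, h.graph, applyEdge_applySet]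
      congr 1
      ext e'
      simp only [Set.mem_insert_iff, Set.mem_sdiff, Finset.mem_coe, Finset.mem_erase]
      constructor
      · rintro (rfl | h')
        · exact ⟨htodo he, fun h' => h'.1 rfl⟩
        · exact ⟨h'.1, fun h'' => h'.2 h''.2⟩
      · rintro ⟨h1, h2⟩
        by_cases hee : e' = e
        · exact .inl hee
        · exact .inr ⟨h1, fun h3 => h2 ⟨hee, h3⟩⟩ }

lemma BatchHist.graph_final (h : x.BatchHist N κ B ∅) :
    (x.cfg N).G = applySet (x.startGraph N) κ ↑B := by
  simpa using h.graph

/-- The phase keeps the descriptors erased by the unmarking. -/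
def _root_.CPLDS.Phase.Keeps : Phase n → Prop
  | .unmarkingRoots => True
  | .unmarkingRest => True
  | .quiescent => True
  | _ => False

lemma full_succ_keep (h : (x.cfg (N + 1)).phase.Keeps) : x.full (N + 1) = x.full N := by
  rw [full]
  split
  · rfl
  · rfl
  · rfl
  · generalize (x.cfg (N + 1)).phase = p at *
    cases p <;> simp_all [Phase.Keeps]

lemma full_succ_desc (h : ¬ (x.cfg (N + 1)).phase.Keeps) :
    x.full (N + 1) = (x.cfg (N + 1)).desc := by
  rw [full]
  split <;> simp_all [Phase.Keeps]

lemma PreHist.succ (h : x.PreHist N κ B todo) (ha : x.ev N = some a)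
    (h1 : ∀ κ B, a ≠ .batchInv κ B) (h2 : a ≠ .batchResp) (h3 : ∀ e, a ≠ .modify e)
    (h4 : a ≠ .beginUnmark) (hG : (x.cfg (N + 1)).G = (x.cfg N).G)
    (hp : ¬ (x.cfg (N + 1)).phase.Keeps) : x.PreHist (N + 1) κ B todo :=
  { h.toBatchHist.succ ha h1 h2 h3 hG with
    noUnmark := fun k hk1 hk2 he => by
      rw [batch_succ ha h1] at hk1
      rcases Nat.lt_succ_iff_lt_or_eq.1 hk2 with h' | rfl
      · exact h.noUnmark k hk1 h' he
      · rw [ha] at he; cases he; exact h4 rfl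
    full := full_succ_desc hp }

lemma PreHist.modify (h : x.PreHist N κ B todo) {e : Sym2 (Fin n)}
    (ha : x.ev N = some (.modify e)) (htodo : todo ⊆ B) (he : e ∈ todo)
    (hG : (x.cfg (N + 1)).G = applyEdge (x.cfg N).G κ e)
    (hp : ¬ (x.cfg (N + 1)).phase.Keeps) : x.PreHist (N + 1) κ B (todo.erase e) :=
  { h.toBatchHist.modify ha htodo he hG with
    noUnmark := fun k hk1 hk2 he => by
      rw [batch_succ ha (by simp)] at hk1
      rcases Nat.lt_succ_iff_lt_or_eq.1 hk2 with h' | rfl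
      · exact h.noUnmark k hk1 h' he
      · rw [ha] at he; cases he
    full := full_succ_desc hp }

/-- As long as no descriptor has been erased, every root is still marked. -/
lemma applied_eq_empty (h : x.full N = (x.cfg N).desc) : x.applied N = ∅ := by
  rw [Set.eq_empty_iff_forall_notMem]
  rintro v ⟨r, hr, hd⟩
  rw [h] at hr
  exact hr.2.ne_none hd

lemma applied_succ_subset (hf : x.full (N + 1) = x.full N)
    (hd : ∀ v, (x.cfg N).desc v = none → (x.cfg (N + 1)).desc v = none) :
    x.applied N ⊆ x.applied (N + 1) := by
  rintro v ⟨r, hr, h⟩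
  exact ⟨r, hf ▸ hr, hd r h⟩

/-- The hypothesis `hd` covers both kinds of erasure. An erased entry has to belong to a DAG whose
root is gone, and the erasure of a root that was still marked has to be an `unmarkRoot` event; this
is what the fields `desc` and `root_exists` need. -/
lemma PostHist.succ {s : ℕ} (h : x.PostHist N κ B s) (ha : x.ev N = some a)
    (h1 : ∀ κ B, a ≠ .batchInv κ B) (h2 : a ≠ .batchResp) (h3 : ∀ e, a ≠ .modify e)
    (hG : (x.cfg (N + 1)).G = (x.cfg N).G) (hL : (x.cfg (N + 1)).level = (x.cfg N).level)
    (hp : (x.cfg (N + 1)).phase.Keeps)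
    (hd : ∀ v, (x.cfg (N + 1)).desc v = (x.cfg N).desc v ∨
      (x.cfg (N + 1)).desc v = none ∧ v ∈ x.applied (N + 1) ∧
        (IsRoot (x.full N) v → (x.cfg N).desc v = none ∨ a = .unmarkRoot v))
    (hr : ∀ r, a = .unmarkRoot r → (x.cfg (N + 1)).desc r = none) :
    x.PostHist (N + 1) κ B s := by
  have hf := full_succ_keep hp
  have hb := batch_succ ha h1
  have hd' : ∀ v, (x.cfg N).desc v = none → (x.cfg (N + 1)).desc v = none := fun v hv => by
    rcases hd v with h' | h'
    · rw [h', hv]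
    · exact h'.1
  exact
  { h.toBatchHist.succ ha h1 h2 h3 hG with
    settles := hb ▸ h.settles
    settles_lt := by have := h.settles_lt; omega
    full := by rw [hf, h.full]
    level := by rw [hL, h.level]
    reb := by
      rw [hf, hL, startGraph_of_batch hb, startLevel_of_batch hb]
      exact h.reb
    desc := fun v => by
      rcases hd v with h' | h'
      · rw [h', hf]
        exact (h.desc v).imp_right fun h'' => ⟨h''.1, applied_succ_subset hf hd' h''.2⟩
      · exact .inr ⟨h'.1, h'.2.1⟩
    root_exists := fun r hr hn => by
      rw [hf] at hr
      have : (x.cfg N).desc r = none ∨ a = .unmarkRoot r := by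
        rcases hd r with h' | h'
        · rw [← h']; exact .inl hn
        · exact h'.2.2 hr
      rcases this with h' | rfl
      · obtain ⟨t, ht1, ht2, ht3⟩ := h.root_exists r hr h'
        exact ⟨t, ht1, by omega, ht3⟩
      · exact ⟨N, h.settles_lt, by omega, ha⟩
    root_done := fun r t ht1 ht2 ht3 => by
      rcases Nat.lt_succ_iff_lt_or_eq.1 ht2 with h' | rfl
      · exact hd' r (h.root_done r t ht1 h' ht3)
      · rw [ha] at ht3
        cases ht3
        exact hr r rfl }

/-- Steps of the readers do not affect the invariant. -/
lemma PhaseInv.read (h : x.PhaseInv N) (ha : x.ev N = some a)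
    (h1 : ∀ κ B, a ≠ .batchInv κ B) (h2 : a ≠ .batchResp) (h3 : ∀ e, a ≠ .modify e)
    (h4 : a ≠ .beginUnmark) (h5 : ∀ r, a ≠ .unmarkRoot r) {f : P → Reader n}
    (hc : x.cfg (N + 1) = { x.cfg N with reader := f }) : x.PhaseInv (N + 1) := by
  have hG : (x.cfg (N + 1)).G = (x.cfg N).G := by rw [hc]
  have hL : (x.cfg (N + 1)).level = (x.cfg N).level := by rw [hc]
  have hD : (x.cfg (N + 1)).desc = (x.cfg N).desc := by rw [hc]
  have hp : (x.cfg (N + 1)).phase = (x.cfg N).phase := by rw [hc]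
  have hb := batch_succ ha h1
  have hpost : ∀ {κ B s}, x.PostHist N κ B s → (x.cfg (N + 1)).phase.Keeps →
      x.PostHist (N + 1) κ B s := fun h hk =>
    h.succ ha h1 h2 h3 hG hL hk (fun v => .inl (by rw [hD])) (fun r hr => (h5 r hr).elim)
  unfold PhaseInv at *
  rw [hp]
  generalize hph : (x.cfg N).phase = p at *
  cases p with
  | quiescent =>
    have hf := full_succ_keep (x := x) (N := N) (by rw [hp]; trivial)
    have h : x.Calm N := h
    exact Calm.mk (by rw [hD]; exact h.desc) (by rw [hG, hL]; exact h.stable)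
      (by rw [hL]; exact h.level_le)
      (by rw [hf, hL, startLevel_of_batch hb]; exact h.unmarked) (by rw [hf]; exact h.root)
  | invoked κ B =>
    exact ⟨h.1.succ ha h1 h2 h3 h4 hG (by rw [hp]; exact id),
      by rw [hL, startLevel_of_batch hb, h.2.1], by rw [hD, h.2.2]⟩
  | editing κ B todo =>
    exact ⟨h.1.succ ha h1 h2 h3 h4 hG (by rw [hp]; exact id),
      by rw [hL, startLevel_of_batch hb, h.2.1], by rw [hD, h.2.2.1], h.2.2.2⟩
  | rebalancing κ B ℓ task =>
    refine ⟨h.1.succ ha h1 h2 h3 h4 hG (by rw [hp]; exact id), ?_⟩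
    rw [hL, hD, startLevel_of_batch hb, startGraph_of_batch hb]
    exact h.2
  | unmarkingRoots =>
    obtain ⟨κ, B, s, h⟩ := h
    exact ⟨κ, B, s, hpost h (by rw [hp]; trivial)⟩
  | unmarkingRest =>
    obtain ⟨κ, B, s, h, h'⟩ := h
    refine ⟨κ, B, s, hpost h (by rw [hp]; trivial), ?_⟩
    rw [full_succ_keep (by rw [hp]; trivial), hD]
    exact h'

/-! ### The invariant of the update side along an execution -/

lemma phaseInv_zero (x : Execution n P prm) : x.PhaseInv 0 := by
  have hc := x.init
  have hb : x.batch 0 = 0 := rfl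
  unfold PhaseInv
  rw [show (x.cfg 0).phase = .quiescent by rw [hc]; rfl]
  refine Calm.mk (by rw [hc]; exact fun _ => rfl) (fun v => ⟨fun _ => ?_, fun h => ?_⟩)
    (by rw [hc]; exact fun _ => Nat.zero_le _) (fun v _ => by rw [startLevel, hb]) fun v h => ?_
  · have : degAbove (x.cfg 0).G (x.cfg 0).level v ((x.cfg 0).level v) = 0 := by
      rw [hc]; simp [Config.init, degAbove]
    rw [this]
    have h1 := prm.pow_le_bound (prm.group n ((x.cfg 0).level v))
    have h2 : 0 < (1 + prm.δ) ^ prm.group n ((x.cfg 0).level v) :=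
      pow_pos (by linarith [prm.δ_pos]) _
    push_cast
    linarith
  · rw [hc] at h; exact absurd h (lt_irrefl _)
  · exact (h (by rw [full, hc]; rfl)).elim

lemma PhaseInv.succ (h : x.PhaseInv N) (ha : x.ev N = some a) : x.PhaseInv (N + 1) := by
  have hs := x.step N a ha
  generalize hc' : x.cfg (N + 1) = c' at hs
  cases hs with
  | read p a s' hr =>
    generalize (x.cfg N).reader p = s at hr
    cases hr <;> exact h.read ha (by simp) (by simp) (by simp) (by simp) (by simp) hc'
  | update _ _ hu =>
    have key : ∀ {p q}, (x.cfg N).phase = p → (x.cfg (N + 1)).phase = q →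
        (x.PhaseInvAt N p → x.PhaseInvAt (N + 1) q) → x.PhaseInv (N + 1) := by
      rintro p q hp hq hpq
      unfold PhaseInv at *
      rw [hq]
      exact hpq (hp ▸ h)
    cases hu with
    | invoke κ B hph hB =>
      refine key hph (q := .invoked κ B) (by rw [hc']) fun h : x.Calm N => ?_
      have hb := batch_succ_inv ha
      have hG : x.startGraph (N + 1) = (x.cfg N).G := by rw [startGraph, hb]
      have hL : x.startLevel (N + 1) = (x.cfg N).level := by rw [startLevel, hb]
      refine ⟨⟨⟨?_, ?_, hB, ?_, ?_, ?_, ?_, ?_, ?_, ?_⟩, ?_, ?_⟩, ?_, ?_⟩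
      · rw [hb, ha]
      · omega
      · rw [hG, hL]; exact h.stable
      · rw [hL]; exact h.level_le
      · intro k; omega
      · intro e k; omega
      · intro e k; omega
      · intro e h1 h2; exact (h2 h1).elim
      · rw [hG, hc']; simp [applySet_empty]
      · intro k; omega
      · exact full_succ_desc (by rw [hc']; exact id)
      · rw [hL, hc']
      · rw [hc']; exact funext h.desc
    | tick κ B hph =>
      refine key hph (q := .editing κ B B) (by rw [hc']) fun h => ?_
      have hb := batch_succ ha (by simp)
      exact ⟨h.1.succ ha (by simp) (by simp) (by simp) (by simp) (by rw [hc'])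
        (by rw [hc']; exact id), by rw [startLevel_of_batch hb, hc', ← h.2.1],
        by rw [hc']; exact h.2.2, subset_rfl⟩
    | modify κ B todo e hph he =>
      refine key hph (q := .editing κ B (todo.erase e)) (by rw [hc']) fun h => ?_
      have hb := batch_succ ha (by simp)
      exact ⟨h.1.modify ha h.2.2.2 he (by rw [hc']) (by rw [hc']; exact id),
        by rw [startLevel_of_batch hb, hc', ← h.2.1], by rw [hc']; exact h.2.2.1,
        (Finset.erase_subset _ _).trans h.2.2.2⟩
    | editsDone κ B hph =>
      refine key hph (q := .rebalancing κ B 0 none) (by rw [hc']) fun h => ?_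
      have hb := batch_succ ha (by simp)
      refine ⟨h.1.succ ha (by simp) (by simp) (by simp) (by simp) (by rw [hc'])
        (by rw [hc']; exact id), ?_⟩
      rw [startLevel_of_batch hb, startGraph_of_batch hb, hc', h.2.1, h.2.2.1]
      exact RebInv.start h.1.level_le
    | markNewDAG κ B ℓ v hph hv hunm hR =>
      refine key hph (q := .rebalancing κ B ℓ (some ⟨v, ∅, none⟩)) (by rw [hc']) fun h => ?_
      have hb := batch_succ ha (by simp)
      refine ⟨h.1.succ ha (by simp) (by simp) (by simp) (by simp) (by rw [hc'])
        (by rw [hc']; exact id), ?_⟩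
      have hG := h.1.graph_final
      rw [startLevel_of_batch hb, startGraph_of_batch hb, hc']
      rw [moves_of_needsMove, hG] at hv
      refine h.2.newDAG hv hunm fun w => ?_
      rw [← hG, ← rel_of_related]
      exact hR w
    | markMerge κ B ℓ v hph hv hunm R hR r₀ hr =>
      refine key hph (q := .rebalancing κ B ℓ (some ⟨v, R.erase r₀, some r₀⟩)) (by rw [hc'])
        fun h => ?_
      have hb := batch_succ ha (by simp)
      refine ⟨h.1.succ ha (by simp) (by simp) (by simp) (by simp) (by rw [hc'])
        (by rw [hc']; exact id), ?_⟩
      have hG := h.1.graph_final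
      rw [startLevel_of_batch hb, startGraph_of_batch hb, hc']
      rw [moves_of_needsMove, hG] at hv
      refine h.2.merge hv hunm (fun r => ?_) hr
      rw [hR, ← hG]
      simp only [rel_of_related]
    | link κ B ℓ v r₀ y todo d hph hy hd =>
      refine key hph (q := .rebalancing κ B ℓ (some ⟨v, todo.erase y, some r₀⟩)) (by rw [hc'])
        fun h => ?_
      have hb := batch_succ ha (by simp)
      refine ⟨h.1.succ ha (by simp) (by simp) (by simp) (by simp) (by rw [hc'])
        (by rw [hc']; exact id), ?_⟩
      rw [startLevel_of_batch hb, startGraph_of_batch hb, hc']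
      exact h.2.link hy hd
    | publish κ B ℓ v r₀ hph =>
      refine key hph (q := .rebalancing κ B ℓ none) (by rw [hc']) fun h => ?_
      have hb := batch_succ ha (by simp)
      refine ⟨h.1.succ ha (by simp) (by simp) (by simp) (by simp) (by rw [hc'])
        (by rw [hc']; exact id), ?_⟩
      rw [startLevel_of_batch hb, startGraph_of_batch hb, hc']
      exact h.2.publish
    | move κ B ℓ task v hph hv hm =>
      refine key hph (q := .rebalancing κ B ℓ task) (by rw [hc']; exact hph) fun h => ?_
      have hb := batch_succ ha (by simp)
      refine ⟨h.1.succ ha (by simp) (by simp) (by simp) (by simp) (by rw [hc'])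
        (by rw [hc']; simp [hph, Phase.Keeps]), ?_⟩
      rw [startLevel_of_batch hb, startGraph_of_batch hb, hc']
      rw [moves_of_needsMove, h.1.graph_final] at hv
      exact h.2.move hv hm
    | nextRound κ B ℓ hph hℓ hdone =>
      refine key hph (q := .rebalancing κ B (ℓ + 1) none) (by rw [hc']) fun h => ?_
      have hb := batch_succ ha (by simp)
      refine ⟨h.1.succ ha (by simp) (by simp) (by simp) (by simp) (by rw [hc'])
        (by rw [hc']; exact id), ?_⟩
      rw [startLevel_of_batch hb, startGraph_of_batch hb, hc']
      refine h.2.nextRound fun v => ?_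
      rw [← h.1.graph_final, ← moves_of_needsMove]
      exact hdone v
    | beginUnmark κ B hph =>
      refine key hph (q := .unmarkingRoots) (by rw [hc']) fun h => ⟨κ, B, N, ?_⟩
      have hb := batch_succ ha (by simp)
      have hf : x.full (N + 1) = (x.cfg N).desc :=
        (full_succ_keep (by rw [hc']; trivial)).trans h.1.full
      exact
      { h.1.toBatchHist.succ ha (by simp) (by simp) (by simp) (by rw [hc']) with
        settles := by
          rw [hb]
          refine ⟨h.1.lt, ⟨_, ha, rfl⟩, fun k hk1 hk2 b hb' he => ?_⟩
          subst he
          exact h.1.noUnmark k hk1 hk2 hb'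
        settles_lt := by omega
        full := hf
        level := by rw [hc']
        reb := by
          rw [startLevel_of_batch hb, startGraph_of_batch hb, hf, hc']
          exact h.2
        desc := fun v => .inl (by rw [hf, hc'])
        root_exists := fun r hr hn => by
          rw [hf] at hr
          rw [hc'] at hn
          exact (hr.ne_none hn).elim
        root_done := fun r t => by omega }
    | unmarkRoot r hph hr =>
      refine key hph (q := .unmarkingRoots) (by rw [hc']; exact hph) ?_
      rintro ⟨κ, B, s, h⟩
      have hkeep : (x.cfg (N + 1)).phase.Keeps := by rw [hc']; simp [hph, Phase.Keeps]
      have hf := full_succ_keep hkeep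
      have hD : (x.cfg (N + 1)).desc = Function.update (x.cfg N).desc r none := by rw [hc']
      have hr' : IsRoot (x.full N) r := by
        obtain ⟨d, hd, hd'⟩ := hr
        rcases h.desc r with h' | h'
        · exact ⟨d, h' ▸ hd, hd'⟩
        · simp [hd] at h'
      refine ⟨κ, B, s, h.succ ha (by simp) (by simp) (by simp) (by rw [hc']) (by rw [hc']) hkeep
        (fun v => ?_) fun r' hr' => ?_⟩
      · rw [hD]
        by_cases hv : v = r
        · subst hv
          exact .inr ⟨Function.update_self .., ⟨v, hf ▸ hr'.rootOf, by rw [hD]; simp⟩,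
            fun _ => .inr rfl⟩
        · exact .inl (Function.update_of_ne hv ..)
      · cases hr'
        rw [hD]
        simp
    | rootsDone hph hr =>
      refine key hph (q := .unmarkingRest) (by rw [hc']) ?_
      rintro ⟨κ, B, s, h⟩
      have hkeep : (x.cfg (N + 1)).phase.Keeps := by rw [hc']; trivial
      refine ⟨κ, B, s, h.succ ha (by simp) (by simp) (by simp) (by rw [hc']) (by rw [hc']) hkeep
        (fun v => .inl (by rw [hc'])) (by simp), fun r hr' => ?_⟩
      rw [full_succ_keep hkeep] at hr'
      rw [hc']
      rcases h.desc r with h' | h'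
      · obtain ⟨d, hd, hd'⟩ := hr'
        exact (hr r ⟨d, h' ▸ hd, hd'⟩).elim
      · exact h'.1
    | unmarkOther v hph hv =>
      refine key hph (q := .unmarkingRest) (by rw [hc']; exact hph) ?_
      rintro ⟨κ, B, s, h, hr⟩
      have hkeep : (x.cfg (N + 1)).phase.Keeps := by rw [hc']; simp [hph, Phase.Keeps]
      have hf := full_succ_keep hkeep
      have hD : (x.cfg (N + 1)).desc = Function.update (x.cfg N).desc v none := by rw [hc']
      have hr' : ∀ r, IsRoot (x.full N) r → (x.cfg (N + 1)).desc r = none := fun r hr' => by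
        rw [hD]
        by_cases hrv : r = v
        · simp [hrv]
        · rw [Function.update_of_ne hrv]
          exact hr r hr'
      refine ⟨κ, B, s, h.succ ha (by simp) (by simp) (by simp) (by rw [hc']) (by rw [hc']) hkeep
        (fun w => ?_) (by simp), by rw [hf]; exact hr'⟩
      rw [hD]
      by_cases hw : w = v
      · subst hw
        have hm : x.full N w ≠ none := by
          rcases h.desc w with h' | h'
          · rwa [← h']
          · exact (hv h'.1).elim
        -- Other vertices are unmarked only when all roots are gone, so the DAG of `w` is already
        -- applied and the erasure hides nothing.
        obtain ⟨r, hrw⟩ := h.reb.root w hm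
        exact .inr ⟨Function.update_self .., ⟨r, hf ▸ hrw, hr' r hrw.2⟩, fun h' => .inl (hr w h')⟩
      · exact .inl (Function.update_of_ne hw ..)
    | respond hph hv =>
      refine key hph (q := .quiescent) (by rw [hc']) ?_
      rintro ⟨κ, B, s, h, hr⟩
      have hb := batch_succ ha (by simp)
      have hf := full_succ_keep (x := x) (N := N) (by rw [hc']; trivial)
      -- With `X` everything and `F` the whole batch, the independence of the DAGs says that the
      -- batch as a whole has rebalanced correctly; hence the next batch starts from a stable state.
      have hst : Stable prm (x.cfg N).G (x.cfg N).level := by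
        rw [h.graph_final]
        have := h.reb.settle_mix h.stable (X := Set.univ) (fun _ _ _ => Iff.rfl) subset_rfl
          fun e he _ _ _ => by simpa using he
        have hm : mix Set.univ (x.cfg N).level (x.startLevel N) = (x.cfg N).level :=
          funext fun v => mix_of_mem (Set.mem_univ v)
        rw [hm] at this
        exact this.stable h.stable
      exact Calm.mk (by rw [hc']; exact hv) (by rw [hc']; exact hst)
        (by rw [hc']; exact h.reb.level_le)
        (by rw [hf, hc', startLevel_of_batch hb]; exact h.reb.unmarked)
        (by rw [hf]; exact h.reb.root)

lemma phaseInv (h : x.Alive N) : x.PhaseInv N := by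
  induction N with
  | zero => exact phaseInv_zero x
  | succ N ih =>
    obtain ⟨a, ha⟩ := Option.ne_none_iff_exists'.1 (h N (Nat.lt_succ_self N))
    exact (ih (h.mono (Nat.le_succ N))).succ ha

end Execution

/-! ## Reads -/

namespace Execution

variable {x : Execution n P prm} {N : ℕ} {κ : Kind} {B todo : Finset (Sym2 (Fin n))}
  {a : Event n P} {u v w : Fin n}

/-! ### Descriptors and the levels of the sequential object -/

lemma step_cases (ha : x.ev N = some a) : UpdateStep prm (x.cfg N) a (x.cfg (N + 1)) ∨
    ∃ p s', ReadStep prm p (x.cfg N) ((x.cfg N).reader p) a s' ∧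
      x.cfg (N + 1) = { x.cfg N with reader := Function.update (x.cfg N).reader p s' } := by
  have hs := x.step N a ha
  generalize hc' : x.cfg (N + 1) = c' at hs
  cases hs with
  | update _ _ h => exact .inl (hc' ▸ h)
  | read p a s' h => exact .inr ⟨p, s', h, rfl⟩

/-- A batch is running and has modified the batch number. -/
def _root_.CPLDS.Phase.Active : Phase n → Prop
  | .quiescent => False
  | .invoked _ _ => False
  | _ => True

/-- A batch is running that has not begun the unmarking. -/
def _root_.CPLDS.Phase.Pre : Phase n → Prop
  | .invoked _ _ => True
  | .editing _ _ _ => True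
  | .rebalancing _ _ _ _ => True
  | _ => False

lemma pre_inv (hA : x.Alive N) (hp : (x.cfg N).phase.Pre) : ∃ κ B todo ℓ task,
    x.PreHist N κ B todo ∧ RebInv prm κ (↑B) (x.startGraph N) (x.startLevel N) (x.cfg N).level
      (x.cfg N).desc ℓ task := by
  have h := phaseInv hA
  unfold PhaseInv at h
  generalize (x.cfg N).phase = p at *
  cases p with
  | invoked κ B =>
    refine ⟨κ, B, B, 0, none, h.1, ?_⟩
    rw [h.2.1, h.2.2]
    exact RebInv.start h.1.level_le
  | editing κ B todo =>
    refine ⟨κ, B, todo, 0, none, h.1, ?_⟩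
    rw [h.2.1, h.2.2.1]
    exact RebInv.start h.1.level_le
  | rebalancing κ B ℓ task => exact ⟨κ, B, ∅, ℓ, task, h⟩
  | _ => exact hp.elim

lemma post_inv (hA : x.Alive N) (hp : ¬ (x.cfg N).phase.Pre)
    (hq : (x.cfg N).phase ≠ .quiescent) : ∃ κ B s, x.PostHist N κ B s := by
  have h := phaseInv hA
  unfold PhaseInv at h
  generalize (x.cfg N).phase = p at *
  cases p with
  | unmarkingRoots => exact h
  | unmarkingRest =>
    obtain ⟨κ, B, s, h, -⟩ := h
    exact ⟨κ, B, s, h⟩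
  | quiescent => exact (hq rfl).elim
  | _ => exact (hp trivial).elim

/-- While a batch is running, the retained descriptors satisfy the invariant of the rounds. -/
lemma busy_inv (hA : x.Alive N) (hq : (x.cfg N).phase ≠ .quiescent) : ∃ κ B ℓ task,
    RebInv prm κ (↑B) (x.startGraph N) (x.startLevel N) (x.cfg N).level (x.full N) ℓ task ∧
    ∀ v, (x.cfg N).desc v = x.full N v ∨ (x.cfg N).desc v = none ∧ v ∈ x.applied N := by
  by_cases hp : (x.cfg N).phase.Pre
  · obtain ⟨κ, B, todo, ℓ, task, h1, h2⟩ := pre_inv hA hp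
    exact ⟨κ, B, ℓ, task, h1.full ▸ h2, fun v => .inl (by rw [h1.full])⟩
  · obtain ⟨κ, B, s, h⟩ := post_inv hA hp hq
    exact ⟨κ, B, _, _, h.reb, h.desc⟩

lemma _root_.CPLDS.Phase.Active.ne {p : Phase n} (h : p.Active) : p ≠ .quiescent := by
  rintro rfl; exact h

/-- Between batches all retained DAGs are applied and unmarked vertices are on their old levels.
After the invocation of a batch, before it increments the batch number, nothing has moved. In both
cases live levels are correct without any reference to batch numbers. -/
lemma absLevel_of_not_active (hA : x.Alive N) (hp : ¬ (x.cfg N).phase.Active) :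
    x.absLevel N = (x.cfg N).level := by
  have h := phaseInv hA
  unfold PhaseInv at h
  funext v
  generalize (x.cfg N).phase = p at *
  cases p with
  | quiescent =>
    have h : x.Calm N := h
    by_cases hv : x.full N v = none
    · exact mix_of_eq (h.unmarked v hv)
    · obtain ⟨r, hr⟩ := h.root v hv
      exact mix_of_mem ⟨r, hr, h.desc r⟩
  | invoked κ B => exact mix_of_eq (by rw [h.2.1])
  | _ => exact (hp trivial).elim

lemma desc_some (hA : x.Alive N) {d : Desc n} (hd : (x.cfg N).desc v = some d) :
    (x.cfg N).phase.Active ∧ x.full N v = some d ∧ d.oldLevel = x.startLevel N v := by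
  have hact : (x.cfg N).phase.Active := by
    have h := phaseInv hA
    unfold PhaseInv at h
    generalize (x.cfg N).phase = p at *
    cases p with
    | quiescent =>
      have h : x.Calm N := h
      rw [h.desc v] at hd
      cases hd
    | invoked κ B =>
      rw [h.2.2] at hd
      cases hd
    | _ => trivial
  obtain ⟨κ, B, ℓ, task, h1, h2⟩ := busy_inv hA hact.ne
  have hf : x.full N v = some d := by
    rcases h2 v with h' | h'
    · rw [← h', hd]
    · rw [hd] at h'; cases h'.1
  exact ⟨hact, hf, h1.old v d hf⟩

lemma absLevel_of_desc (hA : x.Alive N) {d : Desc n} (hd : (x.cfg N).desc v = some d)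
    (hv : v ∉ x.applied N) : x.absLevel N v = d.oldLevel := by
  rw [(desc_some hA hd).2.2]
  exact mix_of_notMem hv

/-- A retained descriptor is missing from the array only after the root of its DAG has been
unmarked, because roots go first. So finding an unmarked vertex that was once marked in the batch
proves that its DAG is applied. -/
lemma mem_applied_of_desc (hA : x.Alive N) (hact : (x.cfg N).phase.Active)
    (hd : (x.cfg N).desc v = none) (hf : x.full N v ≠ none) : v ∈ x.applied N := by
  obtain ⟨κ, B, ℓ, task, -, h2⟩ := busy_inv hA hact.ne
  rcases h2 v with h' | h'
  · rw [← h', hd] at hf; exact (hf rfl).elim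
  · exact h'.2

lemma level_of_full (hA : x.Alive N) (hact : (x.cfg N).phase.Active)
    (hf : x.full N v = none) : (x.cfg N).level v = x.startLevel N v := by
  obtain ⟨κ, B, ℓ, task, h1, -⟩ := busy_inv hA hact.ne
  exact h1.unmarked v hf

lemma parent_of_desc (hA : x.Alive N) {d : Desc n} (hd : (x.cfg N).desc v = some d)
    (hp : d.parent = some w) : x.full N w ≠ none ∧ Conn (x.full N) v w := by
  obtain ⟨hact, hf, -⟩ := desc_some hA hd
  obtain ⟨κ, B, ℓ, task, h1, -⟩ := busy_inv hA hact.ne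
  have hpar : ParentOf (x.full N) v w := ⟨d, hf, hp⟩
  obtain ⟨r, hr⟩ := h1.root v (by simp [hf])
  exact ⟨(hr.parent hpar).ne_none, hpar.conn⟩

lemma closed_applied (x : Execution n P prm) (N : ℕ) : Closed (x.full N) (x.applied N) :=
  closed_rootOf _ _

/-- A marked root is its own unique root and is visibly not erased. -/
lemma notMem_applied_of_root (hA : x.Alive N) {d : Desc n} (hd : (x.cfg N).desc v = some d)
    (hp : d.parent = none) : v ∉ x.applied N := by
  obtain ⟨-, hf, -⟩ := desc_some hA hd
  rintro ⟨r, hr, hn⟩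
  have := hr.eq_of_isRoot ⟨d, hf, hp⟩
  subst this
  rw [hd] at hn
  cases hn

/-- While the batch number does not change and a batch is active, the retained descriptors and the
unmarked DAGs only grow. -/
structure Window (x : Execution n P prm) (N : ℕ) : Prop where
  active : (x.cfg N).phase.Active
  batch : x.batch (N + 1) = x.batch N
  conn : ∀ u v, Conn (x.full N) u v → Conn (x.full (N + 1)) u v
  full : ∀ v, x.full N v ≠ none → x.full (N + 1) v ≠ none
  applied : x.applied N ⊆ x.applied (N + 1)

lemma window_of_pre (hA : x.Alive N) (hact : (x.cfg N).phase.Active) (hp : (x.cfg N).phase.Pre)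
    (hk : ¬ (x.cfg (N + 1)).phase.Keeps) (hb : x.batch (N + 1) = x.batch N) {y : Fin n}
    {d : Desc n} (hy : (x.cfg N).desc y = none ∨ IsRoot (x.cfg N).desc y)
    (hd : (x.cfg (N + 1)).desc = (x.cfg N).desc ∨
      (x.cfg (N + 1)).desc = Function.update (x.cfg N).desc y (some d)) : x.Window N := by
  obtain ⟨κ, B, todo, ℓ, task, h1, h2⟩ := pre_inv hA hp
  have hf := full_succ_desc hk
  refine ⟨hact, hb, ?_, ?_, ?_⟩
  · intro u v huv
    rw [hf]
    rw [h1.full] at huv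
    refine huv.mono fun a b hab => ?_
    rcases hd with hd | hd <;> rw [hd]
    · exact hab
    · exact IsRoot.parentOf_update hy _ hab
  · intro v hv
    rw [hf]
    rw [h1.full] at hv
    rcases hd with hd | hd <;> rw [hd]
    · exact hv
    · by_cases hvy : v = y
      · simp [hvy]
      · simpa [hvy] using hv
  · rw [applied_eq_empty h1.full]
    exact Set.empty_subset _

lemma window_of_keeps (hact : (x.cfg N).phase.Active) (hk : (x.cfg (N + 1)).phase.Keeps)
    (hb : x.batch (N + 1) = x.batch N)
    (hd : ∀ v, (x.cfg N).desc v = none → (x.cfg (N + 1)).desc v = none) : x.Window N := by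
  have hf := full_succ_keep hk
  exact ⟨hact, hb, fun u v => by rw [hf]; exact id, fun v => by rw [hf]; exact id,
    applied_succ_subset hf hd⟩

/-- The only step from an inactive to an active phase increments the batch number. If the number is
unchanged and a batch is active after the step, the same batch was active before it, and within a
batch information about DAGs only accumulates. -/
lemma batchNum_succ (ha : x.ev N = some a) :
    (x.cfg N).batchNum ≤ (x.cfg (N + 1)).batchNum ∧
    ((x.cfg N).batchNum = (x.cfg (N + 1)).batchNum → (x.cfg (N + 1)).phase.Active →
      x.Window N) := by
  have hA : x.Alive N := (alive_of_ev ha).mono (Nat.le_succ N)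
  rcases step_cases ha with h | ⟨p, s', h, hc'⟩
  · generalize hc' : x.cfg (N + 1) = c' at h
    have key : (x.cfg (N + 1)).batchNum = (x.cfg N).batchNum → ((x.cfg (N + 1)).phase.Active →
      x.Window N) → (x.cfg N).batchNum ≤ c'.batchNum ∧
        ((x.cfg N).batchNum = c'.batchNum → c'.phase.Active → x.Window N) := by
      intro h1 h2
      rw [hc'] at h1 h2
      exact ⟨h1.ge, fun _ => h2⟩
    have hb : (∀ κ B, a ≠ .batchInv κ B) → x.batch (N + 1) = x.batch N := batch_succ ha
    have same : (∀ κ B, a ≠ .batchInv κ B) → (x.cfg N).phase.Active → (x.cfg N).phase.Pre →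
        ¬ (x.cfg (N + 1)).phase.Keeps → (x.cfg (N + 1)).desc = (x.cfg N).desc → x.Window N := by
      intro h1 h2 h3 h4 h5
      obtain ⟨κ, B, todo, ℓ, task, h6, h7⟩ := pre_inv hA h3
      by_cases hex : ∃ y, (x.cfg N).desc y = none ∨ IsRoot (x.cfg N).desc y
      -- `window_of_pre` asks for a writable vertex even if nothing is written. If there is none
      -- (for instance if `n = 0`), the retained array is unchanged and the claim is immediate.
      · obtain ⟨y, hy⟩ := hex
        exact window_of_pre (d := ⟨0, none⟩) hA h2 h3 h4 (hb h1) hy (.inl h5)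
      · have hf : x.full (N + 1) = x.full N := by rw [full_succ_desc h4, h5, h6.full]
        exact ⟨h2, hb h1, fun u v => by rw [hf]; exact id, fun v => by rw [hf]; exact id,
          applied_succ_subset hf fun v => by rw [h5]; exact id⟩
    cases h with
    | invoke κ B hph hB => exact key (by rw [hc']) fun h => by rw [hc'] at h; exact h.elim
    | tick κ B hph => exact ⟨Nat.le_succ _, fun h => absurd h (Nat.succ_ne_self _).symm⟩
    | modify κ B todo e hph he =>
      exact key (by rw [hc']) fun h => same (by simp) (by rw [hph]; trivial) (by rw [hph]; trivial)
        (by rw [hc']; exact id) (by rw [hc'])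
    | editsDone κ B hph =>
      exact key (by rw [hc']) fun h => same (by simp) (by rw [hph]; trivial) (by rw [hph]; trivial)
        (by rw [hc']; exact id) (by rw [hc'])
    | markNewDAG κ B ℓ v hph hv hunm hR =>
      exact key (by rw [hc']) fun h => same (by simp) (by rw [hph]; trivial) (by rw [hph]; trivial)
        (by rw [hc']; exact id) (by rw [hc'])
    | markMerge κ B ℓ v hph hv hunm R hR r₀ hr =>
      exact key (by rw [hc']) fun h => same (by simp) (by rw [hph]; trivial) (by rw [hph]; trivial)
        (by rw [hc']; exact id) (by rw [hc'])
    | link κ B ℓ v r₀ y todo d hph hy hd =>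
      have hI := phaseInv hA
      unfold PhaseInv at hI
      rw [hph] at hI
      exact key (by rw [hc']) fun h => window_of_pre hA (by rw [hph]; trivial)
        (by rw [hph]; trivial) (by rw [hc']; exact id) (hb (by simp))
        (.inr ((hI.2.task _ rfl).todo_root y hy)) (.inr (by rw [hc']))
    | publish κ B ℓ v r₀ hph =>
      have hI := phaseInv hA
      unfold PhaseInv at hI
      rw [hph] at hI
      exact key (by rw [hc']) fun h => window_of_pre hA (by rw [hph]; trivial)
        (by rw [hph]; trivial) (by rw [hc']; exact id) (hb (by simp))
        (.inl (hI.2.task _ rfl).unmarked) (.inr (by rw [hc']))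
    | move κ B ℓ task v hph hv hm =>
      exact key (by rw [hc']) fun h => same (by simp) (by rw [hph]; trivial) (by rw [hph]; trivial)
        (by rw [hc']; simp [hph, Phase.Keeps]) (by rw [hc'])
    | nextRound κ B ℓ hph hℓ hdone =>
      exact key (by rw [hc']) fun h => same (by simp) (by rw [hph]; trivial) (by rw [hph]; trivial)
        (by rw [hc']; exact id) (by rw [hc'])
    | beginUnmark κ B hph =>
      exact key (by rw [hc']) fun h => window_of_keeps (by rw [hph]; trivial)
        (by rw [hc']; trivial) (hb (by simp)) (by rw [hc']; exact fun _ => id)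
    | unmarkRoot r hph hr =>
      exact key (by rw [hc']) fun h => window_of_keeps (by rw [hph]; trivial)
        (by rw [hc']; simp [hph, Phase.Keeps]) (hb (by simp))
        (by rw [hc']; intro v hv; by_cases hvr : v = r <;> simp [hvr, hv])
    | rootsDone hph hr =>
      exact key (by rw [hc']) fun h => window_of_keeps (by rw [hph]; trivial)
        (by rw [hc']; trivial) (hb (by simp)) (by rw [hc']; exact fun _ => id)
    | unmarkOther w hph hw =>
      exact key (by rw [hc']) fun h => window_of_keeps (by rw [hph]; trivial)
        (by rw [hc']; simp [hph, Phase.Keeps]) (hb (by simp))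
        (by rw [hc']; intro v hv; by_cases hvr : v = w <;> simp [hvr, hv])
    | respond hph hv => exact key (by rw [hc']) fun h => by rw [hc'] at h; exact h.elim
  · have hp : (x.cfg (N + 1)).phase = (x.cfg N).phase := by rw [hc']
    have hD : (x.cfg (N + 1)).desc = (x.cfg N).desc := by rw [hc']
    refine ⟨by rw [hc'], fun _ hact => ?_⟩
    rw [hp] at hact
    have hb : x.batch (N + 1) = x.batch N := by
      refine batch_succ ha fun κ B => ?_
      generalize (x.cfg N).reader p = s at h
      cases h <;> simp
    have hf : x.full (N + 1) = x.full N := by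
      by_cases hk : (x.cfg (N + 1)).phase.Keeps
      · exact full_succ_keep hk
      · rw [full_succ_desc hk, hD]
        by_cases hpre : (x.cfg N).phase.Pre
        · obtain ⟨κ, B, todo, ℓ, task, h1, -⟩ := pre_inv hA hpre
          exact h1.full.symm
        · rw [hp] at hk
          generalize (x.cfg N).phase = q at *
          cases q <;> first | exact (hk trivial).elim | exact (hpre trivial).elim
    exact ⟨hact, hb, fun u v => by rw [hf]; exact id, fun v => by rw [hf]; exact id,
      applied_succ_subset hf fun v => by rw [hD]; exact id⟩

end Execution

lemma UpdateStep.not_read {n : ℕ} {P : Type*} {prm : Params} {c c' : Config n P} {a : Event n P}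
    (h : UpdateStep prm c a c') : c'.reader = c.reader ∧ (∀ p v, a ≠ .readInv p v) ∧
      (∀ p, a ≠ .readDesc p) ∧ ∀ p, a ≠ .readL2 p := by
  cases h <;> exact ⟨rfl, by simp, by simp, by simp⟩

namespace Execution

variable {x : Execution n P prm} {N : ℕ} {a : Event n P} {p : P} {v : Fin n}

/-- The step at which the last read of `p` before step `N` is invoked. -/
noncomputable def readInvoked (x : Execution n P prm) (p : P) (N : ℕ) : ℕ :=
  lastBefore (fun k => ∃ v, x.ev k = some (.readInv p v)) N

/-- The last step before `N` with event `a`. -/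
noncomputable def lastEv (x : Execution n P prm) (a : Event n P) (N : ℕ) : ℕ :=
  lastBefore (fun k => x.ev k = some a) N

lemma LastBetween.eq {i j m : ℕ} (h : x.LastBetween a i j m) : x.lastEv a j = m :=
  lastBefore_eq h.2.1 h.2.2.1 h.2.2.2

/-- The current read of `p` is a read of `v`. -/
def Reading (x : Execution n P prm) (p : P) (N : ℕ) (v : Fin n) : Prop :=
  x.readInvoked p N < N ∧ x.ev (x.readInvoked p N) = some (.readInv p v)

/-- The event `a` has happened during the current read of `p`. -/
def Happened (x : Execution n P prm) (p : P) (N : ℕ) (a : Event n P) : Prop :=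
  x.readInvoked p N < x.lastEv a N ∧ x.lastEv a N < N ∧ x.ev (x.lastEv a N) = some a

/-- The batch number has not changed since it was `b`, and a batch is active. -/
def InWindow (x : Execution n P prm) (N b : ℕ) : Prop :=
  (x.cfg N).phase.Active ∧ b = (x.cfg N).batchNum

/-- If the read finds out that `v` is unmarked, then the live level will be correct. -/
def LiveFact (x : Execution n P prm) (N b₁ l₁ : ℕ) (v : Fin n) : Prop :=
  x.InWindow N b₁ → l₁ = x.startLevel N v ∨ v ∈ x.applied N

/-- The descriptor `d` of `v`, read at the last reading of a descriptor, contains the correct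
level. -/
def OldFact (x : Execution n P prm) (p : P) (N b₁ : ℕ) (v : Fin n) (d : Option (Desc n)) : Prop :=
  ∀ d', d = some d' → b₁ = (x.cfg N).batchNum →
    x.absLevel (x.lastEv (.readDesc p) N) v = d'.oldLevel

/-- The invariant of a read that is following the parents. -/
structure CheckFact (x : Execution n P prm) (p : P) (N b₁ l₁ : ℕ) (v : Fin n)
    (d cur : Option (Desc n)) : Prop where
  live : cur = none → x.LiveFact N b₁ l₁ v
  parent : x.InWindow N b₁ → ∀ c q, cur = some c → c.parent = some q →
    x.full N q ≠ none ∧ Conn (x.full N) v q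
  cur_none : d = none → cur = none
  old : ∀ d', d = some d' → b₁ = (x.cfg N).batchNum →
    x.absLevel (x.lastEv (.readDesc p) N) v = d'.oldLevel ∨
      (∀ c, cur = some c → c.parent ≠ none) ∧ ((x.cfg N).phase.Active → v ∈ x.applied N)

/-- The invariant of the reader `p`, for each local state. -/
def ReaderInvAt (x : Execution n P prm) (p : P) (N : ℕ) : Reader n → Prop
  | .idle => True
  | .start v => x.Reading p N v
  | .gotB1 v b₁ => x.Reading p N v ∧ b₁ ≤ (x.cfg N).batchNum
  | .gotL1 v b₁ l₁ => x.Reading p N v ∧ b₁ ≤ (x.cfg N).batchNum ∧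
      (x.InWindow N b₁ → x.full N v = none → l₁ = x.startLevel N v)
  | .checking v b₁ l₁ d cur => x.Reading p N v ∧ b₁ ≤ (x.cfg N).batchNum ∧
      x.Happened p N (.readDesc p) ∧ x.CheckFact p N b₁ l₁ v d cur
  | .checked v b₁ l₁ d m => x.Reading p N v ∧ b₁ ≤ (x.cfg N).batchNum ∧
      x.Happened p N (.readDesc p) ∧ (m = false → x.LiveFact N b₁ l₁ v) ∧
      (m = true → x.OldFact p N b₁ v d)
  | .gotL2 v b₁ l₁ d m l₂ => x.Reading p N v ∧ b₁ ≤ (x.cfg N).batchNum ∧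
      x.Happened p N (.readDesc p) ∧ x.Happened p N (.readL2 p) ∧
      (m = false → l₁ = l₂ → b₁ = (x.cfg N).batchNum →
        x.absLevel (x.lastEv (.readL2 p) N) v = l₂) ∧
      (m = true → x.OldFact p N b₁ v d)
  | .returningOld l => ∃ v, x.Reading p N v ∧ x.Happened p N (.readDesc p) ∧
      x.absLevel (x.lastEv (.readDesc p) N) v = l
  | .returningLive l => ∃ v, x.Reading p N v ∧ x.Happened p N (.readL2 p) ∧
      x.absLevel (x.lastEv (.readL2 p) N) v = l

/-- The invariant of the reader `p`. -/
def ReaderInv (x : Execution n P prm) (p : P) (N : ℕ) : Prop :=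
  x.ReaderInvAt p N ((x.cfg N).reader p)

/-! ### The invariant of a reading process -/

lemma lastEv_succ (h : x.ev N = some a) : x.lastEv a (N + 1) = N := lastBefore_succ h

lemma lastEv_succ_of_ne {b : Event n P} (ha : x.ev N = some a) (h : a ≠ b) :
    x.lastEv b (N + 1) = x.lastEv b N :=
  lastBefore_succ_of_not (by rw [ha]; simpa using h)

lemma readInvoked_succ (h : x.ev N = some (.readInv p v)) : x.readInvoked p (N + 1) = N :=
  lastBefore_succ ⟨v, h⟩

lemma readInvoked_succ_of_ne (ha : x.ev N = some a) (h : ∀ v, a ≠ .readInv p v) :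
    x.readInvoked p (N + 1) = x.readInvoked p N :=
  lastBefore_succ_of_not (by rw [ha]; rintro ⟨v, hv⟩; cases hv; exact h v rfl)

lemma Reading.succ (h : x.Reading p N v) (ha : x.ev N = some a) (h1 : ∀ v, a ≠ .readInv p v) :
    x.Reading p (N + 1) v := by
  rw [Reading, readInvoked_succ_of_ne ha h1]
  exact ⟨h.1.trans (Nat.lt_succ_self N), h.2⟩

lemma Happened.succ {b : Event n P} (h : x.Happened p N b) (ha : x.ev N = some a)
    (h1 : ∀ v, a ≠ .readInv p v) (h2 : a ≠ b) : x.Happened p (N + 1) b := by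
  rw [Happened, readInvoked_succ_of_ne ha h1, lastEv_succ_of_ne ha h2]
  exact ⟨h.1, h.2.1.trans (Nat.lt_succ_self N), h.2.2⟩

lemma Reading.happened {w : Fin n} (h : x.Reading p N w) (ha : x.ev N = some a)
    (h1 : ∀ v, a ≠ .readInv p v) : x.Happened p (N + 1) a := by
  rw [Happened, readInvoked_succ_of_ne ha h1, lastEv_succ ha]
  exact ⟨h.1, Nat.lt_succ_self N, ha⟩

/-- Batch numbers never decrease, so a read whose number is still current was in the same batch one
step earlier. Facts are thus conditional on the window and are pulled back to the moment when they
were observed. -/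
lemma InWindow.pred {b : ℕ} (ha : x.ev N = some a) (hb : b ≤ (x.cfg N).batchNum)
    (h : x.InWindow (N + 1) b) : x.InWindow N b ∧ x.Window N := by
  obtain ⟨h1, h2⟩ := batchNum_succ ha
  have h3 := h.2
  have h4 := h2 (by omega) h.1
  exact ⟨⟨h4.active, by omega⟩, h4⟩

lemma LiveFact.succ {b₁ l₁ : ℕ} (ha : x.ev N = some a) (hb : b₁ ≤ (x.cfg N).batchNum)
    (h : x.LiveFact N b₁ l₁ v) : x.LiveFact (N + 1) b₁ l₁ v := fun hw => by
  obtain ⟨h1, h2⟩ := hw.pred ha hb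
  rw [startLevel_of_batch h2.batch]
  exact (h h1).imp_right fun h' => h2.applied h'

lemma OldFact.succ {b₁ : ℕ} {d : Option (Desc n)} (ha : x.ev N = some a)
    (hne : a ≠ .readDesc p) (hb : b₁ ≤ (x.cfg N).batchNum)
    (h : x.OldFact p N b₁ v d) : x.OldFact p (N + 1) b₁ v d := fun d' hd' hb' => by
  rw [lastEv_succ_of_ne ha hne]
  have := (batchNum_succ ha).1
  exact h d' hd' (by omega)

lemma CheckFact.succ {b₁ l₁ : ℕ} {d cur : Option (Desc n)} (ha : x.ev N = some a)
    (hne : a ≠ .readDesc p) (hb : b₁ ≤ (x.cfg N).batchNum)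
    (h : x.CheckFact p N b₁ l₁ v d cur) : x.CheckFact p (N + 1) b₁ l₁ v d cur where
  live hc := (h.live hc).succ ha hb
  parent hw c q hc hq := by
    obtain ⟨h1, h2⟩ := hw.pred ha hb
    obtain ⟨h3, h4⟩ := h.parent h1 c q hc hq
    exact ⟨h2.full q h3, h2.conn v q h4⟩
  cur_none := h.cur_none
  old d' hd' hb' := by
    rw [lastEv_succ_of_ne ha hne]
    have := (batchNum_succ ha).1
    refine (h.old d' hd' (by omega)).imp_right fun h' => ⟨h'.1, fun hact => ?_⟩
    obtain ⟨h1, h2⟩ := InWindow.pred ha hb ⟨hact, hb'⟩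
    exact h2.applied (h'.2 h1.1)

/-- Steps of the update side and of other readers do not affect the invariant of a reader. -/
lemma ReaderInv.other (h : x.ReaderInv p N) (ha : x.ev N = some a)
    (h1 : ∀ v, a ≠ .readInv p v) (h2 : a ≠ .readDesc p) (h3 : a ≠ .readL2 p)
    (hr : (x.cfg (N + 1)).reader p = (x.cfg N).reader p) : x.ReaderInv p (N + 1) := by
  unfold ReaderInv at *
  rw [hr]
  have hle := (batchNum_succ ha).1
  generalize (x.cfg N).reader p = s at *
  cases s with
  | idle => trivial
  | start v => exact Reading.succ h ha h1
  | gotB1 v b₁ => exact ⟨h.1.succ ha h1, h.2.trans hle⟩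
  | gotL1 v b₁ l₁ =>
    refine ⟨h.1.succ ha h1, h.2.1.trans hle, fun hw hf => ?_⟩
    obtain ⟨h4, h5⟩ := hw.pred ha h.2.1
    rw [startLevel_of_batch h5.batch]
    refine h.2.2 h4 ?_
    by_contra hc
    exact h5.full v hc hf
  | checking v b₁ l₁ d cur =>
    exact ⟨h.1.succ ha h1, h.2.1.trans hle, h.2.2.1.succ ha h1 h2, h.2.2.2.succ ha h2 h.2.1⟩
  | checked v b₁ l₁ d m =>
    exact ⟨h.1.succ ha h1, h.2.1.trans hle, h.2.2.1.succ ha h1 h2,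
      fun hm => (h.2.2.2.1 hm).succ ha h.2.1, fun hm => (h.2.2.2.2 hm).succ ha h2 h.2.1⟩
  | gotL2 v b₁ l₁ d m l₂ =>
    refine ⟨h.1.succ ha h1, h.2.1.trans hle, h.2.2.1.succ ha h1 h2, h.2.2.2.1.succ ha h1 h3,
      fun hm hl hb => ?_, fun hm => (h.2.2.2.2.2 hm).succ ha h2 h.2.1⟩
    rw [lastEv_succ_of_ne ha h3]
    have := h.2.1
    exact h.2.2.2.2.1 hm hl (by omega)
  | returningOld l =>
    obtain ⟨v, h4, h5, h6⟩ := h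
    exact ⟨v, h4.succ ha h1, h5.succ ha h1 h2, by rw [lastEv_succ_of_ne ha h2]; exact h6⟩
  | returningLive l =>
    obtain ⟨v, h4, h5, h6⟩ := h
    exact ⟨v, h4.succ ha h1, h5.succ ha h1 h3, by rw [lastEv_succ_of_ne ha h3]; exact h6⟩

/-- If the DAG of `v` is pending when the descriptor is read, the old level is correct at that
moment. If it is already applied, the descriptor is not that of a root, and from then on no marked
root can be found. -/
lemma CheckFact.start {b₁ l₁ : ℕ} (ha : x.ev N = some (.readDesc p))
    (hb : b₁ ≤ (x.cfg N).batchNum)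
    (h : x.InWindow N b₁ → x.full N v = none → l₁ = x.startLevel N v) :
    x.CheckFact p (N + 1) b₁ l₁ v ((x.cfg N).desc v) ((x.cfg N).desc v) where
  live hd := by
    refine LiveFact.succ ha hb fun hw => ?_
    have hA := (alive_of_ev ha).mono (Nat.le_succ N)
    by_cases hf : x.full N v = none
    · exact .inl (h hw hf)
    · exact .inr (mem_applied_of_desc hA hw.1 hd hf)
  parent hw c q hc hq := by
    have hA := (alive_of_ev ha).mono (Nat.le_succ N)
    obtain ⟨-, h2⟩ := hw.pred ha hb
    obtain ⟨h3, h4⟩ := parent_of_desc hA hc hq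
    exact ⟨h2.full q h3, h2.conn v q h4⟩
  cur_none := id
  old d' hd' hb' := by
    have hA := (alive_of_ev ha).mono (Nat.le_succ N)
    rw [lastEv_succ ha]
    by_cases hv : v ∈ x.applied N
    · refine .inr ⟨fun c hc hp => notMem_applied_of_root hA hc hp hv, fun hact => ?_⟩
      obtain ⟨-, h2⟩ := InWindow.pred ha hb ⟨hact, hb'⟩
      exact h2.applied hv
    · exact .inl (absLevel_of_desc hA hd' hv)

/-- The entry `q` is connected to `v`. If `q` is found unmarked, its DAG, which is that of `v`, is
applied. If it is found to be a marked root, that DAG is pending, so it was also pending when the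
descriptor of `v` was read. -/
lemma CheckFact.follow {b₁ l₁ old : ℕ} {d : Option (Desc n)} {q : Fin n}
    (ha : x.ev N = some (.checkDAG p)) (hb : b₁ ≤ (x.cfg N).batchNum)
    (h : x.CheckFact p N b₁ l₁ v d (some ⟨old, some q⟩)) :
    x.CheckFact p (N + 1) b₁ l₁ v d ((x.cfg N).desc q) where
  live hd := by
    have hA := (alive_of_ev ha).mono (Nat.le_succ N)
    refine LiveFact.succ ha hb fun hw => ?_
    obtain ⟨h3, h4⟩ := h.parent hw _ q rfl rfl
    exact .inr ((h4 _ (closed_applied x N)).2 (mem_applied_of_desc hA hw.1 hd h3))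
  parent hw c q' hc hq := by
    have hA := (alive_of_ev ha).mono (Nat.le_succ N)
    obtain ⟨h1, h2⟩ := hw.pred ha hb
    obtain ⟨-, h4⟩ := h.parent h1 _ q rfl rfl
    obtain ⟨h5, h6⟩ := parent_of_desc hA hc hq
    exact ⟨h2.full q' h5, h2.conn v q' (h4.trans h6)⟩
  cur_none hd := by have := h.cur_none hd; simp at this
  old d' hd' hb' := by
    have hA := (alive_of_ev ha).mono (Nat.le_succ N)
    rw [lastEv_succ_of_ne ha (by simp)]
    have hle := (batchNum_succ ha).1
    refine (h.old d' hd' (by omega)).imp_right fun h' => ⟨fun c hc hp => ?_, fun hact => ?_⟩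
    · have hact := (desc_some hA hc).1
      obtain ⟨-, h4⟩ := h.parent ⟨hact, by omega⟩ _ q rfl rfl
      exact notMem_applied_of_root hA hc hp ((h4 _ (closed_applied x N)).1 (h'.2 hact))
    · obtain ⟨h1, h2⟩ := InWindow.pred ha hb ⟨hact, hb'⟩
      exact h2.applied (h'.2 h1.1)

lemma ReaderInv.succ (h : x.ReaderInv p N) (ha : x.ev N = some a) : x.ReaderInv p (N + 1) := by
  have hA := (alive_of_ev ha).mono (Nat.le_succ N)
  have hle := (batchNum_succ ha).1
  rcases step_cases ha with hu | ⟨p', s', hs, hc'⟩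
  · obtain ⟨h1, h2, h3, h4⟩ := hu.not_read
    exact h.other ha (h2 p) (h3 p) (h4 p) (by rw [h1])
  · by_cases hp : p' = p
    · subst hp
      have hr : (x.cfg (N + 1)).reader p' = s' := by rw [hc']; simp
      unfold ReaderInv at *
      rw [hr]
      generalize (x.cfg N).reader p' = s at *
      cases hs with
      | invoke v =>
        change x.Reading p' (N + 1) v
        rw [Reading, readInvoked_succ ha]
        exact ⟨Nat.lt_succ_self N, ha⟩
      | readB1 v => exact ⟨Reading.succ h ha (by simp), hle⟩
      | readL1 v b₁ =>
        refine ⟨h.1.succ ha (by simp), h.2.trans hle, fun hw hf => ?_⟩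
        obtain ⟨h4, h5⟩ := hw.pred ha h.2
        rw [startLevel_of_batch h5.batch]
        -- A vertex unmarked after this step was unmarked at it, so the live level just read is the
        -- one before the batch.
        refine level_of_full hA h4.1 ?_
        by_contra hc
        exact h5.full v hc hf
      | readDesc v b₁ l₁ =>
        exact ⟨h.1.succ ha (by simp), h.2.1.trans hle, h.1.happened ha (by simp),
          CheckFact.start ha h.2.1 h.2.2⟩
      | checkUnmarked v b₁ l₁ d =>
        exact ⟨h.1.succ ha (by simp), h.2.1.trans hle, h.2.2.1.succ ha (by simp) (by simp),
          fun _ => (h.2.2.2.live rfl).succ ha h.2.1, by simp⟩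
      | checkMarked v b₁ l₁ d old =>
        refine ⟨h.1.succ ha (by simp), h.2.1.trans hle, h.2.2.1.succ ha (by simp) (by simp),
          by simp, fun _ => OldFact.succ ha (by simp) h.2.1 fun d' hd' hb' => ?_⟩
        -- Reaching a marked root excludes the alternative that the DAG was already applied when the
        -- descriptor was read.
        exact (h.2.2.2.old d' hd' hb').resolve_right fun h' => h'.1 _ rfl rfl
      | checkParent v b₁ l₁ d old q =>
        exact ⟨h.1.succ ha (by simp), h.2.1.trans hle, h.2.2.1.succ ha (by simp) (by simp),
          h.2.2.2.follow ha h.2.1⟩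
      | readL2 v b₁ l₁ d m =>
        refine ⟨h.1.succ ha (by simp), h.2.1.trans hle, h.2.2.1.succ ha (by simp) (by simp),
          h.1.happened ha (by simp), fun hm hl hb => ?_,
          fun hm => (h.2.2.2.2 hm).succ ha (by simp) h.2.1⟩
        rw [lastEv_succ ha]
        by_cases hact : (x.cfg N).phase.Active
        · have h' := h.2.2.2.1 hm ⟨hact, by have := h.2.1; omega⟩
          by_cases hv : v ∈ x.applied N
          · exact mix_of_mem hv
          · exact mix_of_eq (by rw [← hl]; exact h'.resolve_right hv)
        · rw [absLevel_of_not_active hA hact]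
      | retryBatch v b₁ l₁ d m l₂ hb => exact Reading.succ h.1 ha (by simp)
      | acceptOld v b₁ l₁ d l₂ hb =>
        refine ⟨v, h.1.succ ha (by simp), h.2.2.1.succ ha (by simp) (by simp), ?_⟩
        rw [lastEv_succ_of_ne ha (by simp)]
        exact h.2.2.2.2.2 rfl d rfl hb
      | acceptLive v b₁ l₁ d l₂ hb hl =>
        refine ⟨v, h.1.succ ha (by simp), h.2.2.2.1.succ ha (by simp) (by simp), ?_⟩
        rw [lastEv_succ_of_ne ha (by simp)]
        exact h.2.2.2.2.1 rfl hl hb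
      | retryLevel v b₁ l₁ d l₂ hb hl => exact Reading.succ h.1 ha (by simp)
      | returnOld l => trivial
      | returnLive l => trivial
    · have hr : (x.cfg (N + 1)).reader p = (x.cfg N).reader p := by
        rw [hc']; exact Function.update_of_ne (Ne.symm hp) ..
      generalize (x.cfg N).reader p' = s at hs
      cases hs <;> exact h.other ha (by simp [hp]) (by simp [hp]) (by simp [hp]) hr

lemma readerInv (p : P) (h : x.Alive N) : x.ReaderInv p N := by
  induction N with
  | zero => rw [ReaderInv, x.init]; trivial
  | succ N ih =>
    obtain ⟨a, ha⟩ := Option.ne_none_iff_exists'.1 (h N (Nat.lt_succ_self N))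
    exact (ih (h.mono (Nat.le_succ N))).succ ha

/-- A process does not invoke a read before its last read has returned. -/
lemma reader_ne_idle {i : ℕ} (hi : x.ev i = some (.readInv p v)) (hN : i < N) (hA : x.Alive N)
    (hr : ∀ k, i < k → k < N → ∀ a, x.ev k = some a → ¬ Event.IsReturnOf p a) :
    (x.cfg N).reader p ≠ .idle ∧ x.readInvoked p N = i := by
  induction N with
  | zero => omega
  | succ N ih =>
    rcases Nat.lt_succ_iff_lt_or_eq.1 hN with hN' | rfl
    · obtain ⟨h1, h2⟩ := ih hN' (hA.mono (Nat.le_succ N)) fun k hk hk' => hr k hk (by omega)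
      obtain ⟨a, ha⟩ := Option.ne_none_iff_exists'.1 (hA N (Nat.lt_succ_self N))
      have hret := hr N hN' (Nat.lt_succ_self N) a ha
      rcases step_cases ha with hu | ⟨p', s', hs, hc'⟩
      · rw [hu.not_read.1, ← h2]
        exact ⟨h1, readInvoked_succ_of_ne ha (hu.not_read.2.1 p)⟩
      · by_cases hp : p' = p
        · subst hp
          have hr : (x.cfg (N + 1)).reader p' = s' := by rw [hc']; simp
          rw [hr, ← h2]
          generalize (x.cfg N).reader p' = s at *
          cases hs <;> first
            | exact (h1 rfl).elim
            | exact (hret ⟨_, .inl rfl⟩).elim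
            | exact (hret ⟨_, .inr rfl⟩).elim
            | exact ⟨by simp, readInvoked_succ_of_ne ha (by simp)⟩
        · have hr : (x.cfg (N + 1)).reader p = (x.cfg N).reader p := by
            rw [hc']; exact Function.update_of_ne (Ne.symm hp) ..
          rw [hr, ← h2]
          refine ⟨h1, readInvoked_succ_of_ne ha ?_⟩
          generalize (x.cfg N).reader p' = s at hs
          cases hs <;> simp [hp]
    · have hA' := hA.mono (Nat.le_succ i)
      refine ⟨?_, readInvoked_succ hi⟩
      rcases step_cases hi with hu | ⟨p', s', hs, hc'⟩
      · cases hu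
      · generalize (x.cfg i).reader p' = s at hs
        cases hs
        rw [hc']
        simp

/-- A read that returns an old level returns the correct value at the last reading of the
descriptor. -/
lemma returnOld_spec {i j : ℕ} {val : ℝ} (h : x.RespondsAt (.read i p v val) j)
    (hj : x.ev j = some (.returnOld p val)) :
    x.LastBetween (.readDesc p) i j (x.lastEv (.readDesc p) j) ∧
      val = prm.estimate n (x.absLevel (x.lastEv (.readDesc p) j) v) := by
  have hA := (alive_of_ev hj).mono (Nat.le_succ j)
  have hi := (reader_ne_idle h.1 h.2.1.1 hA h.2.1.2.2).2
  have hinv := readerInv p hA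
  unfold ReaderInv at hinv
  rcases step_cases hj with hu | ⟨p', s', hs, -⟩
  · cases hu
  · generalize hrd : (x.cfg j).reader p' = s at hs
    cases hs
    rw [hrd] at hinv
    obtain ⟨v', h1, h2, h3⟩ := hinv
    have hv : v' = v := by
      have := h1.2
      rw [hi, h.1] at this
      cases this
      rfl
    subst hv
    refine ⟨⟨hi ▸ h2.1, h2.2.1, h2.2.2, ?_⟩, by rw [h3]⟩
    exact (lastBefore_spec ⟨_, h2.2.1, h2.2.2⟩).2.2

/-- A read that returns a live level returns the correct value at the last reading of the live
level. -/
lemma returnLive_spec {i j : ℕ} {val : ℝ} (h : x.RespondsAt (.read i p v val) j)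
    (hj : x.ev j = some (.returnLive p val)) :
    x.LastBetween (.readL2 p) i j (x.lastEv (.readL2 p) j) ∧
      val = prm.estimate n (x.absLevel (x.lastEv (.readL2 p) j) v) := by
  have hA := (alive_of_ev hj).mono (Nat.le_succ j)
  have hi := (reader_ne_idle h.1 h.2.1.1 hA h.2.1.2.2).2
  have hinv := readerInv p hA
  unfold ReaderInv at hinv
  rcases step_cases hj with hu | ⟨p', s', hs, -⟩
  · cases hu
  · generalize hrd : (x.cfg j).reader p' = s at hs
    cases hs
    rw [hrd] at hinv
    obtain ⟨v', h1, h2, h3⟩ := hinv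
    have hv : v' = v := by
      have := h1.2
      rw [hi, h.1] at this
      cases this
      rfl
    subst hv
    refine ⟨⟨hi ▸ h2.1, h2.2.1, h2.2.2, ?_⟩, by rw [h3]⟩
    exact (lastBefore_spec ⟨_, h2.2.1, h2.2.2⟩).2.2

end Execution

/-! ## Properties of the linearization points -/

lemma UpdateStep.phase_change {n : ℕ} {P : Type*} {prm : Params} {c c' : Config n P}
    {a : Event n P} (h : UpdateStep prm c a c') :
    (c.phase.Pre → a ≠ .beginUnmark → c'.phase.Pre) ∧
    (c.phase ≠ .quiescent → a ≠ .batchResp → c'.phase ≠ .quiescent) ∧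
    (∀ κ B, a = .batchInv κ B → c.phase = .quiescent ∧ c'.phase = .invoked κ B) ∧
    (a = .beginUnmark → c'.phase = .unmarkingRoots) ∧
    (a = .batchResp → c.phase = .unmarkingRest ∧ c'.phase = .quiescent) ∧
    (∀ r, a = .unmarkRoot r → c.phase = .unmarkingRoots ∧ IsRoot c.desc r) := by
  cases h <;> simp_all [Phase.Pre]

namespace Execution

variable {x : Execution n P prm} {N i s t : ℕ} {κ : Kind} {B : Finset (Sym2 (Fin n))}
  {a : Event n P} {p : P} {v r : Fin n} {e : Sym2 (Fin n)}

/-! ### Batches, their settling and their DAGs -/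

lemma FirstAfter.unique {Q : Event n P → Prop} {j j' : ℕ} (h : x.FirstAfter Q i j)
    (h' : x.FirstAfter Q i j') : j = j' := by
  obtain ⟨h1, ⟨a, ha, hQ⟩, h2⟩ := h
  obtain ⟨h1', ⟨a', ha', hQ'⟩, h2'⟩ := h'
  rcases lt_trichotomy j j' with hlt | heq | hlt
  · exact (h2' j h1 hlt a ha hQ).elim
  · exact heq
  · exact (h2 j' h1' hlt a' ha' hQ').elim

lemma exists_firstAfter {Q : Event n P → Prop} {k : ℕ} (hk : i < k) (ha : x.ev k = some a)
    (hQ : Q a) : ∃ j, j ≤ k ∧ x.FirstAfter Q i j := by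
  classical
  have hex : ∃ j, i < j ∧ ∃ a, x.ev j = some a ∧ Q a := ⟨k, hk, a, ha, hQ⟩
  refine ⟨Nat.find hex, Nat.find_min' hex ⟨hk, a, ha, hQ⟩, (Nat.find_spec hex).1,
    (Nat.find_spec hex).2, fun m hm hm' b hb hQb => ?_⟩
  exact Nat.find_min hex hm' ⟨hm, b, hb, hQb⟩

/-- How a step changes the phase. -/
lemma phase_succ (ha : x.ev N = some a) :
    ((x.cfg N).phase.Pre → a ≠ .beginUnmark → (x.cfg (N + 1)).phase.Pre) ∧
    ((x.cfg N).phase ≠ .quiescent → a ≠ .batchResp → (x.cfg (N + 1)).phase ≠ .quiescent) ∧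
    (∀ κ B, a = .batchInv κ B → (x.cfg N).phase = .quiescent ∧
      (x.cfg (N + 1)).phase = .invoked κ B) ∧
    (a = .beginUnmark → (x.cfg (N + 1)).phase = .unmarkingRoots) ∧
    (a = .batchResp → (x.cfg N).phase = .unmarkingRest ∧ (x.cfg (N + 1)).phase = .quiescent) ∧
    (∀ r, a = .unmarkRoot r → (x.cfg N).phase = .unmarkingRoots ∧ IsRoot (x.cfg N).desc r) := by
  rcases step_cases ha with h | ⟨p, s', h, hc'⟩
  · exact h.phase_change
  · have hp : (x.cfg (N + 1)).phase = (x.cfg N).phase := by rw [hc']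
    rw [hp]
    generalize (x.cfg N).reader p = s at h
    cases h <;> exact ⟨fun h _ => h, fun h _ => h, by simp, by simp, by simp, by simp⟩

lemma batch_of_busy (hi : x.ev i = some (.batchInv κ B)) (hN : i < N) (hA : x.Alive N)
    (hr : ∀ k, i < k → k < N → x.ev k ≠ some .batchResp) :
    x.batch N = i ∧ (x.cfg N).phase ≠ .quiescent := by
  induction N with
  | zero => omega
  | succ N ih =>
    rcases Nat.lt_succ_iff_lt_or_eq.1 hN with hN' | rfl
    · obtain ⟨h1, h2⟩ := ih hN' (hA.mono (Nat.le_succ N)) fun k hk hk' => hr k hk (by omega)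
      obtain ⟨a, ha⟩ := Option.ne_none_iff_exists'.1 (hA N (Nat.lt_succ_self N))
      obtain ⟨-, h3, h4, -⟩ := phase_succ ha
      refine ⟨by rw [batch_succ ha fun κ B h => h2 (h4 κ B h).1, h1], h3 h2 ?_⟩
      rintro rfl
      exact hr N hN' (Nat.lt_succ_self N) ha
    · obtain ⟨-, -, h4, -⟩ := phase_succ hi
      refine ⟨batch_succ_inv hi, ?_⟩
      rw [(h4 κ B rfl).2]
      simp

lemma batch_of_pre (hi : x.ev i = some (.batchInv κ B)) (hN : i < N) (hA : x.Alive N)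
    (hr : ∀ k, i < k → k < N → x.ev k ≠ some .beginUnmark) :
    x.batch N = i ∧ (x.cfg N).phase.Pre := by
  induction N with
  | zero => omega
  | succ N ih =>
    rcases Nat.lt_succ_iff_lt_or_eq.1 hN with hN' | rfl
    · obtain ⟨h1, h2⟩ := ih hN' (hA.mono (Nat.le_succ N)) fun k hk hk' => hr k hk (by omega)
      obtain ⟨a, ha⟩ := Option.ne_none_iff_exists'.1 (hA N (Nat.lt_succ_self N))
      obtain ⟨h3, -, h4, -⟩ := phase_succ ha
      refine ⟨by rw [batch_succ ha fun κ B h => by rw [(h4 κ B h).1] at h2; exact h2, h1],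
        h3 h2 ?_⟩
      rintro rfl
      exact hr N hN' (Nat.lt_succ_self N) ha
    · obtain ⟨-, -, h4, -⟩ := phase_succ hi
      refine ⟨batch_succ_inv hi, ?_⟩
      rw [(h4 κ B rfl).2]
      trivial

lemma SettlesAt.ev (hs : x.SettlesAt i s) : x.ev s = some .beginUnmark := by
  obtain ⟨-, ⟨a, ha, rfl⟩, -⟩ := hs
  exact ha

lemma SettlesAt.pre (hs : x.SettlesAt i s) (hi : x.ev i = some (.batchInv κ B)) (hN : i < N)
    (hNs : N ≤ s) : x.Alive N ∧ x.batch N = i ∧ (x.cfg N).phase.Pre := by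
  have hA : x.Alive N := (alive_of_ev hs.ev).mono (by omega)
  exact ⟨hA, batch_of_pre hi hN hA fun k hk hk' he => hs.2.2 k hk (by omega) _ he rfl⟩

lemma PostHist.of_settles {κ' : Kind} {B' : Finset (Sym2 (Fin n))} {s' : ℕ}
    (h : x.PostHist N κ' B' s') (hb : x.batch N = i) (hi : x.ev i = some (.batchInv κ B))
    (hs : x.SettlesAt i s) : x.PostHist N κ B s := by
  have h1 := h.inv
  rw [hb, hi] at h1
  cases h1
  have h2 := h.settles
  rw [hb] at h2
  rw [FirstAfter.unique hs h2]
  exact h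

lemma SettlesAt.post (hs : x.SettlesAt i s) (hi : x.ev i = some (.batchInv κ B)) :
    x.batch (s + 1) = i ∧ x.PostHist (s + 1) κ B s := by
  obtain ⟨hA, hb, hp⟩ := hs.pre hi hs.1 le_rfl
  have hb' : x.batch (s + 1) = i := by rw [batch_succ hs.ev (by simp), hb]
  have hph := (phase_succ hs.ev).2.2.2.1 rfl
  obtain ⟨κ', B', s', h⟩ := post_inv (alive_of_ev hs.ev) (by rw [hph]; exact id)
    (by rw [hph]; simp)
  exact ⟨hb', h.of_settles hb' hi hs⟩

/-- The invariant of the rounds, when the batch settles. -/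
lemma SettlesAt.reb (hs : x.SettlesAt i s) (hi : x.ev i = some (.batchInv κ B)) :
    RebInv prm κ (↑B) (x.cfg i).G (x.cfg i).level (x.cfg s).level (x.cfg s).desc
      (prm.topLevel n) none := by
  obtain ⟨hb, h⟩ := hs.post hi
  have h' := h.reb
  rw [h.full, h.level, startGraph, startLevel, hb] at h'
  exact h'

lemma SettlesAt.not_diag (hs : x.SettlesAt i s) (hi : x.ev i = some (.batchInv κ B))
    (he : e ∈ B) : ¬ e.IsDiag :=
  (hs.post hi).2.diag e he

lemma SettlesAt.marked (hs : x.SettlesAt i s) (hi : x.ev i = some (.batchInv κ B))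
    (hv : x.Changes i s v) : (x.cfg s).desc v ≠ none := fun hn =>
  hv ((hs.reb hi).unmarked v hn).symm

/-- Batch neighbours are always related, so whichever endpoint is marked second joins the DAG of the
first, and later links never separate them. -/
theorem sameDAG (x : Execution n P prm) : x.SameDAG := by
  rintro i s κ u v ⟨B, hi, hB⟩ hs hu hv
  refine ⟨⟨hs.marked hi hu, hs.marked hi hv⟩, fun t ht hts hut hvt => ?_⟩
  obtain ⟨hA, hb, hp⟩ := hs.pre hi ht hts
  obtain ⟨κ', B', todo, ℓ, task, h1, h2⟩ := pre_inv hA hp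
  have h3 := h1.inv
  rw [hb, hi] at h3
  cases h3
  obtain ⟨r, hr⟩ := h2.root u hut
  exact ⟨r, hr, hr.of_conn (h2.relB u v hut hvt hB)⟩

/-- The root does not depend on the endpoint chosen: two moved endpoints are marked batch neighbours
and hence connected. -/
lemma IsRootOfDAG.rootOf (h : x.IsRootOfDAG i s e r) (hs : x.SettlesAt i s)
    (hi : x.ev i = some (.batchInv κ B)) (he : e ∈ B) (hv : v ∈ e) (hc : x.Changes i s v) :
    RootOf (x.cfg s).desc v r := by
  obtain ⟨w, hw, hcw, hr⟩ := h
  by_cases hwv : w = v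
  · exact hwv ▸ hr
  · have heq : e = s(w, v) := (Sym2.mem_and_mem_iff hwv).1 ⟨hw, hv⟩
    subst heq
    exact hr.of_conn ((hs.reb hi).relB w v (hs.marked hi hcw) (hs.marked hi hc) he)

lemma IsRootOfDAG.unique {r' : Fin n} (h : x.IsRootOfDAG i s e r) (h' : x.IsRootOfDAG i s e r')
    (hs : x.SettlesAt i s) (hi : x.ev i = some (.batchInv κ B)) (he : e ∈ B) : r = r' := by
  obtain ⟨w, hw, hcw, hr⟩ := id h
  exact hr.unique (h'.rootOf hs hi he hw hcw)

theorem uniqueDAG (x : Execution n P prm) : x.UniqueDAG := by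
  rintro i s κ e ⟨B, hi, hB⟩ hs ⟨v, hv, hc⟩
  obtain ⟨r, hr⟩ := (hs.reb hi).root v (hs.marked hi hc)
  have h : x.IsRootOfDAG i s e r := ⟨v, hv, hc, hr⟩
  exact ⟨r, h, fun r' hr' => hr'.unique h hs hi hB⟩

/-- The root of a visible update is unmarked before the batch responds. -/
lemma root_unmarked_of_resp {j : ℕ} (hi : x.ev i = some (.batchInv κ B))
    (hj : x.FirstAfter (fun a => a = .batchResp) i j) :
    x.batch j = i ∧ ∃ s, x.PostHist j κ B s ∧ x.SettlesAt i s ∧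
      ∀ r, IsRoot (x.cfg s).desc r → ∃ t, s < t ∧ t < j ∧ x.ev t = some (.unmarkRoot r) := by
  obtain ⟨hij, ⟨a, ha, rfl⟩, hno⟩ := hj
  have hA := (alive_of_ev ha).mono (Nat.le_succ j)
  obtain ⟨hb, -⟩ := batch_of_busy hi hij hA fun k hk hk' he => hno k hk hk' _ he rfl
  have hph := ((phase_succ ha).2.2.2.2.1 rfl).1
  have h := phaseInv hA
  unfold PhaseInv at h
  rw [hph] at h
  obtain ⟨κ', B', s, h, hr⟩ := h
  have hs : x.SettlesAt i s := hb ▸ h.settles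
  have h' := h.of_settles hb hi hs
  refine ⟨hb, s, h', hs, fun r hr' => ?_⟩
  rw [← h.full] at hr'
  exact h.root_exists r hr' (hr r hr')

/-- The unmarking of the root of a visible update belongs to the batch of the update. -/
lemma post_of_unmarkRoot (hi : x.ev i = some (.batchInv κ B)) (hs : x.SettlesAt i s)
    (hr : IsRoot (x.cfg s).desc r) (ht : x.FirstAfter (fun a => a = .unmarkRoot r) s t) :
    x.ev t = some (.unmarkRoot r) ∧ x.batch t = i ∧ x.PostHist t κ B s ∧
      ∀ k, i < k → k ≤ t → x.ev k ≠ some .batchResp := by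
  obtain ⟨hst, ⟨a, ha, rfl⟩, hno⟩ := ht
  have hA := (alive_of_ev ha).mono (Nat.le_succ t)
  -- A response would require that `r` was unmarked earlier in the batch, but `t` is the first
  -- unmarking of `r` after `s`.
  have hresp : ∀ k, i < k → k ≤ t → x.ev k ≠ some .batchResp := by
    intro k hk hkt he
    obtain ⟨j, hjk, hj⟩ := exists_firstAfter (Q := fun a => a = .batchResp) hk he rfl
    obtain ⟨-, s', -, hs', h⟩ := root_unmarked_of_resp hi hj
    rw [FirstAfter.unique hs' hs] at h
    obtain ⟨t', h1, h2, h3⟩ := h r hr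
    exact hno t' h1 (by omega) _ h3 rfl
  have hit : i < t := lt_trans hs.1 hst
  obtain ⟨hb, hq⟩ := batch_of_busy hi hit hA fun k hk hk' => hresp k hk hk'.le
  have hph := ((phase_succ ha).2.2.2.2.2 r rfl).1
  obtain ⟨κ', B', s', h⟩ := post_inv hA (by rw [hph]; exact id) hq
  exact ⟨ha, hb, h.of_settles hb hi hs, hresp⟩

/-- The time at which a visible update of `e` is linearized, if its root is unmarked at step `t`. -/
noncomputable def visTime (x : Execution n P prm) (eid : Sym2 (Fin n) → ℕ) (t : ℕ)
    (e : Sym2 (Fin n)) : ℝ :=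
  x.time t + (x.time (t + 1) - x.time t) * (eid e / ((n : ℝ) * (n - 1) / 2 + 1))

/-- The operation `o` with the linearization point `τ` is linearized at step `N` with event `a`. -/
inductive LinAt (x : Execution n P prm) (eid : Sym2 (Fin n) → ℕ) (N : ℕ) (τ : ℝ) :
    Op n P → Event n P → Prop where
  | invisible (κ : Kind) (B : Finset (Sym2 (Fin n))) (e : Sym2 (Fin n)) (s : ℕ)
      (hi : x.ev (x.batch N) = some (.batchInv κ B)) (he : e ∈ B) (hb : x.batch N < N)
      (hs : x.SettlesAt (x.batch N) s) (hNs : N < s) (hτ : τ = x.time N) :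
      LinAt x eid N τ (.update (x.batch N) κ e) (.modify e)
  | visible (κ : Kind) (B : Finset (Sym2 (Fin n))) (e : Sym2 (Fin n)) (s : ℕ) (r : Fin n)
      (hi : x.ev (x.batch N) = some (.batchInv κ B)) (he : e ∈ B)
      (hs : x.SettlesAt (x.batch N) s) (hN : s < N)
      (hresp : ∀ k, x.batch N < k → k ≤ N → x.ev k ≠ some .batchResp)
      (hτ : τ = x.visTime eid N e) :
      LinAt x eid N τ (.update (x.batch N) κ e) (.unmarkRoot r)
  | readOld (i j : ℕ) (p : P) (v : Fin n) (val : ℝ)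
      (hop : x.RespondsAt (.read i p v val) j) (hj : x.ev j = some (.returnOld p val))
      (hm : x.LastBetween (.readDesc p) i j N) (hτ : τ = x.time N) :
      LinAt x eid N τ (.read i p v val) (.readDesc p)
  | readLive (i j : ℕ) (p : P) (v : Fin n) (val : ℝ)
      (hop : x.RespondsAt (.read i p v val) j) (hj : x.ev j = some (.returnLive p val))
      (hm : x.LastBetween (.readL2 p) i j N) (hτ : τ = x.time N) :
      LinAt x eid N τ (.read i p v val) (.readL2 p)

section Points

variable {eid : Sym2 (Fin n) → ℕ} {o o' : Op n P} {τ τ' : ℝ}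

lemma LinPoint.linAt (h : x.LinPoint eid o τ) :
    ∃ N a, x.ev N = some a ∧ x.LinAt eid N τ o a := by
  cases h with
  | invisible i s m κ e hop hs hvis him hms hm =>
    obtain ⟨B, hi, he⟩ := hop
    obtain ⟨-, hb, -⟩ := hs.pre hi him hms.le
    subst hb
    exact ⟨m, _, hm, .invisible κ B e s hi he him hs hms rfl⟩
  | visible i s t κ e r hop hs hvis hr ht =>
    obtain ⟨B, hi, he⟩ := hop
    obtain ⟨w, hw, hcw, hr'⟩ := id hr
    obtain ⟨h1, h2, h3, h4⟩ := post_of_unmarkRoot hi hs hr'.2 ht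
    subst h2
    exact ⟨t, _, h1, .visible κ B e s r hi he hs ht.1 h4 rfl⟩
  | readOld i j m p v val hop hj hm => exact ⟨m, _, hm.2.2.1, .readOld i j p v val hop hj hm rfl⟩
  | readLive i j m p v val hop hj hm => exact ⟨m, _, hm.2.2.1, .readLive i j p v val hop hj hm rfl⟩

/-- Updates linearized by the same unmarking share a time slot, and their edge identifiers order
them within it. -/
lemma visTime_lt {e' : Sym2 (Fin n)} (x : Execution n P prm) (N : ℕ) (h : eid e < eid e') :
    x.visTime eid N e < x.visTime eid N e' := by
  have h1 : (0 : ℝ) < (n : ℝ) * (n - 1) / 2 + 1 := by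
    rcases Nat.eq_zero_or_pos n with rfl | hn
    · norm_num
    · have : (1 : ℝ) ≤ n := by exact_mod_cast hn
      have : 0 ≤ (n : ℝ) * (n - 1) := mul_nonneg (by linarith) (by linarith)
      linarith
  have h2 : x.time N < x.time (N + 1) := x.time_mono (Nat.lt_succ_self N)
  have h3 : (eid e : ℝ) < eid e' := by exact_mod_cast h
  unfold visTime
  have := div_lt_div_of_pos_right h3 h1
  have := mul_lt_mul_of_pos_left this (sub_pos.2 h2)
  linarith

lemma visTime_mem (x : Execution n P prm) (N : ℕ) (h1 : 1 ≤ eid e)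
    (h2 : eid e ≤ n * (n - 1) / 2) :
    x.time N < x.visTime eid N e ∧ x.visTime eid N e < x.time (N + 1) := by
  have hd : (eid e : ℝ) < (n : ℝ) * (n - 1) / 2 + 1 := by
    -- The bound on identifiers uses integer division and the formula for the time uses real
    -- division; doubling avoids any parity argument.
    have h3 : eid e * 2 ≤ n * (n - 1) := by omega
    have h4 : ((n * (n - 1) : ℕ) : ℝ) = (n : ℝ) * (n - 1) := by
      rcases Nat.eq_zero_or_pos n with rfl | hn
      · simp
      · push_cast [Nat.cast_sub hn]; ring
    have h5 : (eid e : ℝ) * 2 ≤ (n : ℝ) * (n - 1) := by rw [← h4]; exact_mod_cast h3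
    linarith
  have h0 : (0 : ℝ) < eid e := by exact_mod_cast h1
  have ht : 0 < x.time (N + 1) - x.time N := sub_pos.2 (x.time_mono (Nat.lt_succ_self N))
  unfold visTime
  have h6 := mul_pos ht (div_pos h0 (h0.trans hd))
  have h7 := mul_lt_mul_of_pos_left ((div_lt_one (h0.trans hd)).2 hd) ht
  constructor <;> linarith

/-- The time `τ` is not earlier than step `N`, and earlier than the next step. -/
def InSlot (x : Execution n P prm) (N : ℕ) (τ : ℝ) : Prop := x.time N ≤ τ ∧ τ < x.time (N + 1)

lemma inSlot_self (x : Execution n P prm) (N : ℕ) : x.InSlot N (x.time N) :=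
  ⟨le_rfl, x.time_mono (Nat.lt_succ_self N)⟩

lemma InSlot.unique {M : ℕ} (h : x.InSlot N τ) (h' : x.InSlot M τ) : N = M := by
  have h1 := x.time_mono.lt_iff_lt.1 (h.1.trans_lt h'.2)
  have h2 := x.time_mono.lt_iff_lt.1 (h'.1.trans_lt h.2)
  omega

variable (eid_range : ∀ e : Sym2 (Fin n), ¬ e.IsDiag → 1 ≤ eid e ∧ eid e ≤ n * (n - 1) / 2)

include eid_range

lemma LinAt.inSlot (h : x.LinAt eid N τ o a) : x.InSlot N τ := by
  cases h with
  | invisible κ B e s hi he hb hs hNs hτ => rw [hτ]; exact inSlot_self x N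
  | visible κ B e s r hi he hs hN hresp hτ =>
    rw [hτ]
    obtain ⟨h1, h2⟩ := eid_range e (hs.not_diag hi he)
    obtain ⟨h3, h4⟩ := visTime_mem x N h1 h2
    exact ⟨h3.le, h4⟩
  | readOld i j p v val hop hj hm hτ => rw [hτ]; exact inSlot_self x N
  | readLive i j p v val hop hj hm hτ => rw [hτ]; exact inSlot_self x N

lemma LinPoint.linAt_of_inSlot (h : x.LinPoint eid o τ) (hN : x.InSlot N τ) :
    ∃ a, x.ev N = some a ∧ x.LinAt eid N τ o a := by
  obtain ⟨M, a, ha, h'⟩ := h.linAt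
  rw [hN.unique (h'.inSlot eid_range)]
  exact ⟨a, ha, h'⟩

omit eid_range

/-- An edge is modified once per batch, a visible update has one root, and a read has one return
event; visibility and the kind of return exclude mixed cases. -/
lemma LinPoint.unique (h : x.LinPoint eid o τ) (h' : x.LinPoint eid o τ') : τ = τ' := by
  cases h with
  | invisible i s m κ e hop hs hvis him hms hm =>
    cases h' with
    | invisible _ s' m' _ _ hop' hs' hvis' him' hms' hm' =>
      have := FirstAfter.unique hs hs'
      subst this
      obtain ⟨B, hi, he⟩ := hop
      obtain ⟨hb, h⟩ := hs.post hi
      rw [h.mod_unique e m m' (by omega) (by omega) hm (by omega) (by omega) hm']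
    | visible _ s' t _ _ r hop' hs' hvis' hr ht =>
      rw [FirstAfter.unique hs hs'] at hvis
      exact (hvis hvis').elim
  | visible i s t κ e r hop hs hvis hr ht =>
    cases h' with
    | invisible _ s' m' _ _ hop' hs' hvis' him' hms' hm' =>
      rw [FirstAfter.unique hs hs'] at hvis
      exact (hvis' hvis).elim
    | visible _ s' t' _ _ r' hop' hs' hvis' hr' ht' =>
      have := FirstAfter.unique hs hs'
      subst this
      obtain ⟨B, hi, he⟩ := hop
      have := hr.unique hr' hs hi he
      subst this
      rw [FirstAfter.unique ht ht']
  | readOld i j m p v val hop hj hm =>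
    cases h' with
    | readOld _ j' m' _ _ _ hop' hj' hm' =>
      have := FirstAfter.unique hop.2.1 hop'.2.1
      subst this
      rw [← hm.eq, ← hm'.eq]
    | readLive _ j' m' _ _ _ hop' hj' hm' =>
      have := FirstAfter.unique hop.2.1 hop'.2.1
      subst this
      rw [hj] at hj'
      cases hj'
  | readLive i j m p v val hop hj hm =>
    cases h' with
    | readOld _ j' m' _ _ _ hop' hj' hm' =>
      have := FirstAfter.unique hop.2.1 hop'.2.1
      subst this
      rw [hj] at hj'
      cases hj'
    | readLive _ j' m' _ _ _ hop' hj' hm' =>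
      have := FirstAfter.unique hop.2.1 hop'.2.1
      subst this
      rw [← hm.eq, ← hm'.eq]

lemma LinPoint.hasOp (h : x.LinPoint eid o τ) : x.HasOp o := by
  cases h with
  | invisible i s m κ e hop => exact hop
  | visible i s t κ e r hop => exact hop
  | readOld i j m p v val hop => exact ⟨j, hop⟩
  | readLive i j m p v val hop => exact ⟨j, hop⟩

/-- Two reads of a process that are both running before step `m` are the same. -/
lemma read_unique {i i' j j' m : ℕ} {v v' : Fin n} {val val' : ℝ}
    (h : x.RespondsAt (.read i p v val) j) (h' : x.RespondsAt (.read i' p v' val') j')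
    (him : i < m) (hmj : m ≤ j) (him' : i' < m) (hmj' : m ≤ j') :
    i = i' ∧ j = j' ∧ v = v' := by
  have hA : x.Alive m := by
    obtain ⟨-, ⟨a, ha, -⟩, -⟩ := h.2.1
    exact (alive_of_ev ha).mono (by omega)
  have h1 := (reader_ne_idle h.1 him hA fun k hk hk' => h.2.1.2.2 k hk (by omega)).2
  have h2 := (reader_ne_idle h'.1 him' hA fun k hk hk' => h'.2.1.2.2 k hk (by omega)).2
  rw [h1] at h2
  subst h2
  have h3 := h.1.symm.trans h'.1
  cases h3
  exact ⟨rfl, FirstAfter.unique h.2.1 h'.2.1, rfl⟩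

include eid_range

/-- Equal times lie in the same slot, so both operations are linearized by the same event. It
identifies the operation, except that one unmarking serves many edges, which their identifiers
separate. -/
lemma LinPoint.distinct
    (eid_inj : ∀ e e' : Sym2 (Fin n), ¬ e.IsDiag → ¬ e'.IsDiag → eid e = eid e' → e = e')
    (h : x.LinPoint eid o τ) (h' : x.LinPoint eid o' τ) : o = o' := by
  obtain ⟨N, a, ha, h⟩ := h.linAt
  obtain ⟨a', ha', h'⟩ := h'.linAt_of_inSlot eid_range (h.inSlot eid_range)
  have := ha.symm.trans ha'
  cases this
  cases h with
  | invisible κ B e s hi he hb hs hNs hτ =>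
    cases h' with
    | invisible κ' B' _ s' hi' he' hb' hs' hNs' hτ' =>
      have := hi.symm.trans hi'
      cases this
      rfl
  | visible κ B e s r hi he hs hN hresp hτ =>
    cases h' with
    | visible κ' B' e' s' _ hi' he' hs' hN' hresp' hτ' =>
      have := hi.symm.trans hi'
      cases this
      have heq : eid e = eid e' := by
        rcases lt_trichotomy (eid e) (eid e') with hlt | heq | hlt
        · exact absurd (hτ.symm.trans hτ') (visTime_lt x N hlt).ne
        · exact heq
        · exact absurd (hτ.symm.trans hτ') (visTime_lt x N hlt).ne'
      rw [eid_inj e e' (hs.not_diag hi he) (hs.not_diag hi he') heq]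
  | readOld i j p v val hop hj hm hτ =>
    cases h' with
    | readOld i' j' _ v' val' hop' hj' hm' hτ' =>
      obtain ⟨rfl, rfl, rfl⟩ := read_unique hop hop' hm.1 hm.2.1.le hm'.1 hm'.2.1.le
      have := hj.symm.trans hj'
      cases this
      rfl
  | readLive i j p v val hop hj hm hτ =>
    cases h' with
    | readLive i' j' _ v' val' hop' hj' hm' hτ' =>
      obtain ⟨rfl, rfl, rfl⟩ := read_unique hop hop' hm.1 hm.2.1.le hm'.1 hm'.2.1.le
      have := hj.symm.trans hj'
      cases this
      rfl

lemma LinPoint.after_inv (h : x.LinPoint eid o τ) : x.time o.inv < τ := by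
  obtain ⟨N, a, ha, h⟩ := h.linAt
  refine lt_of_lt_of_le (x.time_mono ?_) (h.inSlot eid_range).1
  cases h with
  | invisible κ B e s hi he hb hs hNs hτ => exact hb
  | visible κ B e s r hi he hs hN hresp hτ => exact hs.1.trans hN
  | readOld i j p v val hop hj hm hτ => exact hm.1
  | readLive i j p v val hop hj hm hτ => exact hm.1

lemma LinPoint.before_resp {j : ℕ} (h : x.LinPoint eid o τ) (hj : x.RespondsAt o j) :
    τ < x.time j := by
  obtain ⟨N, a, ha, h⟩ := h.linAt
  refine lt_of_lt_of_le (h.inSlot eid_range).2 (x.time_mono.monotone (Nat.succ_le_of_lt ?_))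
  cases h with
  | invisible κ B e s hi he hb hs hNs hτ =>
    obtain ⟨-, s', h1, h2, -⟩ := root_unmarked_of_resp hi hj.2
    have := FirstAfter.unique hs h2
    have := h1.settles_lt
    omega
  | visible κ B e s r hi he hs hN hresp hτ =>
    obtain ⟨h1, ⟨a, ha', rfl⟩, -⟩ := hj.2
    by_contra hc
    exact hresp j h1 (by omega) ha'
  | readOld i j' p v val hop hj' hm hτ => rw [FirstAfter.unique hj.2.1 hop.2.1]; exact hm.2.1
  | readLive i j' p v val hop hj' hm hτ => rw [FirstAfter.unique hj.2.1 hop.2.1]; exact hm.2.1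

omit eid_range

/-- A batch that has responded has modified all its edges before settling and has unmarked all its
roots after it. -/
lemma exists_linPoint {j : ℕ} (eid : Sym2 (Fin n) → ℕ) (h : x.RespondsAt o j) :
    ∃ τ, x.LinPoint eid o τ := by
  cases o with
  | update i κ e =>
    obtain ⟨hop, hj⟩ := h
    obtain ⟨B, hi, he⟩ := id hop
    obtain ⟨-, s, h1, hs, h2⟩ := root_unmarked_of_resp hi hj
    by_cases hvis : x.Visible i s e
    · obtain ⟨v, hv, hc⟩ := id hvis
      obtain ⟨r, hr⟩ := (hs.reb hi).root v (hs.marked hi hc)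
      obtain ⟨t, h3, h4, h5⟩ := h2 r hr.2
      obtain ⟨t', -, ht'⟩ := exists_firstAfter (Q := fun a => a = .unmarkRoot r) h3 h5 rfl
      exact ⟨_, .visible i s t' κ e r hop hs hvis ⟨v, hv, hc, hr⟩ ht'⟩
    · obtain ⟨hb, h3⟩ := hs.post hi
      obtain ⟨m, h4, h5, h6⟩ := h3.mod_exists e he (by simp)
      refine ⟨_, .invisible i s m κ e hop hs hvis (hb ▸ h4) (lt_of_le_of_ne (by omega) ?_) h6⟩
      rintro rfl
      rw [hs.ev] at h6
      cases h6
  | read i p v val =>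
    rcases h.2.2 with hj | hj
    · exact ⟨_, .readOld i j _ p v val h hj (returnOld_spec h hj).1⟩
    · exact ⟨_, .readLive i j _ p v val h hj (returnLive_spec h hj).1⟩

end Points

end Execution

/-! ## The sequential execution -/

lemma SeqRun.append {n : ℕ} {P : Type*} {prm : Params} {S S' S'' : SeqState n}
    {l l' : List (Op n P)} (h : SeqRun prm S l S') (h' : SeqRun prm S' l' S'') :
    SeqRun prm S (l ++ l') S'' := by
  induction h with
  | nil S => exact h'
  | cons S S₁ S₂ o l h hl ih => exact .cons S S₁ S'' o _ h (ih h')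

lemma exists_sorted_list {α : Type*} [DecidableEq α] (f : α → ℕ) (s : Finset α)
    (hf : ∀ a ∈ s, ∀ b ∈ s, f a = f b → a = b) :
    ∃ l : List α, (∀ a, a ∈ l ↔ a ∈ s) ∧ l.Pairwise fun a b => f a < f b := by
  induction s using Finset.induction_on_max_value f with
  | empty => exact ⟨[], by simp, .nil⟩
  | insert a s has hmax ih =>
    obtain ⟨l, h1, h2⟩ := ih fun b hb c hc =>
      hf b (Finset.mem_insert_of_mem hb) c (Finset.mem_insert_of_mem hc)
    refine ⟨l ++ [a], fun b => by simp [h1, or_comm], List.pairwise_append.2 ⟨h2, by simp, ?_⟩⟩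
    intro b hb c hc
    rw [List.mem_singleton] at hc
    subst hc
    have hb' := (h1 b).1 hb
    refine lt_of_le_of_ne (hmax b hb') fun heq => has ?_
    rwa [← hf b (Finset.mem_insert_of_mem hb') c (Finset.mem_insert_self _ _) heq]

/-- The sequential object can process any list of updates of a batch. -/
lemma exists_run {G₀ : SimpleGraph (Fin n)} {L₀ : Fin n → ℕ} {κ : Kind} (P : Type*)
    (h₀ : Stable prm G₀ L₀) (i : ℕ) (l : List (Sym2 (Fin n))) (F : Set (Sym2 (Fin n)))
    (L : Fin n → ℕ) (h : Settle prm κ (applySet G₀ κ F) L₀ L) :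
    ∃ L', SeqRun prm ⟨applySet G₀ κ F, L⟩ (l.map fun e => (Op.update i κ e : Op n P))
        ⟨applySet G₀ κ (F ∪ {e | e ∈ l}), L'⟩ ∧
      Settle prm κ (applySet G₀ κ (F ∪ {e | e ∈ l})) L₀ L' := by
  induction l generalizing F L with
  | nil => exact ⟨L, by simpa using SeqRun.nil _, by simpa using h⟩
  | cons e l ih =>
    obtain ⟨L₁, h1, h2⟩ := h.exists_rebalance h₀ e
    obtain ⟨L', h3, h4⟩ := ih _ _ h2
    have hF : insert e F ∪ {e | e ∈ l} = F ∪ {e' | e' ∈ e :: l} := by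
      ext e'
      simp only [Set.mem_union, Set.mem_insert_iff, Set.mem_ofPred_eq, List.mem_cons]
      tauto
    rw [hF] at h3 h4
    refine ⟨L', .cons _ _ _ _ _ (.update _ i κ e L₁ h1) ?_, h4⟩
    rw [applyEdge_applySet]
    exact h3

namespace Execution

variable {x : Execution n P prm} {N i s t : ℕ} {κ : Kind} {B : Finset (Sym2 (Fin n))}
  {a : Event n P} {p : P} {v r : Fin n} {e : Sym2 (Fin n)} {eid : Sym2 (Fin n) → ℕ}

/-- The edges whose updates in the last batch are linearized before step `N`. -/
def done (x : Execution n P prm) (eid : Sym2 (Fin n) → ℕ) (N : ℕ) : Set (Sym2 (Fin n)) :=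
  {e | ∃ κ τ, x.LinPoint eid (.update (x.batch N) κ e) τ ∧ τ < x.time N}

/-- The edges whose updates in the last batch are linearized from step `N` on and before the next
step. -/
def fresh (x : Execution n P prm) (eid : Sym2 (Fin n) → ℕ) (N : ℕ) : Set (Sym2 (Fin n)) :=
  {e | ∃ κ τ, x.LinPoint eid (.update (x.batch N) κ e) τ ∧ x.InSlot N τ}

/-! ### The sequential state along an execution -/

lemma lt_time_succ_iff {τ : ℝ} : τ < x.time (N + 1) ↔ τ < x.time N ∨ x.InSlot N τ := by
  have := x.time_mono (Nat.lt_succ_self N)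
  constructor
  · intro h
    by_cases h' : τ < x.time N
    · exact .inl h'
    · exact .inr ⟨not_lt.1 h', h⟩
  · rintro (h | h)
    · exact h.trans this
    · exact h.2

lemma done_succ (hb : x.batch (N + 1) = x.batch N) :
    x.done eid (N + 1) = x.done eid N ∪ x.fresh eid N := by
  ext e
  simp only [done, fresh, hb, lt_time_succ_iff, Set.mem_union, Set.mem_ofPred_eq]
  constructor
  · rintro ⟨κ, τ, h, h' | h'⟩
    · exact .inl ⟨κ, τ, h, h'⟩
    · exact .inr ⟨κ, τ, h, h'⟩
  · rintro (⟨κ, τ, h, h'⟩ | ⟨κ, τ, h, h'⟩)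
    · exact ⟨κ, τ, h, .inl h'⟩
    · exact ⟨κ, τ, h, .inr h'⟩

/-- The graph of the sequential object that corresponds to the configuration before step `N`. -/
def AbsGraph (x : Execution n P prm) (eid : Sym2 (Fin n) → ℕ) (N : ℕ)
    (G : SimpleGraph (Fin n)) : Prop :=
  ((x.cfg N).phase = .quiescent → G = (x.cfg N).G) ∧
  ((x.cfg N).phase ≠ .quiescent → ∀ κ B, x.ev (x.batch N) = some (.batchInv κ B) →
    G = applySet (x.startGraph N) κ (x.done eid N))

lemma busy_hist (hA : x.Alive N) (hq : (x.cfg N).phase ≠ .quiescent) :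
    ∃ κ B todo, x.BatchHist N κ B todo := by
  by_cases hp : (x.cfg N).phase.Pre
  · obtain ⟨κ, B, todo, ℓ, task, h1, -⟩ := pre_inv hA hp
    exact ⟨κ, B, todo, h1.toBatchHist⟩
  · obtain ⟨κ, B, s, h⟩ := post_inv hA hp hq
    exact ⟨κ, B, ∅, h.toBatchHist⟩

section Range

variable (eid_range : ∀ e : Sym2 (Fin n), ¬ e.IsDiag → 1 ≤ eid e ∧ eid e ≤ n * (n - 1) / 2)

include eid_range

/-- The edges processed so far lead to the levels of the sequential object. -/
lemma settle_done (hA : x.Alive N) (hq : (x.cfg N).phase ≠ .quiescent)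
    (hi : x.ev (x.batch N) = some (.batchInv κ B)) :
    Settle prm κ (applySet (x.startGraph N) κ (x.done eid N)) (x.startLevel N) (x.absLevel N) := by
  obtain ⟨κ', B', todo, hist⟩ := busy_hist hA hq
  have := hi.symm.trans hist.inv
  cases this
  -- Which updates are invisible is known only when the batch settles, possibly after step `N`. If
  -- it never settles, none of its updates has a point.
  by_cases hex : ∃ s, x.SettlesAt (x.batch N) s
  · obtain ⟨s, hs⟩ := hex
    have hreb := hs.reb hi
    -- Before the unmarking `X` is empty, so it is closed for the final DAGs as well. In every case
    -- `X` consists of the vertices whose root has been unmarked before step `N`, which is to be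
    -- matched with the updates linearized so far.
    have habs : ∃ X, X = x.applied N ∧ Closed (x.cfg s).desc X ∧
        x.absLevel N = mix X (x.cfg s).level (x.startLevel N) ∧
        (∀ v ∈ X, ∃ r t, RootOf (x.cfg s).desc v r ∧ s < t ∧ t < N ∧
          x.ev t = some (.unmarkRoot r)) ∧
        (∀ v r t, RootOf (x.cfg s).desc v r → s < t → t < N →
          x.ev t = some (.unmarkRoot r) → v ∈ X) := by
      by_cases hp : (x.cfg N).phase.Pre
      · obtain ⟨κ', B', todo, ℓ, task, h1, h2⟩ := pre_inv hA hp
        refine ⟨∅, (applied_eq_empty h1.full).symm, fun _ _ _ => Iff.rfl, ?_, by simp, ?_⟩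
        · rw [absLevel, applied_eq_empty h1.full]
          exact funext fun v => by rw [mix_of_notMem (by simp), mix_of_notMem (by simp)]
        · intro v r t _ hst htN
          exact (h1.noUnmark s hs.1 (hst.trans htN) hs.ev).elim
      · obtain ⟨κ', B', s', h⟩ := post_inv hA hp hq
        have h := h.of_settles rfl hi hs
        refine ⟨_, rfl, h.full ▸ closed_applied x N, by rw [absLevel, h.level], ?_, ?_⟩
        · rintro v ⟨r, hr, hn⟩
          obtain ⟨t, h1, h2, h3⟩ := h.root_exists r hr.2 hn
          exact ⟨r, t, h.full ▸ hr, h1, h2, h3⟩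
        · intro v r t hr h1 h2 h3
          exact ⟨r, h.full ▸ hr, h.root_done r t h1 h2 h3⟩
    obtain ⟨X, -, hX, hL, hX1, hX2⟩ := habs
    rw [hL]
    refine hreb.settle_mix hist.stable hX ?_ ?_
    · rintro e ⟨κ', τ, h, -⟩
      obtain ⟨B', hi', he⟩ := h.hasOp
      have := hi.symm.trans hi'
      cases this
      exact he
    · intro e he v hv hc
      have hc : x.Changes (x.batch N) s v := hc.symm
      constructor
      · intro hvX
        obtain ⟨r, t, hr, h1, h2, h3⟩ := hX1 v hvX
        obtain ⟨t', h4, ht'⟩ := exists_firstAfter (Q := fun a => a = .unmarkRoot r) h1 h3 rfl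
        have hlin : x.LinPoint eid (.update (x.batch N) κ e) (x.visTime eid t' e) :=
          .visible _ s t' κ e r ⟨B, hi, he⟩ hs ⟨v, hv, hc⟩ ⟨v, hv, hc, hr⟩ ht'
        obtain ⟨h5, h6⟩ := eid_range e (hs.not_diag hi he)
        refine ⟨κ, _, hlin, (visTime_mem x t' h5 h6).2.trans_le (x.time_mono.monotone ?_)⟩
        omega
      · rintro ⟨κ', τ, h, hτ⟩
        generalize hb : x.batch N = i at *
        cases h with
        -- An invisible update has no moved endpoint, so independence of the DAGs allows it in `F`
        -- at any time.
        | invisible _ s' m _ _ hop hs' hvis =>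
          rw [FirstAfter.unique hs' hs] at hvis
          exact (hvis ⟨v, hv, hc⟩).elim
        | visible _ s' t _ _ r hop hs' hvis hr ht =>
          have := FirstAfter.unique hs' hs
          subst this
          obtain ⟨h5, h6⟩ := eid_range e (hs.not_diag hi he)
          have htN := x.time_mono.lt_iff_lt.1 ((visTime_mem x t h5 h6).1.trans hτ)
          obtain ⟨h1, ⟨a, h2, rfl⟩, -⟩ := ht
          exact hX2 v r t (hr.rootOf hs hi he hv hc) h1 htN h2
  · have hp : (x.cfg N).phase.Pre := by
      by_contra hp
      obtain ⟨κ', B', s', h⟩ := post_inv hA hp hq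
      exact hex ⟨s', h.settles⟩
    obtain ⟨κ', B', todo, ℓ, task, h1, h2⟩ := pre_inv hA hp
    have hd : x.done eid N = ∅ := by
      rw [Set.eq_empty_iff_forall_notMem]
      rintro e ⟨κ', τ, h, -⟩
      cases h with
      | invisible _ s' _ _ _ _ hs' => exact hex ⟨s', hs'⟩
      | visible _ s' _ _ _ _ _ hs' => exact hex ⟨s', hs'⟩
    have hL : x.absLevel N = x.startLevel N := by
      funext v
      rw [absLevel, applied_eq_empty h1.full]
      exact mix_of_notMem (by simp)
    rw [hd, hL, applySet_empty]
    exact ⟨.refl, ((stable_iff κ).1 hist.stable).1⟩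

/-- An update that is linearized at step `N` belongs to the batch that is running. -/
lemma fresh_spec {τ : ℝ} (ha : x.ev N = some a) (h : x.LinPoint eid (.update i κ e) τ)
    (hτ : x.InSlot N τ) : i = x.batch N ∧ (x.cfg N).phase ≠ .quiescent ∧
      (∃ B, x.ev (x.batch N) = some (.batchInv κ B) ∧ e ∈ B) ∧
      ((a = .modify e) ∨ ∃ r, a = .unmarkRoot r ∧ τ = x.visTime eid N e) := by
  have hA := (alive_of_ev ha).mono (Nat.le_succ N)
  obtain ⟨a', ha', h'⟩ := h.linAt_of_inSlot eid_range hτ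
  have := ha.symm.trans ha'
  cases this
  cases h' with
  | invisible _ B _ s hi he hb hs hNs hτ =>
    obtain ⟨-, -, hp⟩ := hs.pre hi hb hNs.le
    refine ⟨rfl, ?_, ⟨B, hi, he⟩, .inl rfl⟩
    intro hq
    rw [hq] at hp
    exact hp
  | visible _ B _ s r hi he hs hN hresp hτ =>
    exact ⟨rfl, (batch_of_busy hi (hs.1.trans hN) hA fun k hk hk' => hresp k hk hk'.le).2,
      ⟨B, hi, he⟩, .inr ⟨r, rfl, hτ⟩⟩

omit eid_range in
lemma absGraph_zero (x : Execution n P prm) : x.AbsGraph eid 0 ⊥ :=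
  ⟨fun _ => by rw [x.init]; rfl, fun h => (h (by rw [x.init]; rfl)).elim⟩

/-- The updates that are linearized at step `N` take the sequential object to the state that
corresponds to the next configuration. -/
lemma run_updates (ha : x.ev N = some a) {G : SimpleGraph (Fin n)} (hG : x.AbsGraph eid N G)
    {l : List (Sym2 (Fin n))} (hl : ∀ e, e ∈ l ↔ e ∈ x.fresh eid N)
    (hκ : (x.cfg N).phase ≠ .quiescent → ∃ B, x.ev (x.batch N) = some (.batchInv κ B)) :
    ∃ G', SeqRun prm ⟨G, x.absLevel N⟩
        (l.map fun e => (Op.update (x.batch N) κ e : Op n P)) ⟨G', x.absLevel (N + 1)⟩ ∧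
      x.AbsGraph eid (N + 1) G' := by
  have hA' := alive_of_ev ha
  have hA := hA'.mono (Nat.le_succ N)
  by_cases hq : (x.cfg N).phase = .quiescent
  · have hnil : l = [] := by
      refine List.eq_nil_iff_forall_not_mem.2 fun e he => ?_
      obtain ⟨κ', τ, h, hτ⟩ := (hl e).1 he
      exact (fresh_spec eid_range ha h hτ).2.1 hq
    subst hnil
    have hcases : ((x.cfg (N + 1)).phase = .quiescent ∨
        ((∃ κ B, (x.cfg (N + 1)).phase = .invoked κ B) ∧ x.batch (N + 1) = N)) ∧
        (x.cfg (N + 1)).G = (x.cfg N).G ∧ (x.cfg (N + 1)).level = (x.cfg N).level := by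
      rcases step_cases ha with hu | ⟨p', s', hs, hc'⟩
      · generalize hc' : x.cfg (N + 1) = c' at hu
        cases hu with
        | invoke κ B hph hB => exact ⟨.inr ⟨⟨κ, B, rfl⟩, batch_succ_inv ha⟩, rfl, rfl⟩
        | _ => simp_all
      · rw [hc']
        exact ⟨.inl hq, rfl, rfl⟩
    obtain ⟨hph, hcG, hcL⟩ := hcases
    have hact : ¬ (x.cfg (N + 1)).phase.Active := by
      rcases hph with h | ⟨⟨κ, B, h⟩, -⟩ <;> rw [h] <;> exact id
    have hlev : x.absLevel (N + 1) = x.absLevel N := by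
      rw [absLevel_of_not_active hA' hact, absLevel_of_not_active hA (by rw [hq]; exact id), hcL]
    refine ⟨G, by rw [hlev]; exact .nil _, fun _ => (hG.1 hq).trans hcG.symm, fun hne κ B hi => ?_⟩
    have hb := (hph.resolve_left hne).2
    -- A point of the batch invoked at this very step would lie in the slot of the step, but that
    -- slot only holds updates of a batch that was already running.
    have hd : x.done eid (N + 1) = ∅ := by
      rw [Set.eq_empty_iff_forall_notMem]
      rintro e ⟨κ', τ, h, hτ⟩
      rw [hb] at h
      have h1 : x.time N < τ := h.after_inv eid_range
      obtain ⟨-, h2, -⟩ := fresh_spec eid_range ha h ⟨h1.le, hτ⟩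
      exact h2 hq
    rw [hd, applySet_empty, startGraph, hb]
    exact hG.1 hq
  · obtain ⟨B, hi⟩ := hκ hq
    obtain ⟨κ', B', todo, hist⟩ := busy_hist hA hq
    have := hi.symm.trans hist.inv
    cases this
    have hb : x.batch (N + 1) = x.batch N :=
      batch_succ ha fun κ B h => hq ((phase_succ ha).2.2.1 κ B h).1
    have hset := settle_done eid_range hA hq hi
    have hGN := hG.2 hq κ B hi
    subst hGN
    obtain ⟨L', h1, h2⟩ := exists_run P hist.stable (x.batch N) l _ _ hset
    have hfresh : x.done eid N ∪ {e | e ∈ l} = x.done eid (N + 1) := by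
      rw [done_succ hb]
      congr 1
      ext e
      exact hl e
    rw [hfresh] at h1 h2
    -- At the response the sequential state is compared with the live graph and levels, so all edges
    -- of the batch must be done by then. Otherwise uniqueness of the settled levels identifies the
    -- end of the run with the next abstract state.
    by_cases hq' : (x.cfg (N + 1)).phase = .quiescent
    · have hresp : a = .batchResp := by
        by_contra hne
        exact (phase_succ ha).2.1 hq hne hq'
      subst hresp
      have hph := ((phase_succ ha).2.2.2.2.1 rfl).1
      have hfirst : x.FirstAfter (fun a => a = .batchResp) (x.batch N) N :=
        ⟨hist.lt, ⟨_, ha, rfl⟩, fun k hk hk' a ha' he => hist.noResp k hk hk' (by rw [ha', he])⟩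
      obtain ⟨-, s, h3, hs, -⟩ := root_unmarked_of_resp hi hfirst
      have hcfg : (x.cfg (N + 1)).G = (x.cfg N).G ∧ (x.cfg (N + 1)).level = (x.cfg N).level ∧
          ∀ v, (x.cfg N).desc v = none := by
        rcases step_cases ha with hu | ⟨p', s', hs, -⟩
        · generalize x.cfg (N + 1) = c' at hu
          cases hu with
          | respond hph hv => exact ⟨rfl, rfl, hv⟩
        · generalize (x.cfg N).reader p' = s at hs
          cases hs
      have hd : x.done eid (N + 1) = ↑B := by
        ext e
        constructor
        · rintro ⟨κ', τ, h, -⟩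
          obtain ⟨B', hi', he⟩ := h.hasOp
          rw [hb, hi] at hi'
          cases hi'
          exact he
        · intro he
          have hr : x.RespondsAt (.update (x.batch N) κ e) N := ⟨⟨B, hi, he⟩, hfirst⟩
          obtain ⟨τ, hτ⟩ := exists_linPoint eid hr
          exact ⟨κ, τ, hb ▸ hτ, (hτ.before_resp eid_range hr).trans
            (x.time_mono (Nat.lt_succ_self N))⟩
      have hlev : L' = x.absLevel (N + 1) := by
        have h4 := h3.reb.settle_mix h3.stable (X := Set.univ) (fun _ _ _ => Iff.rfl) subset_rfl
          fun e he _ _ _ => by simpa using he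
        rw [← hd] at h4
        rw [h2.unique h4, absLevel_of_not_active hA' (by rw [hq']; exact id), hcfg.2.1]
        exact funext fun v => mix_of_mem (Set.mem_univ v)
      subst hlev
      refine ⟨_, h1, fun _ => ?_, fun h => (h hq').elim⟩
      rw [hd, hcfg.1, h3.graph_final]
    · have h3 := settle_done eid_range hA' hq' (hb ▸ hi)
      rw [startGraph_of_batch hb, startLevel_of_batch hb] at h3
      have hlev : L' = x.absLevel (N + 1) := h2.unique h3
      subst hlev
      refine ⟨_, h1, fun h => (hq' h).elim, fun _ κ' B' hi' => ?_⟩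
      rw [hb, hi] at hi'
      cases hi'
      rw [startGraph_of_batch hb]

/-- The operations that are linearized from step `N` on and before the next step take the sequential
object to the state that corresponds to the next configuration. -/
lemma run_step
    (eid_inj : ∀ e e' : Sym2 (Fin n), ¬ e.IsDiag → ¬ e'.IsDiag → eid e = eid e' → e = e')
    (ha : x.ev N = some a) {G : SimpleGraph (Fin n)} (hG : x.AbsGraph eid N G) :
    ∃ (l : List (Op n P)) (G' : SimpleGraph (Fin n)),
      (∀ o, o ∈ l ↔ ∃ τ, x.LinPoint eid o τ ∧ x.InSlot N τ) ∧
      l.Pairwise (fun o o' => ∀ τ τ', x.LinPoint eid o τ → x.LinPoint eid o' τ' → τ < τ') ∧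
      SeqRun prm ⟨G, x.absLevel N⟩ l ⟨G', x.absLevel (N + 1)⟩ ∧ x.AbsGraph eid (N + 1) G' := by
  classical
  have hA := (alive_of_ev ha).mono (Nat.le_succ N)
  have hκ : ∃ κ, (x.cfg N).phase ≠ .quiescent →
      ∃ B, x.ev (x.batch N) = some (.batchInv κ B) := by
    by_cases hq : (x.cfg N).phase = .quiescent
    · exact ⟨.insertion, fun h => (h hq).elim⟩
    · obtain ⟨κ, B, todo, h⟩ := busy_hist hA hq
      exact ⟨κ, fun _ => ⟨B, h.inv⟩⟩
  obtain ⟨κ, hκ⟩ := hκ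
  have hupd : ∀ {i κ' e τ}, x.LinPoint eid (.update i κ' e) τ → x.InSlot N τ →
      i = x.batch N ∧ κ' = κ ∧ ¬ e.IsDiag := by
    intro i κ' e τ h hτ
    obtain ⟨h1, hq, ⟨B, hi, he⟩, -⟩ := fresh_spec eid_range ha h hτ
    obtain ⟨B', hi'⟩ := hκ hq
    have := hi.symm.trans hi'
    cases this
    obtain ⟨_, _, _, hist⟩ := busy_hist hA hq
    have := hi.symm.trans hist.inv
    cases this
    exact ⟨h1, rfl, hist.diag e he⟩
  -- If a read is linearized at this step, the event is a reading of memory, so the slot holds no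
  -- update, and by distinctness it holds no other read.
  by_cases hread : ∃ i p v val, x.LinPoint eid (.read i p v val) (x.time N)
  · obtain ⟨i, p, v, val, h⟩ := hread
    have hN := inSlot_self x N
    have hval : val = prm.estimate n (x.absLevel N v) ∧
        (a = .readDesc p ∨ a = .readL2 p) := by
      obtain ⟨a', ha', h'⟩ := h.linAt_of_inSlot eid_range hN
      have := ha.symm.trans ha'
      cases this
      cases h' with
      | readOld _ j _ _ _ hop hj hm hτ =>
        refine ⟨?_, .inl rfl⟩
        have := (returnOld_spec hop hj).2
        rwa [hm.eq] at this
      | readLive _ j _ _ _ hop hj hm hτ =>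
        refine ⟨?_, .inr rfl⟩
        have := (returnLive_spec hop hj).2
        rwa [hm.eq] at this
    have hmem : ∀ o, (∃ τ, x.LinPoint eid o τ ∧ x.InSlot N τ) ↔ o = .read i p v val := by
      intro o
      constructor
      · rintro ⟨τ, ho, hτ⟩
        obtain ⟨a', ha', h'⟩ := ho.linAt_of_inSlot eid_range hτ
        have := ha.symm.trans ha'
        cases this
        have hτ : τ = x.time N := by
          cases h' with
          | invisible => simp at hval
          | visible => simp at hval
          | readOld _ _ _ _ _ _ _ _ hτ => exact hτ
          | readLive _ _ _ _ _ _ _ _ hτ => exact hτ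
        subst hτ
        exact ho.distinct eid_range eid_inj h
      · rintro rfl
        exact ⟨_, h, hN⟩
    obtain ⟨G', h1, h2⟩ := run_updates (κ := κ) eid_range ha hG (l := []) (fun e => by
      simp only [List.not_mem_nil, false_iff]
      rintro ⟨κ', τ, h1, h2⟩
      have := (hmem _).1 ⟨τ, h1, h2⟩
      cases this) hκ
    refine ⟨[.read i p v val], G', fun o => by rw [hmem]; simp, by simp, ?_, h2⟩
    rw [hval.1]
    exact .cons _ _ _ _ _ (.read _ i p v) h1
  · have hisupd : ∀ {o τ}, x.LinPoint eid o τ → x.InSlot N τ →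
        ∃ e, e ∈ x.fresh eid N ∧ o = .update (x.batch N) κ e := by
      intro o τ h hτ
      cases o with
      | update i κ' e =>
        obtain ⟨rfl, rfl, -⟩ := hupd h hτ
        exact ⟨e, ⟨_, τ, h, hτ⟩, rfl⟩
      | read i p v val =>
        obtain ⟨a', ha', h'⟩ := h.linAt_of_inSlot eid_range hτ
        refine (hread ⟨i, p, v, val, ?_⟩).elim
        cases h' with
        | readOld _ _ _ _ _ _ _ _ hτ => exact hτ ▸ h
        | readLive _ _ _ _ _ _ _ _ hτ => exact hτ ▸ h
    have hfresh : ∀ {e}, e ∈ x.fresh eid N →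
        ∃ τ, x.LinPoint eid (.update (x.batch N) κ e) τ ∧ x.InSlot N τ := by
      rintro e ⟨κ', τ, h, hτ⟩
      obtain ⟨-, rfl, -⟩ := hupd h hτ
      exact ⟨τ, h, hτ⟩
    -- The order of the updates is irrelevant for the resulting levels, so they can be run in the
    -- order of their points, that is, of their identifiers.
    obtain ⟨l, hl, hsort⟩ := exists_sorted_list eid (Set.toFinite (x.fresh eid N)).toFinset
      fun e he e' he' heq => by
        rw [Set.Finite.mem_toFinset] at he he'
        obtain ⟨τ, h1, h2⟩ := hfresh he
        obtain ⟨τ', h1', h2'⟩ := hfresh he'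
        exact eid_inj e e' (hupd h1 h2).2.2 (hupd h1' h2').2.2 heq
    simp only [Set.Finite.mem_toFinset] at hl
    obtain ⟨G', h1, h2⟩ := run_updates eid_range ha hG hl hκ
    refine ⟨_, G', fun o => ?_, ?_, h1, h2⟩
    · rw [List.mem_map]
      constructor
      · rintro ⟨e, he, rfl⟩
        exact hfresh ((hl e).1 he)
      · rintro ⟨τ, h, hτ⟩
        obtain ⟨e, he, rfl⟩ := hisupd h hτ
        exact ⟨e, (hl e).2 he, rfl⟩
    · refine List.pairwise_map.2 (hsort.imp_of_mem fun {e e'} he he' hlt τ τ' h h' => ?_)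
      obtain ⟨τ₀, h3, h4⟩ := hfresh ((hl e).1 he)
      obtain ⟨τ₁, h3', h4'⟩ := hfresh ((hl e').1 he')
      obtain rfl := h.unique h3
      obtain rfl := h'.unique h3'
      obtain ⟨-, -, -, h5⟩ := fresh_spec eid_range ha h3 h4
      obtain ⟨-, -, -, h5'⟩ := fresh_spec eid_range ha h3' h4'
      -- A modification linearizes at most one edge, so two different updates in one slot both stem
      -- from an unmarking.
      rcases h5 with rfl | ⟨r, rfl, h5⟩ <;> rcases h5' with h5' | ⟨r', h5', h6⟩
      · cases h5'
        exact absurd hlt (lt_irrefl _)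
      · cases h5'
      · cases h5'
      · rw [h5, h6]
        exact visTime_lt x N hlt

/-- The slots are run one after the other. The link with the configuration is asserted only while
the execution lasts, since later configurations are meaningless; later slots contain no points, and
the list no longer changes. -/
lemma exists_run_before
    (eid_inj : ∀ e e' : Sym2 (Fin n), ¬ e.IsDiag → ¬ e'.IsDiag → eid e = eid e' → e = e')
    (x : Execution n P prm) (N : ℕ) : ∃ l : List (Op n P),
    (∀ o, o ∈ l ↔ ∃ τ, x.LinPoint eid o τ ∧ τ < x.time N) ∧
    l.Pairwise (fun o o' => ∀ τ τ', x.LinPoint eid o τ → x.LinPoint eid o' τ' → τ < τ') ∧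
    ∃ S, SeqRun prm (SeqState.init n) l S ∧
      (x.Alive N → S.level = x.absLevel N ∧ x.AbsGraph eid N S.G) := by
  induction N with
  | zero =>
    refine ⟨[], fun o => ?_, .nil, _, .nil _, fun hA => ⟨?_, absGraph_zero x⟩⟩
    · simp only [List.not_mem_nil, false_iff]
      rintro ⟨τ, h, hτ⟩
      have := (x.time_mono.monotone (Nat.zero_le _)).trans_lt (h.after_inv eid_range)
      exact absurd hτ this.not_gt
    · rw [absLevel_of_not_active hA (by rw [x.init]; exact id), x.init]
      rfl
  | succ N ih =>
    obtain ⟨l, h1, h2, S, h3, h4⟩ := ih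
    cases ha : x.ev N with
    | none =>
      refine ⟨l, fun o => ?_, h2, S, h3, fun hA => (hA N (Nat.lt_succ_self N) ha).elim⟩
      rw [h1]
      simp only [lt_time_succ_iff]
      constructor
      · rintro ⟨τ, h, hτ⟩
        exact ⟨τ, h, .inl hτ⟩
      · rintro ⟨τ, h, hτ | hτ⟩
        · exact ⟨τ, h, hτ⟩
        · obtain ⟨a, ha', -⟩ := h.linAt_of_inSlot eid_range hτ
          rw [ha] at ha'
          cases ha'
    | some a =>
      obtain ⟨h5, h6⟩ := h4 ((alive_of_ev ha).mono (Nat.le_succ N))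
      obtain ⟨l', G', h7, h8, h9, h10⟩ := run_step eid_range eid_inj ha h6
      have hS : S = ⟨S.G, x.absLevel N⟩ := by rw [← h5]
      rw [hS] at h3
      refine ⟨l ++ l', fun o => ?_,
        List.pairwise_append.2 ⟨h2, h8, fun o ho o' ho' τ τ' h h' => ?_⟩,
        _, h3.append h9, fun _ => ⟨rfl, h10⟩⟩
      · rw [List.mem_append, h1, h7]
        simp only [lt_time_succ_iff]
        constructor
        · rintro (⟨τ, h, hτ⟩ | ⟨τ, h, hτ⟩)
          · exact ⟨τ, h, .inl hτ⟩
          · exact ⟨τ, h, .inr hτ⟩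
        · rintro ⟨τ, h, hτ | hτ⟩
          · exact .inl ⟨τ, h, hτ⟩
          · exact .inr ⟨τ, h, hτ⟩
      · obtain ⟨τ₀, h11, h12⟩ := (h1 o).1 ho
        obtain ⟨τ₁, h13, h14⟩ := (h7 o').1 ho'
        rw [h.unique h11, h'.unique h13]
        exact h12.trans_le h14.1

theorem linearizedBy
    (eid_inj : ∀ e e' : Sym2 (Fin n), ¬ e.IsDiag → ¬ e'.IsDiag → eid e = eid e' → e = e')
    (x : Execution n P prm) : x.LinearizedBy (x.LinPoint eid) where
  unique _ _ _ h h' := h.unique h'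
  hasOp _ _ h := h.hasOp
  total _ _ h := exists_linPoint eid h
  after_inv _ _ h := h.after_inv eid_range
  before_resp _ _ _ h hj := h.before_resp eid_range hj
  distinct _ _ _ h h' := h.distinct eid_range eid_inj h'
  legal N := by
    obtain ⟨l, h1, h2, S, h3, -⟩ := exists_run_before eid_range eid_inj x N
    exact ⟨l, h1, h2, S, h3⟩

end Range

end Execution

end CPLDS

theorem mainTheorem1 {n : ℕ} {P : Type*} [DecidableEq P] (prm : CPLDS.Params)
    (eid : Sym2 (Fin n) → ℕ)
    (eid_inj : ∀ e e' : Sym2 (Fin n), ¬ e.IsDiag → ¬ e'.IsDiag → eid e = eid e' → e = e')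
    (eid_range : ∀ e : Sym2 (Fin n), ¬ e.IsDiag → 1 ≤ eid e ∧ eid e ≤ n * (n - 1) / 2)
    (x : CPLDS.Execution n P prm) :
    x.SameDAG ∧ x.UniqueDAG ∧ x.LinearizedBy (x.LinPoint eid) := by
  exact ⟨x.sameDAG, x.uniqueDAG, x.linearizedBy eid_range eid_inj⟩
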